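/- Let $M$ be a smooth manifold (finite-dimensional, Hausdorff, second countable, without boundary) and let $A\to M$ be a smooth real vector bundle of finite rank with a Lie algebroid structure: an $\mathbb{R}$-bilinear Lie bracket $[\cdot,\cdot]$ on $\Gamma(A)$ and a bundle map $\rho:A\to TM$ (the anchor) with $[\alpha,f\beta]=f[\alpha,\beta]+\rho(\alpha)(f)\beta$. Assume that $A$ is regular, i.e. that $\rho$ has constant rank. For a vector bundle $E$ over $M$ and $\nabla:\Gamma(A)\times\Gamma(E)\to\Gamma(E)$, let $C^n(A;E)$ be the space of alternating $C^\infty(M)$-multilinear maps $\Gamma(A)^n\to\Gamma(E)$, with $$(\delta\eta)(\alpha_0,\dots,\alpha_n)=\sum_i(-1)^i\nabla_{\alpha_i}\big(\eta(\alpha_0,\dots,\widehat{\alpha_i},\dots,\alpha_n)\big)+\sum_{i<j}(-1)^{i+j}\eta([\alpha_i,\alpha_j],\alpha_0,\dots,\widehat{\alpha_i},\dots,\widehat{\alpha_j},\dots,\alpha_n),\qquad(*)$$ and let $H^*(A;E)$ be the cohomology when $\nabla$ is a representation. This is applied to the isotropy representation $\mathfrak g(A)=\ker\rho$, $\nabla_\alpha\beta=[\alpha,\beta]$,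 and to the normal bundle $\nu=TM/\rho(A)$ of the induced foliation with the Bott connection $\nabla_\alpha\overline X=\overline{[\rho(\alpha),X]}$. The deformation complex is given by $C_{def}^0(A)=\Gamma(A)$ and, for $n\ge1$, by the space $C^n_{def}(A)$ of alternating $\mathbb{R}$-multilinear maps $D:\Gamma(A)^n\to\Gamma(A)$ together with an alternating $C^\infty(M)$-multilinear map $\sigma_D:\Gamma(A)^{n-1}\to\mathfrak X(M)$ (the symbol) such that $$D(s_1,\dots,s_{n-1},fs_n)=fD(s_1,\dots,s_n)+\sigma_D(s_1,\dots,s_{n-1})(f)\,s_n\qquad(f\in C^\infty(M)).$$ (If $A$ has positive rank, $\sigma_D$ is determined by $D$; if $A$ has rank zero it is part of the data.) The differential $\delta D$ is given by $(*)$ with $\nabla_\alpha=[\alpha,\cdot]$; its symbol is $\sigma_{\delta D}=\delta(\sigma_D)+(-1)^{n-1}\rho\circ D$ for $D\in C^n_{def}(A)$, $n\ge1$, where $\delta(\sigma_D)$ is given by $(*)$ with $\nabla_\alpha=[\rho(\alpha),\cdot]$, and $\sigma_{\delta\beta}=-\rho(\beta)$ for $\beta\in\Gamma(A)=C^0_{def}(A)$.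 Let $H^*_{def}(A)$ be the cohomology of this complex. Then there is a long exact sequence $$\cdots\to H^n(A;\mathfrak g(A))\xrightarrow{\ j\ }H^n_{def}(A)\xrightarrow{\ p\ }H^{n-1}(A;\nu)\xrightarrow{\ \partial\ }H^{n+1}(A;\mathfrak g(A))\to\cdots\qquad(n\ge0),$$ with $H^{-1}(A;\nu)=0$, starting with $0\to H^0(A;\mathfrak g(A))\to H^0_{def}(A)\to0$ and $0\to H^1(A;\mathfrak g(A))\to H^1_{def}(A)\to H^0(A;\nu)\to\cdots$. Here $j$ is induced by the inclusion $C^n(A;\mathfrak g(A))\subset C^n_{def}(A)$ (as elements of zero symbol), $p$ is induced by $D\mapsto\overline{\sigma_D}=\sigma_D\bmod\rho(A)$, and $\partial$ is the connecting map: for every cocycle $c\in C^{n-1}(A;\nu)$ there are $D\in C^n_{def}(A)$ and a cocycle $\eta\in C^{n+1}(A;\mathfrak g(A))$ with $\overline{\sigma_D}=c$ and $\delta D=\eta$, and $\partial[c]=[\eta]$ for every such choice. In particular, if $A$ is transitive ($\rho$ is surjective), then $j:H^n(A;\mathfrak g(A))\to H^n_{def}(A)$ is an isomorphism for all $n\ge0$.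 -/

import Mathlib

open scoped Manifold ContDiff Bundle Topology
open Bundle

noncomputable section

namespace LieAlgebroidDeformation

/-- The ring `C^∞(M)` of smooth real functions. -/
abbrev SmoothFun (E : Type*) [NormedAddCommGroup E] [NormedSpace ℝ E]
    (M : Type*) [TopologicalSpace M] [ChartedSpace E M] : Type _ :=
  C^∞⟮𝓘(ℝ, E), M; 𝓘(ℝ, ℝ), ℝ⟯

/-- The space `𝔛(M)` of smooth vector fields. -/
abbrev VecField (E : Type*) [NormedAddCommGroup E] [NormedSpace ℝ E]
    (M : Type*) [TopologicalSpace M] [ChartedSpace E M] [IsManifold 𝓘(ℝ, E) ∞ M] : Type _ :=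
  Cₛ^∞⟮𝓘(ℝ, E); E, (TangentSpace 𝓘(ℝ, E) : M → Type _)⟯

/-- The space `Γ(V)` of smooth sections of a vector bundle `V → M` with model fibre `F`. -/
abbrev Sec (E : Type*) [NormedAddCommGroup E] [NormedSpace ℝ E]
    (F : Type*) [NormedAddCommGroup F] [NormedSpace ℝ F]
    {M : Type*} [TopologicalSpace M] [ChartedSpace E M]
    (V : M → Type*) [TopologicalSpace (TotalSpace F V)] [∀ x, TopologicalSpace (V x)]
    [FiberBundle F V] : Type _ :=
  Cₛ^∞⟮𝓘(ℝ, E); F, V⟯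

section SectionModule

variable {E : Type*} [NormedAddCommGroup E] [NormedSpace ℝ E]
  {F : Type*} [NormedAddCommGroup F] [NormedSpace ℝ F]
  {M : Type*} [TopologicalSpace M] [ChartedSpace E M]
  {V : M → Type*} [TopologicalSpace (TotalSpace F V)] [∀ x, TopologicalSpace (V x)]
  [FiberBundle F V] [∀ x, AddCommGroup (V x)] [∀ x, Module ℝ (V x)] [VectorBundle ℝ F V]

instance : SMul (SmoothFun E M) (Sec E F V) :=
  ⟨fun f s => ⟨fun x => f x • s x, f.contMDiff.smul_section s.contMDiff⟩⟩

@[simp]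
theorem smul_sec_apply (f : SmoothFun E M) (s : Sec E F V) (x : M) : (f • s) x = f x • s x :=
  rfl

/-- Sections form a module over `C^∞(M)`, pointwise. -/
instance : Module (SmoothFun E M) (Sec E F V) where
  one_smul s := by ext x; simp
  mul_smul f g s := by ext x; simp [mul_smul]
  smul_zero f := by ext x; simp
  smul_add f s t := by ext x; simp
  add_smul f g s := by ext x; simp [add_smul]
  zero_smul s := by ext x; simp

instance : IsScalarTower ℝ (SmoothFun E M) (Sec E F V) where
  smul_assoc c f s := by ext x; simp [mul_smul]

instance : SMulCommClass (SmoothFun E M) ℝ (Sec E F V) where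
  smul_comm f c s := by ext x; exact smul_comm (f x) c (s x)

instance : SMulCommClass ℝ (SmoothFun E M) (Sec E F V) where
  smul_comm c f s := by ext x; exact smul_comm c (f x) (s x)

end SectionModule

section VectorFields

variable {E : Type*} [NormedAddCommGroup E] [NormedSpace ℝ E]
  {M : Type*} [TopologicalSpace M] [ChartedSpace E M] [IsManifold 𝓘(ℝ, E) ∞ M]

/-- The derivative `X(f)` of a smooth function along a vector field. -/
def lieDeriv (X : VecField E M) (f : SmoothFun E M) : SmoothFun E M :=
  ⟨fun x => mvfderiv 𝓘(ℝ, E) f x (X x), by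
    have h := (contMDiff_snd_tangentBundle_modelSpace ℝ 𝓘(ℝ, ℝ) (n := ∞)).comp
      ((f.contMDiff.contMDiff_tangentMap (m := ∞) (n := ∞) (by simp)).comp X.contMDiff)
    exact h⟩

theorem lieDeriv_apply (X : VecField E M) (f : SmoothFun E M) (x : M) :
    lieDeriv X f x = mvfderiv 𝓘(ℝ, E) f x (X x) := rfl

variable [FiniteDimensional ℝ E]

/-- The Lie bracket of vector fields. -/
def vecBracket : VecField E M →ₗ[ℝ] VecField E M →ₗ[ℝ] VecField E M :=
  have : CompleteSpace E := FiniteDimensional.complete ℝ E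
  have : IsManifold 𝓘(ℝ, E) (minSmoothness ℝ 2) M := by
    rw [minSmoothness_of_isRCLikeNormedField]; infer_instance
  have : IsManifold 𝓘(ℝ, E) (((⊤ : ℕ∞) : WithTop ℕ∞) + 1) M :=
    inferInstanceAs (IsManifold 𝓘(ℝ, E) ∞ M)
  LinearMap.mk₂ ℝ
    (fun X Y => ⟨VectorField.mlieBracket 𝓘(ℝ, E) X Y,
      ContDiff.mlieBracket_vectorField (m := ⊤) (n := ⊤) X.contMDiff Y.contMDiff (by simp)⟩)
    (fun X Y Z => by
      ext x; exact VectorField.mlieBracket_add_left X.mdifferentiableAt Y.mdifferentiableAt)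
    (fun c X Z => by
      ext x; exact VectorField.mlieBracket_const_smul_left X.mdifferentiableAt)
    (fun X Y Z => by
      ext x; exact VectorField.mlieBracket_add_right Y.mdifferentiableAt Z.mdifferentiableAt)
    (fun c X Z => by
      ext x; exact VectorField.mlieBracket_const_smul_right Z.mdifferentiableAt)

theorem vecBracket_apply (X Y : VecField E M) (x : M) :
    vecBracket X Y x = VectorField.mlieBracket 𝓘(ℝ, E) X Y x := rfl

theorem vecBracket_smul (X Y : VecField E M) (f : SmoothFun E M) :
    vecBracket X (f • Y) = f • vecBracket X Y + lieDeriv X f • Y := by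
  ext x
  exact (VectorField.mlieBracket_smul_right (f.contMDiff.mdifferentiable (by simp) x)
    Y.mdifferentiableAt).trans (add_comm _ _)

theorem vecBracket_jacobi (X Y Z : VecField E M) :
    vecBracket X (vecBracket Y Z)
      = vecBracket (vecBracket X Y) Z + vecBracket Y (vecBracket X Z) := by
  have : CompleteSpace E := FiniteDimensional.complete ℝ E
  have h2 : minSmoothness ℝ 2 ≤ (∞ : WithTop ℕ∞) := by
    rw [minSmoothness_of_isRCLikeNormedField]; exact WithTop.coe_le_coe.2 (le_top : (2 : ℕ∞) ≤ ⊤)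
  ext x
  have : IsManifold 𝓘(ℝ, E) (minSmoothness ℝ 3) M := by
    rw [minSmoothness_of_isRCLikeNormedField]; infer_instance
  exact VectorField.leibniz_identity_mlieBracket_apply
    (X.contMDiff.of_le h2 x) (Y.contMDiff.of_le h2 x) (Z.contMDiff.of_le h2 x)

end VectorFields

section Extension

variable {E : Type*} [NormedAddCommGroup E] [NormedSpace ℝ E] [FiniteDimensional ℝ E]
  {F : Type*} [NormedAddCommGroup F] [NormedSpace ℝ F]
  {M : Type*} [TopologicalSpace M] [ChartedSpace E M] [IsManifold 𝓘(ℝ, E) ∞ M]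
  [T2Space M]

theorem exists_sec_eq [SigmaCompactSpace M]
    {V : M → Type*} [TopologicalSpace (TotalSpace F V)] [∀ x, TopologicalSpace (V x)]
    [FiberBundle F V] [∀ x, AddCommGroup (V x)] [∀ x, Module ℝ (V x)] [VectorBundle ℝ F V]
    [ContMDiffVectorBundle ∞ F V 𝓘(ℝ, E)] (x₀ : M) (w : V x₀) :
    ∃ s : Sec E F V, s x₀ = w := by
  classical
  have key := exists_contMDiffSection_forall_mem_convex_of_local (n := ⊤) 𝓘(ℝ, E) (F_fiber := F) V
    (fun x => {v | ∀ h : x = x₀, h ▸ v = w}) ?_ ?_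
  · obtain ⟨s, hs⟩ := key
    exact ⟨s, hs x₀ rfl⟩
  · intro x
    by_cases h : x = x₀
    · subst h
      simp
    · have : {v : V x | ∀ h : x = x₀, h ▸ v = w} = Set.univ := by
        ext v; simp [h]
      rw [this]; exact convex_univ
  · intro x
    by_cases h : x = x₀
    · subst h
      obtain ⟨u, hu, hs⟩ := FiberBundle.exists_contMDiffOn_extend (k := ∞) 𝓘(ℝ, E) F w
      refine ⟨u, hu, FiberBundle.extend F w, hs, ?_⟩
      rintro y - h
      subst h
      simp
    · refine ⟨{x₀}ᶜ, isOpen_compl_singleton.mem_nhds h, fun _ => 0,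
        ((contMDiff_zeroSection ℝ V).of_le le_top).contMDiffOn, ?_⟩
      intro y hy h
      exact absurd h hy

theorem eq_zero_of_forall_mvfderiv {x₀ : M} {v : TangentSpace 𝓘(ℝ, E) x₀}
    (h : ∀ f : SmoothFun E M, mvfderiv 𝓘(ℝ, E) f x₀ v = 0) : v = 0 := by
  obtain ⟨b⟩ : Nonempty (SmoothBumpFunction 𝓘(ℝ, E) x₀) := inferInstance
  let φ : M → E := extChartAt 𝓘(ℝ, E) x₀
  have hsm : ContMDiff 𝓘(ℝ, E) 𝓘(ℝ, E) ∞ (fun x => b x • φ x) :=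
    b.contMDiff_smul (contMDiffOn_extChartAt)
  have hφ : MDifferentiableAt 𝓘(ℝ, E) 𝓘(ℝ, E) φ x₀ :=
    mdifferentiableAt_extChartAt (mem_chart_source E x₀)
  have hinv := isInvertible_mfderiv_extChartAt (I := 𝓘(ℝ, E)) (mem_extChartAt_source (I := 𝓘(ℝ, E)) x₀)
  have hz : mfderiv 𝓘(ℝ, E) 𝓘(ℝ, E) φ x₀ v = 0 := by
    by_contra hne
    obtain ⟨l, hl⟩ : ∃ l : E →L[ℝ] ℝ, l (mfderiv 𝓘(ℝ, E) 𝓘(ℝ, E) φ x₀ v) ≠ 0 := by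
      by_contra! hcon
      exact hne (SeparatingDual.eq_zero_of_forall_dual_eq_zero (R := ℝ) (V := E) hcon)
    apply hl
    have hf := h ⟨fun x => l (b x • φ x), l.contMDiff.comp hsm⟩
    have heq : (fun x => l (b x • φ x)) =ᶠ[𝓝 x₀] l ∘ φ := by
      filter_upwards [b.eventuallyEq_one] with x hx
      simp [hx]
    have : mfderiv 𝓘(ℝ, E) 𝓘(ℝ, ℝ) (fun x => l (b x • φ x)) x₀
        = (l.comp (mfderiv 𝓘(ℝ, E) 𝓘(ℝ, E) φ x₀) : E →L[ℝ] ℝ) := by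
      rw [heq.mfderiv_eq, mfderiv_comp x₀ l.mdifferentiableAt hφ]
      rw [ContinuousLinearMap.mfderiv_eq]
      rfl
    have h2 : mfderiv 𝓘(ℝ, E) 𝓘(ℝ, ℝ) (fun x => l (b x • φ x)) x₀ v = (0 : ℝ) := hf
    rw [this] at h2
    exact h2
  obtain ⟨e, he⟩ := hinv
  have : e v = 0 := by
    have := congrArg (fun T => T v) he
    exact this.trans hz
  exact e.injective (this.trans (map_zero e).symm)

end Extension

/-- A Lie algebroid structure on the smooth vector bundle `V → M`: a smooth bundle map
`ρ : V → TM` and a Lie bracket on `Γ(V)` satisfying the Leibniz identity. -/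
structure LieAlgebroid (E : Type*) [NormedAddCommGroup E] [NormedSpace ℝ E]
    (F : Type*) [NormedAddCommGroup F] [NormedSpace ℝ F]
    {M : Type*} [TopologicalSpace M] [ChartedSpace E M] [IsManifold 𝓘(ℝ, E) ∞ M]
    (V : M → Type*) [TopologicalSpace (TotalSpace F V)] [∀ x, TopologicalSpace (V x)]
    [FiberBundle F V] [∀ x, AddCommGroup (V x)] [∀ x, Module ℝ (V x)] [VectorBundle ℝ F V] where
  /-- the anchor, fibre by fibre -/
  anchor : ∀ x : M, V x →ₗ[ℝ] TangentSpace 𝓘(ℝ, E) x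
  contMDiff_anchor : ContMDiff (𝓘(ℝ, E).prod 𝓘(ℝ, F)) 𝓘(ℝ, E).tangent ∞
    (fun p : TotalSpace F V => (⟨p.1, anchor p.1 p.2⟩ : TangentBundle 𝓘(ℝ, E) M))
  /-- the Lie bracket on sections -/
  bracket : Sec E F V →ₗ[ℝ] Sec E F V →ₗ[ℝ] Sec E F V
  bracket_self : ∀ α, bracket α α = 0
  jacobi : ∀ α β γ, bracket α (bracket β γ) = bracket (bracket α β) γ + bracket β (bracket α γ)
  leibniz : ∀ (f : SmoothFun E M) (α β : Sec E F V) (x : M),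
    bracket α (f • β) x
      = f x • bracket α β x + (mvfderiv 𝓘(ℝ, E) f x (anchor x (α x)) : ℝ) • β x

namespace LieAlgebroid

universe uE uF uM uV

variable {E : Type uE} [NormedAddCommGroup E] [NormedSpace ℝ E]
  {F : Type uF} [NormedAddCommGroup F] [NormedSpace ℝ F]
  {M : Type uM} [TopologicalSpace M] [ChartedSpace E M] [IsManifold 𝓘(ℝ, E) ∞ M]
  {V : M → Type uV} [TopologicalSpace (TotalSpace F V)] [∀ x, TopologicalSpace (V x)]
  [FiberBundle F V] [∀ x, AddCommGroup (V x)] [∀ x, Module ℝ (V x)] [VectorBundle ℝ F V]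
  (A : LieAlgebroid E F V)

/-- The anchor on sections, `ρ : Γ(A) → 𝔛(M)`. -/
def rho : Sec E F V →ₗ[SmoothFun E M] VecField E M where
  toFun α := ⟨fun x => A.anchor x (α x), A.contMDiff_anchor.comp α.contMDiff⟩
  map_add' α β := by ext x; exact map_add (A.anchor x) (α x) (β x)
  map_smul' f α := by ext x; exact map_smul (A.anchor x) (f x) (α x)

theorem rho_apply (α : Sec E F V) (x : M) : A.rho α x = A.anchor x (α x) := rfl

theorem bracket_smul (f : SmoothFun E M) (α β : Sec E F V) :
    A.bracket α (f • β) = f • A.bracket α β + lieDeriv (A.rho α) f • β := by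
  ext x; exact A.leibniz f α β x

theorem rho_bracket [FiniteDimensional ℝ E] [T2Space M] [SigmaCompactSpace M]
    [ContMDiffVectorBundle ∞ F V 𝓘(ℝ, E)] (α β : Sec E F V) :
    A.rho (A.bracket α β) = vecBracket (A.rho α) (A.rho β) := by
  have h1 : ∀ (f : SmoothFun E M) (γ : Sec E F V),
      lieDeriv (A.rho (A.bracket α β)) f • γ
        = lieDeriv (A.rho α) (lieDeriv (A.rho β) f) • γ
          - lieDeriv (A.rho β) (lieDeriv (A.rho α) f) • γ := by
    intro f γ
    have h := A.jacobi α β (f • γ)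
    simp only [bracket_smul, map_add] at h
    rw [A.jacobi α β γ, smul_add] at h
    rw [← sub_eq_zero] at h ⊢
    rw [← neg_eq_zero, ← h]
    abel
  have h2 : ∀ (f : SmoothFun E M) (Z : VecField E M),
      lieDeriv (vecBracket (A.rho α) (A.rho β)) f • Z
        = lieDeriv (A.rho α) (lieDeriv (A.rho β) f) • Z
          - lieDeriv (A.rho β) (lieDeriv (A.rho α) f) • Z := by
    intro f γ
    have h := vecBracket_jacobi (A.rho α) (A.rho β) (f • γ)
    simp only [vecBracket_smul, map_add] at h
    rw [vecBracket_jacobi (A.rho α) (A.rho β) γ, smul_add] at h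
    rw [← sub_eq_zero] at h ⊢
    rw [← neg_eq_zero, ← h]
    abel
  have hE := subsingleton_or_nontrivial E
  rcases subsingleton_or_nontrivial F with hF | hF
  · have hV (x : M) : Subsingleton (V x) :=
      ((trivializationAt F V x).linearEquivAt ℝ x
        (FiberBundle.mem_baseSet_trivializationAt' x)).toEquiv.subsingleton
    have hS : ∀ γ : Sec E F V, γ = 0 := fun γ => by ext x; exact Subsingleton.elim _ _
    rw [hS (A.bracket α β), hS α]
    simp
  ext x
  rcases hE with hE | hE
  · exact Subsingleton.elim (α := E) _ _
  rw [← sub_eq_zero]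
  apply eq_zero_of_forall_mvfderiv
  intro f
  obtain ⟨w, hw⟩ : ∃ w : V x, w ≠ 0 := by
    obtain ⟨y, hy⟩ := exists_ne (0 : F)
    let e := (trivializationAt F V x).linearEquivAt ℝ x
      (FiberBundle.mem_baseSet_trivializationAt' x)
    exact ⟨e.symm y, by simpa using hy⟩
  obtain ⟨γ, hγ⟩ := exists_sec_eq (E := E) (F := F) x w
  obtain ⟨z, hz⟩ := exists_ne (0 : E)
  obtain ⟨Z, hZ⟩ := exists_sec_eq (E := E) (F := E)
    (V := (TangentSpace 𝓘(ℝ, E) : M → Type _)) x z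
  have e1 := congrArg (fun s : Sec E F V => s x) (h1 f γ)
  have e2 := congrArg (fun s : VecField E M => s x) (h2 f Z)
  rw [← sub_smul] at e1 e2
  simp only [smul_sec_apply, hγ, hZ] at e1 e2
  have e3 := smul_left_injective ℝ hw e1
  have e4 := smul_left_injective ℝ hz e2
  have e5 := e3.trans e4.symm
  rw [lieDeriv_apply, lieDeriv_apply] at e5
  rw [map_sub, sub_eq_zero]
  exact e5

/-- `A` is regular: its anchor has constant rank. -/
def IsRegular : Prop := ∃ r : ℕ, ∀ x, Module.finrank ℝ (LinearMap.range (A.anchor x)) = r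

/-- `A` is transitive: its anchor is surjective. -/
def IsTransitive : Prop := ∀ x, Function.Surjective (A.anchor x)

/-- The image of the anchor of a regular Lie algebroid is involutive, in the form needed to
define the Bott connection. -/
theorem IsRegular.involutive {A : LieAlgebroid E F V}
    [FiniteDimensional ℝ E] [T2Space M] [SigmaCompactSpace M]
    [ContMDiffVectorBundle ∞ F V 𝓘(ℝ, E)] (hA : A.IsRegular) (α : Sec E F V)
    (X : VecField E M) (x₀ : M) (hX : ∀ᶠ x in 𝓝 x₀, X x ∈ LinearMap.range (A.anchor x)) :
    vecBracket (A.rho α) X x₀ ∈ LinearMap.range (A.anchor x₀) := by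
  classical
  obtain ⟨r, hr⟩ := hA
  have hfd (x : M) : FiniteDimensional ℝ (TangentSpace 𝓘(ℝ, E) x) :=
    inferInstanceAs (FiniteDimensional ℝ E)
  let b : Module.Basis (Fin r) ℝ (LinearMap.range (A.anchor x₀)) :=
    Module.finBasisOfFinrankEq ℝ _ (hr x₀)
  have hw : ∀ i, ∃ β : Sec E F V, A.anchor x₀ (β x₀) = b i := by
    intro i
    obtain ⟨w, hw⟩ := (b i).2
    obtain ⟨β, hβ⟩ := exists_sec_eq (E := E) (F := F) x₀ w
    exact ⟨β, by rw [hβ, hw]⟩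
  choose β hβ using hw
  -- coordinates in the trivialization at `x₀`
  let t := trivializationAt E (TangentSpace 𝓘(ℝ, E) : M → Type _) x₀
  have ht : x₀ ∈ t.baseSet := FiberBundle.mem_baseSet_trivializationAt' x₀
  let τ : ∀ x : M, TangentSpace 𝓘(ℝ, E) x →L[ℝ] E := fun x => t.continuousLinearMapAt ℝ x
  have hτinj : ∀ x ∈ t.baseSet, Function.Injective (τ x) := by
    intro x hx u v huv
    have := congrArg (t.symmL ℝ x) huv
    exact (t.symmL_continuousLinearMapAt hx u).symm.trans
      (this.trans (t.symmL_continuousLinearMapAt hx v))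
  have hξ : ∀ Y : VecField E M, MDifferentiableAt 𝓘(ℝ, E) 𝓘(ℝ, E) (fun x => τ x (Y x)) x₀ := by
    intro Y
    have h := (contMDiffAt_section x₀).1 (Y.contMDiff x₀)
    have h' := h.mdifferentiableAt (by simp)
    refine h'.congr_of_eventuallyEq ?_
    filter_upwards [t.open_baseSet.mem_nhds ht] with x hx
    exact t.continuousLinearMapAt_apply_of_mem ℝ hx (Y x)
  -- a left inverse `Q` of the frame at `x₀`, and the matrix `G` of the frame near `x₀`
  let Φ : M → (Fin r → ℝ) →ₗ[ℝ] E := fun x =>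
    Fintype.linearCombination ℝ (fun i => τ x (A.rho (β i) x))
  have hΦ₀ : Function.Injective (Φ x₀) := by
    rw [← LinearMap.ker_eq_bot, LinearMap.ker_eq_bot']
    intro c hc
    have h1 : τ x₀ (∑ i, c i • A.rho (β i) x₀) = τ x₀ 0 := by
      rw [map_sum, map_zero, ← hc]
      simp [Φ, Fintype.linearCombination_apply]
    have h2 := hτinj x₀ ht h1
    have h3 : ∑ i, c i • b i = 0 := by
      apply Subtype.ext
      refine Eq.trans ?_ h2
      push_cast
      exact Finset.sum_congr rfl fun i _ => by rw [← hβ]; rfl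
    funext i
    exact Fintype.linearIndependent_iff.1 b.linearIndependent c h3 i
  obtain ⟨Q', hQ'⟩ := (Φ x₀).exists_leftInverse_of_injective (LinearMap.ker_eq_bot.2 hΦ₀)
  let Q : E →L[ℝ] (Fin r → ℝ) := LinearMap.toContinuousLinearMap Q'
  let G : M → ((Fin r → ℝ) →L[ℝ] (Fin r → ℝ)) := fun x =>
    ∑ i, ContinuousLinearMap.smulRightL ℝ (Fin r → ℝ) (Fin r → ℝ)
      (ContinuousLinearMap.proj i) (Q (τ x (A.rho (β i) x)))
  have hG_apply : ∀ x c, G x c = Q (τ x (∑ i, c i • A.rho (β i) x)) := by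
    intro x c
    simp [G, map_sum]
  have hG₀ : G x₀ = 1 := by
    ext1 c
    rw [hG_apply]
    have : τ x₀ (∑ i, c i • A.rho (β i) x₀) = Φ x₀ c := by
      simp [Φ, Fintype.linearCombination_apply, map_sum]
    rw [this]
    exact LinearMap.congr_fun hQ' c
  have hG : MDifferentiableAt 𝓘(ℝ, E) 𝓘(ℝ, (Fin r → ℝ) →L[ℝ] (Fin r → ℝ)) G x₀ := by
    refine MDifferentiableAt.congr_of_eventuallyEq (f := ∑ i, fun x =>
      ContinuousLinearMap.smulRightL ℝ (Fin r → ℝ) (Fin r → ℝ)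
        (ContinuousLinearMap.proj i) (Q (τ x (A.rho (β i) x)))) ?_ ?_
    · refine MDifferentiableAt.sum fun i _ => ?_
      exact ((ContinuousLinearMap.smulRightL ℝ (Fin r → ℝ) (Fin r → ℝ)
        (ContinuousLinearMap.proj i)).comp Q).mdifferentiableAt.comp x₀ (hξ (A.rho (β i)))
    · refine Filter.Eventually.of_forall fun x => ?_
      simp [G, Finset.sum_apply]
  have hunit : ∀ᶠ x in 𝓝 x₀, IsUnit (G x) := by
    refine hG.continuousAt.eventually (Units.isOpen.mem_nhds ?_)
    show IsUnit (G x₀)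
    rw [hG₀]; exact isUnit_one
  let f : Fin r → M → ℝ := fun i x => (Ring.inverse (G x) (Q (τ x (X x)))) i
  have hf : ∀ i, MDifferentiableAt 𝓘(ℝ, E) 𝓘(ℝ, ℝ) (f i) x₀ := by
    intro i
    have h1 : MDifferentiableAt 𝓘(ℝ, E) 𝓘(ℝ, (Fin r → ℝ) →L[ℝ] (Fin r → ℝ))
        (fun x => Ring.inverse (G x)) x₀ := by
      have h0 : DifferentiableAt ℝ
          (Ring.inverse : ((Fin r → ℝ) →L[ℝ] (Fin r → ℝ)) → _) (G x₀) :=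
        differentiableAt_inverse (by rw [hG₀]; exact isUnit_one)
      exact h0.mdifferentiableAt.comp x₀ hG
    have h2 : MDifferentiableAt 𝓘(ℝ, E) 𝓘(ℝ, Fin r → ℝ) (fun x => Q (τ x (X x))) x₀ :=
      Q.mdifferentiableAt.comp x₀ (hξ X)
    have h3 := h1.clm_apply h2
    exact (ContinuousLinearMap.proj (R := ℝ) (φ := fun _ : Fin r => ℝ) i).mdifferentiableAt.comp
      x₀ h3
  have hXf : ∀ᶠ x in 𝓝 x₀, X x = ∑ i, f i x • A.rho (β i) x := by
    filter_upwards [hunit, hX] with x hu hx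
    let L : (Fin r → ℝ) →ₗ[ℝ] LinearMap.range (A.anchor x) :=
      Fintype.linearCombination ℝ (fun i => ⟨A.rho (β i) x, ⟨β i x, rfl⟩⟩)
    have hL : ∀ c, (L c : TangentSpace 𝓘(ℝ, E) x) = ∑ i, c i • A.rho (β i) x := by
      intro c
      simp only [L, Fintype.linearCombination_apply]
      push_cast
      rfl
    have hGL : ∀ c, G x c = Q (τ x (L c)) := fun c => by rw [hG_apply, hL]
    obtain ⟨u, hu⟩ := hu
    have hinv : ∀ c, Ring.inverse (G x) (G x c) = c := by
      intro c
      rw [← hu, Ring.inverse_unit]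
      exact DFunLike.congr_fun u.inv_mul c
    have hinj : Function.Injective L := by
      intro c c' h
      rw [← hinv c, ← hinv c', hGL, hGL, h]
    have hsurj : Function.Surjective L :=
      (LinearMap.injective_iff_surjective_of_finrank_eq_finrank (by simp [hr])).1 hinj
    obtain ⟨c, hc⟩ := hsurj ⟨X x, hx⟩
    have hc' : (L c : TangentSpace 𝓘(ℝ, E) x) = X x := by rw [hc]
    have hfc : ∀ i, f i x = c i := by
      intro i
      simp only [f]
      rw [← hc', ← hGL, hinv]
    rw [← hc', hL]
    exact Finset.sum_congr rfl fun i _ => by rw [hfc]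
  -- the bracket of `ρ(α)` with the local expression
  have hmem : ∀ s : Finset (Fin r),
      VectorField.mlieBracket 𝓘(ℝ, E) (A.rho α) (fun x => ∑ i ∈ s, f i x • A.rho (β i) x) x₀
        ∈ LinearMap.range (A.anchor x₀) := by
    intro s
    have hsm : ∀ i, MDifferentiableAt 𝓘(ℝ, E) 𝓘(ℝ, E).tangent
        (fun x => (⟨x, (f i • (A.rho (β i) : Π x, TangentSpace 𝓘(ℝ, E) x)) x⟩ :
          TangentBundle 𝓘(ℝ, E) M)) x₀ :=
      fun i => (hf i).smul_section (A.rho (β i)).mdifferentiableAt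
    induction s using Finset.induction_on with
    | empty =>
      have : VectorField.mlieBracket 𝓘(ℝ, E) (A.rho α) (0 : Π x : M, TangentSpace 𝓘(ℝ, E) x) x₀
          ∈ LinearMap.range (A.anchor x₀) := by
        simp
      simp only [Finset.sum_empty]
      exact this
    | insert j s hj ih =>
      have hsum : (fun x => ∑ i ∈ insert j s, f i x • A.rho (β i) x)
          = (f j • (A.rho (β j) : Π x, TangentSpace 𝓘(ℝ, E) x))
            + (fun x => ∑ i ∈ s, f i x • A.rho (β i) x) := by
        funext x
        simp [Finset.sum_insert hj]
      have hT : MDifferentiableAt 𝓘(ℝ, E) 𝓘(ℝ, E).tangent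
          (fun x => (⟨x, ∑ i ∈ s, f i x • A.rho (β i) x⟩ : TangentBundle 𝓘(ℝ, E) M)) x₀ :=
        MDifferentiableAt.sum_section fun i _ => hsm i
      rw [hsum, VectorField.mlieBracket_add_right (hsm j) hT]
      refine Submodule.add_mem _ ?_ ih
      rw [VectorField.mlieBracket_smul_right (hf j) (A.rho (β j)).mdifferentiableAt]
      refine Submodule.add_mem _ (Submodule.smul_mem _ _ ⟨β j x₀, rfl⟩)
        (Submodule.smul_mem _ _ ⟨A.bracket α (β j) x₀, ?_⟩)
      have h := congrArg (fun s : VecField E M => s x₀) (A.rho_bracket α (β j))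
      exact h
  rw [vecBracket_apply]
  rw [(Filter.EventuallyEq.rfl (f := (A.rho α : Π x, TangentSpace 𝓘(ℝ, E) x))).mlieBracket_vectorField_eq
    (show (X : Π x, TangentSpace 𝓘(ℝ, E) x) =ᶠ[𝓝 x₀] _ from hXf)]
  exact hmem Finset.univ

/-- The space `Γ(ν)` of smooth sections of the normal bundle `ν = TM / im ρ`: families of normal
vectors which near every point are the class of a smooth vector field. (Multiplying by a bump
function, a vector field defined near a point can be taken to be defined on all of `M`.) -/
def normalSec : Submodule ℝ (Π x : M, TangentSpace 𝓘(ℝ, E) x ⧸ LinearMap.range (A.anchor x)) where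
  carrier := {s | ∀ x₀ : M, ∃ X : VecField E M,
    ∀ᶠ x in 𝓝 x₀, s x = (LinearMap.range (A.anchor x)).mkQ (X x)}
  add_mem' := by
    intro s t hs ht x₀
    obtain ⟨X, hX⟩ := hs x₀
    obtain ⟨Y, hY⟩ := ht x₀
    refine ⟨X + Y, ?_⟩
    filter_upwards [hX, hY] with x h1 h2
    rw [Pi.add_apply, h1, h2, ← map_add]
    rfl
  zero_mem' := fun x₀ => ⟨0, Filter.Eventually.of_forall fun x => (map_zero _).symm⟩
  smul_mem' := by
    intro c s hs x₀
    obtain ⟨X, hX⟩ := hs x₀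
    refine ⟨c • X, ?_⟩
    filter_upwards [hX] with x h1
    rw [Pi.smul_apply, h1, ← map_smul]
    rfl

variable {A} in
theorem normalSec_ext {s t : A.normalSec} (h : ∀ x, s.1 x = t.1 x) : s = t :=
  Subtype.ext (funext h)

instance : SMul (SmoothFun E M) A.normalSec :=
  ⟨fun f s => ⟨fun x => f x • s.1 x, by
    intro x₀
    obtain ⟨X, hX⟩ := s.2 x₀
    refine ⟨f • X, ?_⟩
    filter_upwards [hX] with x h1
    rw [h1, ← map_smul]
    rfl⟩⟩

theorem normalSec_smul_apply (f : SmoothFun E M) (s : A.normalSec) (x : M) :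
    (f • s).1 x = f x • s.1 x := rfl

instance : Module (SmoothFun E M) A.normalSec where
  one_smul s := normalSec_ext fun x => one_smul ℝ (s.1 x)
  mul_smul f g s := normalSec_ext fun x => mul_smul (f x) (g x) (s.1 x)
  smul_zero f := normalSec_ext fun x => smul_zero (f x)
  smul_add f s t := normalSec_ext fun x => smul_add (f x) (s.1 x) (t.1 x)
  add_smul f g s := normalSec_ext fun x => add_smul (f x) (g x) (s.1 x)
  zero_smul s := normalSec_ext fun x => zero_smul ℝ (s.1 x)

instance : SMulCommClass (SmoothFun E M) ℝ A.normalSec where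
  smul_comm f c s := normalSec_ext fun x => smul_comm (f x) c (s.1 x)

instance : IsScalarTower ℝ (SmoothFun E M) A.normalSec where
  smul_assoc c f s := normalSec_ext fun x => smul_assoc c (f x) (s.1 x)

/-- The projection `𝔛(M) → Γ(ν)`, `X ↦ X̄`. -/
def toNormal : VecField E M →ₗ[SmoothFun E M] A.normalSec where
  toFun X := ⟨fun x => (LinearMap.range (A.anchor x)).mkQ (X x),
    fun _ => ⟨X, Filter.Eventually.of_forall fun _ => rfl⟩⟩
  map_add' X Y := normalSec_ext fun x => map_add (LinearMap.range (A.anchor x)).mkQ (X x) (Y x)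
  map_smul' f X := normalSec_ext fun x => map_smul (LinearMap.range (A.anchor x)).mkQ (f x) (X x)

section Bott

variable [FiniteDimensional ℝ E] [T2Space M] [SigmaCompactSpace M]
  [ContMDiffVectorBundle ∞ F V 𝓘(ℝ, E)]

variable {A} in
theorem IsRegular.mkQ_vecBracket_congr (hA : A.IsRegular) (α : Sec E F V) (X Y : VecField E M)
    (x₀ : M) (h : ∀ᶠ x in 𝓝 x₀, (LinearMap.range (A.anchor x)).mkQ (X x)
      = (LinearMap.range (A.anchor x)).mkQ (Y x)) :
    (LinearMap.range (A.anchor x₀)).mkQ (vecBracket (A.rho α) X x₀)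
      = (LinearMap.range (A.anchor x₀)).mkQ (vecBracket (A.rho α) Y x₀) := by
  have h1 := hA.involutive α (X - Y) x₀ (by
    filter_upwards [h] with x hx
    exact (Submodule.Quotient.eq _).1 hx)
  rw [map_sub] at h1
  exact (Submodule.Quotient.eq _).2 h1

/-- The Bott connection on `ν`: if `s` is the class of `X` near `x`, then
`(∇_α s)(x)` is the class of `[ρ(α), X](x)`, see `bott_apply`. -/
def bott (hA : A.IsRegular) (α : Sec E F V) : A.normalSec →ₗ[ℝ] A.normalSec :=
  have hwd : ∀ (s : A.normalSec) (x : M) (X : VecField E M),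
      (∀ᶠ y in 𝓝 x, s.1 y = (LinearMap.range (A.anchor y)).mkQ (X y)) →
      (LinearMap.range (A.anchor x)).mkQ (vecBracket (A.rho α) (s.2 x).choose x)
        = (LinearMap.range (A.anchor x)).mkQ (vecBracket (A.rho α) X x) := by
    intro s x X hX
    apply hA.mkQ_vecBracket_congr
    filter_upwards [hX, (s.2 x).choose_spec] with y h1 h2
    rw [← h1, ← h2]
  { toFun := fun s =>
      ⟨fun x => (LinearMap.range (A.anchor x)).mkQ (vecBracket (A.rho α) (s.2 x).choose x), by
        intro x₀
        refine ⟨vecBracket (A.rho α) (s.2 x₀).choose, ?_⟩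
        filter_upwards [(s.2 x₀).choose_spec.eventually_nhds] with x hx
        exact hwd s x _ hx⟩
    map_add' := by
      intro s t
      refine normalSec_ext fun x => ?_
      refine (hwd (s + t) x ((s.2 x).choose + (t.2 x).choose) ?_).trans ?_
      · filter_upwards [(s.2 x).choose_spec, (t.2 x).choose_spec] with y h1 h2
        change s.1 y + t.1 y = _
        rw [h1, h2, ← map_add]
        rfl
      · rw [map_add]
        exact map_add (LinearMap.range (A.anchor x)).mkQ _ _
    map_smul' := by
      intro c s
      refine normalSec_ext fun x => ?_
      refine (hwd (c • s) x (c • (s.2 x).choose) ?_).trans ?_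
      · filter_upwards [(s.2 x).choose_spec] with y h1
        change c • s.1 y = _
        rw [h1, ← map_smul]
        rfl
      · rw [map_smul]
        exact map_smul (LinearMap.range (A.anchor x)).mkQ _ _ }

theorem bott_apply (hA : A.IsRegular) (α : Sec E F V) (s : A.normalSec) (X : VecField E M) (x : M)
    (hX : ∀ᶠ y in 𝓝 x, s.1 y = (LinearMap.range (A.anchor y)).mkQ (X y)) :
    (A.bott hA α s).1 x = (LinearMap.range (A.anchor x)).mkQ (vecBracket (A.rho α) X x) := by
  refine hA.mkQ_vecBracket_congr α (s.2 x).choose X x ?_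
  filter_upwards [hX, (s.2 x).choose_spec] with y h1 h2
  rw [← h1, ← h2]

theorem bott_toNormal (hA : A.IsRegular) (α : Sec E F V) (X : VecField E M) :
    A.bott hA α (A.toNormal X) = A.toNormal (vecBracket (A.rho α) X) :=
  normalSec_ext fun x => A.bott_apply hA α _ X x (Filter.Eventually.of_forall fun _ => rfl)

/-- The space `Γ(g(A))` of sections of the isotropy bundle `g(A) = ker ρ`. -/
def isotropySec : Submodule (SmoothFun E M) (Sec E F V) where
  carrier := {β | ∀ x, β x ∈ LinearMap.ker (A.anchor x)}
  add_mem' := fun hα hβ x => Submodule.add_mem _ (hα x) (hβ x)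
  zero_mem' := fun _ => Submodule.zero_mem _
  smul_mem' := fun f _ hβ x => Submodule.smul_mem _ (f x) (hβ x)

/-- The isotropy representation `∇_α β = [α, β]` on `g(A)`. -/
def isotropyConn (α : Sec E F V) : A.isotropySec →ₗ[ℝ] A.isotropySec :=
  LinearMap.codRestrict (A.isotropySec.restrictScalars ℝ)
    ((A.bracket α).comp (A.isotropySec.restrictScalars ℝ).subtype) (by
      intro β x
      have h : A.rho β.1 = 0 := by ext x; exact β.2 x
      have h2 := congrArg (fun s : VecField E M => s x) (A.rho_bracket α β.1)
      rw [h, map_zero] at h2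
      exact h2)

theorem isotropyConn_coe (α : Sec E F V) (β : A.isotropySec) :
    (A.isotropyConn α β : Sec E F V) = A.bracket α β := rfl

end Bott

section Differential

variable {L W : Type*} [AddCommGroup W] [Module ℝ W]

/-- The part `∑_{i<j} (-1)^{i+j} η([α_i, α_j], α_0, …, α̂_i, …, α̂_j, …, α_n)` of the
Chevalley–Eilenberg differential. -/
def ceBracketPart (br : L → L → L) :
    ∀ n : ℕ, ((Fin n → L) → W) →ₗ[ℝ] ((Fin (n + 1) → L) → W)
  | 0 => 0
  | n + 1 =>
    { toFun := fun η α => ∑ j : Fin (n + 2), ∑ i : Fin (n + 1),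
        if i.castSucc < j then
          (-1 : ℝ) ^ ((i : ℕ) + (j : ℕ)) •
            η (Fin.cons (br (α i.castSucc) (α j)) fun k => α (j.succAbove (i.succAbove k)))
        else 0
      map_add' := by
        intro η θ
        funext α
        simp only [Pi.add_apply, ← Finset.sum_add_distrib]
        refine Finset.sum_congr rfl fun j _ => Finset.sum_congr rfl fun i _ => ?_
        split_ifs <;> simp
      map_smul' := by
        intro c η
        funext α
        simp only [Pi.smul_apply, Finset.smul_sum, RingHom.id_apply]
        refine Finset.sum_congr rfl fun j _ => Finset.sum_congr rfl fun i _ => ?_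
        split_ifs
        · exact smul_comm _ _ _
        · simp }

/-- The Chevalley–Eilenberg differential
`(δη)(α_0, …, α_n) = ∑_i (-1)^i ∇_{α_i} (η(α_0, …, α̂_i, …, α_n))
  + ∑_{i<j} (-1)^{i+j} η([α_i, α_j], α_0, …, α̂_i, …, α̂_j, …, α_n)`. -/
def ceDiff (br : L → L → L) (nab : L → W →ₗ[ℝ] W) (n : ℕ) :
    ((Fin n → L) → W) →ₗ[ℝ] ((Fin (n + 1) → L) → W) where
  toFun η α := (∑ i : Fin (n + 1), (-1 : ℝ) ^ (i : ℕ) • nab (α i) (η fun k => α (i.succAbove k)))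
    + ceBracketPart br n η α
  map_add' η θ := by
    funext α
    simp only [Pi.add_apply, map_add, smul_add, Finset.sum_add_distrib]
    abel
  map_smul' c η := by
    funext α
    simp only [Pi.smul_apply, map_smul, RingHom.id_apply, smul_add, Finset.smul_sum]
    congr 1
    exact Finset.sum_congr rfl fun i _ => smul_comm _ _ _

end Differential

section Cohomology

variable (E F V) in
/-- The cochains `C^n(A; W)`: antisymmetric `C^∞(M)`-multilinear maps `Γ(A)^n → W`, where `W` is
a module of sections. -/
abbrev Cochain (W : Type*) [AddCommGroup W] [Module (SmoothFun E M) W] (n : ℕ) : Type _ :=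
  Sec E F V [⋀^Fin n]→ₗ[SmoothFun E M] W

variable {W : Type*} [AddCommGroup W] [Module (SmoothFun E M) W] [Module ℝ W]
  [SMulCommClass (SmoothFun E M) ℝ W]

/-- The underlying function of a cochain. -/
def cochainFun (n : ℕ) : Cochain E F V W n →ₗ[ℝ] ((Fin n → Sec E F V) → W) where
  toFun η := η
  map_add' _ _ := rfl
  map_smul' _ _ := rfl

/-- The differential of `C^*(A; W)` for a connection `∇` on `W`. -/
def repDiff (nab : Sec E F V → W →ₗ[ℝ] W) (n : ℕ) :
    Cochain E F V W n →ₗ[ℝ] ((Fin (n + 1) → Sec E F V) → W) :=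
  (ceDiff (fun α β => A.bracket α β) nab n).comp (cochainFun n)

/-- The cocycles in `C^n(A; W)`. -/
def repCocycles (nab : Sec E F V → W →ₗ[ℝ] W) (n : ℕ) : Submodule ℝ (Cochain E F V W n) :=
  LinearMap.ker (A.repDiff nab n)

/-- The coboundaries in `C^n(A; W)`. -/
def repCoboundaries (nab : Sec E F V → W →ₗ[ℝ] W) :
    ∀ n : ℕ, Submodule ℝ (Cochain E F V W n)
  | 0 => ⊥
  | n + 1 => (LinearMap.range (A.repDiff nab n)).comap (cochainFun (n + 1))

/-- The cohomology `H^n(A; W)`, cocycles modulo coboundaries. -/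
abbrev RepCoh (nab : Sec E F V → W →ₗ[ℝ] W) (n : ℕ) : Type _ :=
  A.repCocycles nab n ⧸ (A.repCoboundaries nab n).submoduleOf (A.repCocycles nab n)

/-- The cohomology class of a cocycle in `C^n(A; W)`. -/
def repClass (nab : Sec E F V → W →ₗ[ℝ] W) (n : ℕ) :
    A.repCocycles nab n →ₗ[ℝ] A.RepCoh nab n :=
  Submodule.mkQ _

end Cohomology

section Deformation

variable (E F V) in
/-- Multiderivations with `n + 1` arguments, given with their symbol: pairs of an antisymmetric
`ℝ`-multilinear map `D : Γ(A)^{n+1} → Γ(A)` and an antisymmetric `C^∞(M)`-multilinear map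
`σ : Γ(A)^n → 𝔛(M)` such that
`D(s_0, …, s_{n-1}, f t) = f D(s_0, …, s_{n-1}, t) + σ(s_0, …, s_{n-1})(f) t`.
When the bundle has positive rank, `σ` is determined by `D`; in rank zero it is extra data
(a derivation of the zero bundle is the same as its symbol, a vector field). -/
def multiDer (n : ℕ) :
    Submodule ℝ ((Sec E F V [⋀^Fin (n + 1)]→ₗ[ℝ] Sec E F V) × Cochain E F V (VecField E M) n) where
  carrier := {p | ∀ (s : Fin n → Sec E F V) (f : SmoothFun E M) (t : Sec E F V),
    p.1 (Fin.snoc s (f • t)) = f • p.1 (Fin.snoc s t) + lieDeriv (p.2 s) f • t}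
  add_mem' := by
    intro p q hp hq s f t
    have h : lieDeriv (p.2 s + q.2 s) f = lieDeriv (p.2 s) f + lieDeriv (q.2 s) f := by
      ext x; exact map_add (mvfderiv 𝓘(ℝ, E) f x) (p.2 s x) (q.2 s x)
    change p.1 _ + q.1 _ = f • (p.1 _ + q.1 _) + lieDeriv (p.2 s + q.2 s) f • t
    rw [hp, hq, h, add_smul, smul_add]
    abel
  zero_mem' := by
    intro s f t
    have h : lieDeriv (0 : VecField E M) f = 0 := by
      ext x; exact map_zero (mvfderiv 𝓘(ℝ, E) f x)
    change (0 : Sec E F V) = f • (0 : Sec E F V) + lieDeriv (0 : VecField E M) f • t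
    rw [h, smul_zero, zero_smul, add_zero]
  smul_mem' := by
    intro c p hp s f t
    have h : lieDeriv (c • p.2 s) f = c • lieDeriv (p.2 s) f := by
      ext x; exact map_smul (mvfderiv 𝓘(ℝ, E) f x) c (p.2 s x)
    change c • p.1 _ = f • (c • p.1 _) + lieDeriv (c • p.2 s) f • t
    rw [hp, h, smul_add, smul_comm f c, smul_assoc]

variable (E F V) in
/-- The symbols of deformation cochains: an element of `C_def^0(A) = Γ(A)` has no symbol, a
multiderivation with `n + 1` arguments has a symbol with `n` arguments. -/
def SymbolSpace : ℕ → Type (max uE uM uV)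
  | 0 => PUnit
  | n + 1 => Cochain E F V (VecField E M) n

instance : ∀ n : ℕ, AddCommGroup (SymbolSpace E F V n)
  | 0 => show AddCommGroup PUnit.{max uE uM uV + 1} from inferInstance
  | n + 1 => show AddCommGroup (Cochain E F V (VecField E M) n) from inferInstance

instance : ∀ n : ℕ, Module ℝ (SymbolSpace E F V n)
  | 0 => show Module ℝ PUnit.{max uE uM uV + 1} from inferInstance
  | n + 1 => show Module ℝ (Cochain E F V (VecField E M) n) from inferInstance

variable (E F V) in
/-- The deformation cochains as a subspace: `C_def^0(A) = Γ(A)`, and `C_def^{n+1}(A)` consists of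
the multiderivations with `n + 1` arguments. -/
def defSubmodule : ∀ n : ℕ, Submodule ℝ ((Sec E F V [⋀^Fin n]→ₗ[ℝ] Sec E F V) × SymbolSpace E F V n)
  | 0 => ⊤
  | n + 1 => multiDer E F V n

variable (E F V) in
/-- The space `C_def^n(A)` of deformation cochains. -/
def DefCochain (n : ℕ) : Type (max uE uM uV) := defSubmodule E F V n

instance (n : ℕ) : AddCommGroup (DefCochain E F V n) :=
  inferInstanceAs (AddCommGroup (defSubmodule E F V n))

instance (n : ℕ) : Module ℝ (DefCochain E F V n) :=
  inferInstanceAs (Module ℝ (defSubmodule E F V n))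

/-- A deformation cochain as a pair of a map and its symbol. -/
def defPair (n : ℕ) : DefCochain E F V n →ₗ[ℝ]
    (Sec E F V [⋀^Fin n]→ₗ[ℝ] Sec E F V) × SymbolSpace E F V n :=
  (defSubmodule E F V n).subtype

/-- The symbol of a deformation cochain with `n + 1` arguments. -/
def symbol (n : ℕ) : DefCochain E F V (n + 1) →ₗ[ℝ] Cochain E F V (VecField E M) n :=
  (LinearMap.snd ℝ _ (SymbolSpace E F V (n + 1))).comp (defPair (n + 1))

/-- The underlying function of a deformation cochain. -/
def defFun (n : ℕ) : DefCochain E F V n →ₗ[ℝ] ((Fin n → Sec E F V) → Sec E F V) where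
  toFun D := (defPair n D).1
  map_add' _ _ := rfl
  map_smul' _ _ := rfl

/-- The underlying function of the symbol. -/
def symbolFun (n : ℕ) : DefCochain E F V (n + 1) →ₗ[ℝ] ((Fin n → Sec E F V) → VecField E M) :=
  (cochainFun n).comp (symbol n)

variable [FiniteDimensional ℝ E]

/-- Composition with `ρ` on functions. -/
def rhoComp (n : ℕ) :
    ((Fin n → Sec E F V) → Sec E F V) →ₗ[ℝ] ((Fin n → Sec E F V) → VecField E M) where
  toFun D s := A.rho (D s)
  map_add' D D' := funext fun s => map_add A.rho (D s) (D' s)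
  map_smul' c D := funext fun s => LinearMap.map_smul_of_tower A.rho c (D s)

/-- The symbol of `δD`: `-ρ(β)` for `D = β ∈ Γ(A)`, and `δσ + (-1)^n ρ ∘ D` for a multiderivation
`D` with `n + 1` arguments and symbol `σ`, where `δσ` is given by the Chevalley–Eilenberg formula
with `∇_α = [ρ(α), ·]`. -/
def defDiffSymbol : ∀ n : ℕ,
    DefCochain E F V n →ₗ[ℝ] ((Fin n → Sec E F V) → VecField E M)
  | 0 => -((A.rhoComp 0).comp (defFun 0))
  | n + 1 =>
    (ceDiff (fun α β => A.bracket α β) (fun α => vecBracket (A.rho α)) n).comp (symbolFun n)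
      + (-1 : ℝ) ^ n • (A.rhoComp (n + 1)).comp (defFun (n + 1))

/-- The differential of the deformation complex, as the pair of the map `δD` (given by the
Chevalley–Eilenberg formula with `∇_α = [α, ·]`) and of its symbol. -/
def defDiff (n : ℕ) : DefCochain E F V n →ₗ[ℝ]
    ((Fin (n + 1) → Sec E F V) → Sec E F V) × ((Fin n → Sec E F V) → VecField E M) :=
  ((ceDiff (fun α β => A.bracket α β) (fun α => A.bracket α) n).comp (defFun n)).prod
    (A.defDiffSymbol n)

/-- `IsDefDiff D D'` says that `D' = δD`. -/
def IsDefDiff {n : ℕ} (D : DefCochain E F V n) (D' : DefCochain E F V (n + 1)) : Prop :=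
  A.defDiff n D = (defFun (n + 1) D', symbolFun n D')

/-- The cocycles in `C_def^n(A)`. -/
def defCocycles (n : ℕ) : Submodule ℝ (DefCochain E F V n) := LinearMap.ker (A.defDiff n)

/-- The coboundaries in `C_def^n(A)`. -/
def defCoboundaries : ∀ n : ℕ, Submodule ℝ (DefCochain E F V n)
  | 0 => ⊥
  | n + 1 => (LinearMap.range (A.defDiff n)).comap ((defFun (n + 1)).prod (symbolFun n))

/-- The deformation cohomology `H_def^n(A)`. -/
abbrev DefCoh (n : ℕ) : Type _ :=
  A.defCocycles n ⧸ (A.defCoboundaries n).submoduleOf (A.defCocycles n)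

/-- The class of a cocycle in `H_def^n(A)`. -/
def defClass (n : ℕ) : A.defCocycles n →ₗ[ℝ] A.DefCoh n := Submodule.mkQ _

end Deformation

section Maps

/-- A `C^∞(M)`-multilinear cochain with values in `g(A)` as an `ℝ`-multilinear map
`Γ(A)^n → Γ(A)`. -/
def inclMap (n : ℕ) :
    Cochain E F V A.isotropySec n →ₗ[ℝ] (Sec E F V [⋀^Fin n]→ₗ[ℝ] Sec E F V) where
  toFun η :=
    { MultilinearMap.restrictScalars ℝ
        (A.isotropySec.subtype.compMultilinearMap η.toMultilinearMap) with
      map_eq_zero_of_eq' := fun v _ _ h hij =>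
        congrArg Subtype.val (η.map_eq_zero_of_eq v h hij) }
  map_add' _ _ := rfl
  map_smul' _ _ := rfl

theorem inclMap_apply (n : ℕ) (η : Cochain E F V A.isotropySec n) (v : Fin n → Sec E F V) :
    A.inclMap n η v = (η v : Sec E F V) := rfl

/-- The inclusion `C^n(A; g(A)) ⊆ C_def^n(A)` as the `C^∞(M)`-multilinear maps with values in
`g(A)`, which are multiderivations with symbol zero. -/
def inclCochain (n : ℕ) : Cochain E F V A.isotropySec n →ₗ[ℝ] DefCochain E F V n :=
  LinearMap.codRestrict (defSubmodule E F V n) ((A.inclMap n).prod 0) (by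
    intro η
    match n, η with
    | 0, η => exact Submodule.mem_top
    | n + 1, η =>
      intro s f t
      have h0 : lieDeriv (0 : VecField E M) f = 0 := by
        ext x; exact map_zero (mvfderiv 𝓘(ℝ, E) f x)
      have h := η.map_update_smul (Fin.snoc s t) (Fin.last n) f t
      rw [Fin.update_snoc_last, Fin.update_snoc_last] at h
      change (η (Fin.snoc s (f • t)) : Sec E F V)
        = f • (η (Fin.snoc s t) : Sec E F V) + lieDeriv (0 : VecField E M) f • t
      rw [h, h0, zero_smul, add_zero]
      rfl)

/-- The class in `ν` of the symbol of a multiderivation, `C_def^{n+1}(A) → C^n(A; ν)`. -/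
def normalSymbol (n : ℕ) : DefCochain E F V (n + 1) →ₗ[ℝ] Cochain E F V A.normalSec n where
  toFun D := A.toNormal.compAlternatingMap (symbol n D)
  map_add' D D' := by
    ext1 s
    exact map_add A.toNormal (symbol n D s) (symbol n D' s)
  map_smul' c D := by
    ext1 s
    exact LinearMap.map_smul_of_tower A.toNormal c (symbol n D s)

end Maps

end LieAlgebroid

end LieAlgebroidDeformation

end

/-! Let `K` be the kernel of `D ↦ σ_D mod ρ(A)` on `C_def`, with `K^0 = Γ(A)`. It contains `C(A;
g(A))`. The two facts behind the theorem are that the symbol map is onto `C(A; ν)` and that `C(A;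
g(A)) ⊂ K` is a quasi-isomorphism; the long exact sequence of `0 → K → C_def → C(A; ν)[-1] → 0` then
becomes the stated one.

Surjectivity (`IsRegular.normalSymbol_surjective`): constant rank gives a `C^∞(M)`-linear splitting
of `𝔛(M) → Γ(ν)`, so a cochain `c` lifts to some `σ` with values in vector fields. Antisymmetrising
`∇_{σ(…)} s` for a connection `∇` on `A` gives a multiderivation with symbol `σ`.

Comparison (`IsDefDiff.exists_sub_eq_inclCochain`): a cochain with zero symbol and `n` arguments
satisfies `σ_{δD} = (-1)^{n+1} ρ ∘ D`. If `σ_D` takes values in `ρ(A)`, lift it through `ρ` by a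
`C^∞(M)`-linear right inverse `θ` on `ρ(A)`. The tensorial cochain `D₀ = ± θ ∘ σ_D` has `σ_{δD₀} =
σ_D`, so `D - δD₀` has zero symbol. If also `σ_{δD} = 0`, the same formula gives `ρ ∘ (D - δD₀) =
0`, that is, `D - δD₀` lies in `C(A; g(A))`.

That all differentials are well defined and square to zero follows by induction on the degree from
Cartan's formula `ι_α δ = L_α - δ ι_α` (`ceDiff_cons`), where `ι_α` is `curryLeft`. The homological
algebra is isolated in `exists_long_exact_sequence`. -/

noncomputable section

namespace LieAlgebroidDeformation

namespace LieAlgebroid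

/-! ### Cartan's formula for the Chevalley–Eilenberg differential. -/

section ChevalleyEilenberg

variable {L W : Type*} [AddCommGroup L] [Module ℝ L] [AddCommGroup W] [Module ℝ W]

/-- The action of an endomorphism `g` on alternating maps by
`∑ k, η(s_0, …, g s_k, …, s_{n-1})`. -/
def altDeriv (g : L →ₗ[ℝ] L) {n : ℕ} (η : L [⋀^Fin n]→ₗ[ℝ] W) : L [⋀^Fin n]→ₗ[ℝ] W where
  toFun s := ∑ k, η (Function.update s k (g (s k)))
  map_update_add' := by
    intro inst s i x y
    obtain rfl : inst = instDecidableEqFin n := Subsingleton.elim _ _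
    rw [← Finset.sum_add_distrib]
    refine Finset.sum_congr rfl fun k _ => ?_
    rcases eq_or_ne k i with rfl | h
    · simp
    · rw [Function.update_of_ne h, Function.update_of_ne h, Function.update_of_ne h]
      rw [Function.update_comm h.symm, Function.update_comm h.symm, Function.update_comm h.symm,
        η.map_update_add]
  map_update_smul' := by
    intro inst s i c x
    obtain rfl : inst = instDecidableEqFin n := Subsingleton.elim _ _
    rw [Finset.smul_sum]
    refine Finset.sum_congr rfl fun k _ => ?_
    rcases eq_or_ne k i with rfl | h
    · simp
    · rw [Function.update_of_ne h, Function.update_of_ne h]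
      rw [Function.update_comm h.symm, Function.update_comm h.symm, η.map_update_smul]
  map_eq_zero_of_eq' := by
    intro s i j hs hij
    change ∑ k, η (Function.update s k (g (s k))) = 0
    -- Replacing an entry other than `i`, `j` leaves two equal entries, so only these two terms
    -- survive; they differ by the transposition of `i` and `j` and cancel.
    rw [Fintype.sum_eq_add i j hij]
    · rw [← η.map_swap_add (Function.update s i (g (s i))) hij]
      rw [add_comm, add_left_inj]
      congr 1
      funext k
      simp only [Function.comp_apply]
      rcases eq_or_ne k i with rfl | hi
      · simp [hij, hij.symm, hs]
      rcases eq_or_ne k j with rfl | hj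
      · simp [hs]
      · simp [Equiv.swap_apply_of_ne_of_ne hi hj, hi, hj]
    · rintro k ⟨hi, hj⟩
      exact η.map_eq_zero_of_eq _ (by simp [hi.symm, hj.symm, hs]) hij

theorem altDeriv_apply (g : L →ₗ[ℝ] L) {n : ℕ} (η : L [⋀^Fin n]→ₗ[ℝ] W) (s : Fin n → L) :
    altDeriv g η s = ∑ k, η (Function.update s k (g (s k))) := rfl

variable (br : L →ₗ[ℝ] L →ₗ[ℝ] L) (nab : L →ₗ[ℝ] W →ₗ[ℝ] W)

/-- The Lie derivative `(L_α η)(s) = ∇_α(η(s)) - ∑ k, η(s_0, …, [α, s_k], …, s_{n-1})`. -/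
def altLie (n : ℕ) : L →ₗ[ℝ] (L [⋀^Fin n]→ₗ[ℝ] W) →ₗ[ℝ] (L [⋀^Fin n]→ₗ[ℝ] W) :=
  LinearMap.mk₂ ℝ (fun α η => (nab α).compAlternatingMap η - altDeriv (br α) η)
    (by
      intro α β η; ext s
      simp [altDeriv_apply, Finset.sum_add_distrib]; abel)
    (by
      intro c α η; ext s
      simp [altDeriv_apply, Finset.smul_sum, smul_sub])
    (by
      intro α η θ; ext s
      simp [altDeriv_apply, Finset.sum_add_distrib]; abel)
    (by
      intro c α η; ext s
      simp [altDeriv_apply, Finset.smul_sum, smul_sub])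

theorem altLie_apply {n : ℕ} (α : L) (η : L [⋀^Fin n]→ₗ[ℝ] W) (s : Fin n → L) :
    altLie br nab n α η s = nab α (η s) - ∑ k, η (Function.update s k (br α (s k))) := rfl

omit [AddCommGroup L] [Module ℝ L] in
theorem ceDiff_zero_apply (br : L → L → L) (nab : L → W →ₗ[ℝ] W)
    (η : (Fin 0 → L) → W) (v : Fin 1 → L) :
    ceDiff br nab 0 η v = nab (v 0) (η Fin.elim0) := by
  simp [ceDiff, ceBracketPart]
  congr 2
  exact Subsingleton.elim _ _

theorem curryLeft_cons {n : ℕ} (η : L [⋀^Fin (n + 1)]→ₗ[ℝ] W) (α : L) (s : Fin n → L) :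
    η.curryLeft α s = η (Fin.cons α s) := rfl

/-- Translates between the terms of `L_α`, where `[α, s_k]` stands in slot `k`, and those of the
differential, where the bracket stands first. -/
theorem update_eq_sign_cons {n : ℕ} (η : L [⋀^Fin (n + 1)]→ₗ[ℝ] W) (s : Fin (n + 1) → L)
    (k : Fin (n + 1)) (x : L) :
    η (Function.update s k x) = (-1 : ℝ) ^ (k : ℕ) • η (Fin.cons x fun i => s (k.succAbove i)) := by
  have h := η.map_insertNth k x (k.removeNth s)
  rw [Fin.insertNth_removeNth] at h
  rw [h]
  rcases Nat.even_or_odd (k : ℕ) with hk | hk <;> simp [hk.neg_one_pow] <;> rfl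

/-- Cartan's formula. The terms in which `α` acts through `∇` or occurs inside the bracket form `L_α
η`; in all others `α` is a passive argument, and they form `-δ(ι_α η)`. It reduces later statements
about `δ` to one degree lower. -/
theorem ceDiff_cons {n : ℕ} (η : L [⋀^Fin (n + 1)]→ₗ[ℝ] W) (α : L) (s : Fin (n + 1) → L) :
    ceDiff (fun a b => br a b) (fun a => nab a) (n + 1) η (Fin.cons α s)
      = altLie br nab (n + 1) α η s
        - ceDiff (fun a b => br a b) (fun a => nab a) n (η.curryLeft α) s := by
  have hcons : ∀ k : Fin (n + 1), (fun l => (Fin.cons α s : Fin (n + 2) → L) (k.succ.succAbove l))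
      = Fin.cons α (fun l => s (k.succAbove l)) := by
    intro k
    funext l
    refine Fin.cases ?_ (fun l => ?_) l <;> simp [Fin.succ_succAbove_succ]
  have h1 : ∑ i : Fin (n + 2), (-1 : ℝ) ^ (i : ℕ) • nab ((Fin.cons α s : Fin (n + 2) → L) i)
        (η fun k => (Fin.cons α s : Fin (n + 2) → L) (i.succAbove k))
      = nab α (η s) - ∑ i : Fin (n + 1), (-1 : ℝ) ^ (i : ℕ) • nab (s i)
        (η.curryLeft α fun k => s (i.succAbove k)) := by
    rw [Fin.sum_univ_succ, sub_eq_add_neg, ← Finset.sum_neg_distrib]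
    congr 1
    · simp
    · refine Finset.sum_congr rfl fun k _ => ?_
      rw [hcons, Fin.val_succ, pow_succ, mul_neg_one, neg_smul]
      rfl
  have h2 : ceBracketPart (fun a b => br a b) (n + 1) η (Fin.cons α s)
      = -(∑ k, η (Function.update s k (br α (s k))))
        - ceBracketPart (fun a b => br a b) n (η.curryLeft α) s := by
    change ∑ j : Fin (n + 2), ∑ i : Fin (n + 1), _ = _
    -- No `i` lies below `j = 0`. For the remaining `j`, the terms with `i = 0` are those containing
    -- `[α, s_k]`.
    rw [Fin.sum_univ_succ]
    simp only [Fin.not_lt_zero, if_false, Finset.sum_const_zero, zero_add]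
    refine (Finset.sum_congr rfl fun j _ => Fin.sum_univ_succ _).trans ?_
    rw [Finset.sum_add_distrib, sub_eq_add_neg, ← Finset.sum_neg_distrib]
    congr 1
    · refine Finset.sum_congr rfl fun k _ => ?_
      rw [update_eq_sign_cons, ← neg_smul]
      simp [pow_succ]
    · clear h1
      obtain _ | n := n
      · simp [ceBracketPart]
      · change _ = -∑ j : Fin (n + 2), ∑ i : Fin (n + 1), _
        rw [← Finset.sum_neg_distrib]
        refine Finset.sum_congr rfl fun j _ => ?_
        rw [← Finset.sum_neg_distrib]
        refine Finset.sum_congr rfl fun i _ => ?_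
        -- In the remaining terms the bracket comes first and `α` second. Exchanging them gives the
        -- minus sign; both indices shift by one, so `(-1)^(i+j)` is unchanged.
        have hswap : ∀ (x y : L) (t : Fin n → L),
            η (Fin.cons x (Fin.cons y t)) = -η (Fin.cons y (Fin.cons x t)) := by
          intro x y t
          rw [← η.map_swap _ (show (0 : Fin (n + 2)) ≠ 1 by simp)]
          congr 1
          funext k
          refine Fin.cases (by simp) (fun k => ?_) k
          refine Fin.cases (by simp) (fun k => ?_) k
          have h0 : k.succ.succ ≠ (0 : Fin (n + 2)) := Fin.succ_ne_zero _
          have h1 : k.succ.succ ≠ (1 : Fin (n + 2)) := by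
            simp [Fin.ext_iff]
          simp [Equiv.swap_apply_of_ne_of_ne h0 h1]
        have htail : (fun k => (Fin.cons α s : Fin (n + 3) → L)
            (j.succ.succAbove (i.succ.succAbove k)))
            = Fin.cons α fun k => s (j.succAbove (i.succAbove k)) := by
          funext k
          refine Fin.cases ?_ (fun k => ?_) k <;> simp [Fin.succ_succAbove_succ]
        rw [htail]
        simp only [← Fin.succ_castSucc, Fin.succ_lt_succ_iff, Fin.cons_succ, Fin.val_succ]
        split_ifs
        · rw [hswap, curryLeft_cons, smul_neg, neg_inj]
          congr 1
          ring
        · simp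
  have h3 : ceDiff (fun a b => br a b) (fun a => nab a) n (η.curryLeft α) s
      = (∑ i : Fin (n + 1), (-1 : ℝ) ^ (i : ℕ) • nab (s i)
        (η.curryLeft α fun k => s (i.succAbove k)))
        + ceBracketPart (fun a b => br a b) n (η.curryLeft α) s := rfl
  refine (congrArg₂ (· + ·) h1 h2).trans ?_
  rw [h3, altLie_apply]
  abel

end ChevalleyEilenberg

/-! ### The differential on alternating maps, and `δ² = 0`. -/

section AlternatingDifferential

variable {L W : Type*} [AddCommGroup L] [Module ℝ L] [AddCommGroup W] [Module ℝ W]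

theorem alternating_ext_curryLeft {n : ℕ} {η θ : L [⋀^Fin (n + 1)]→ₗ[ℝ] W}
    (h : ∀ α, η.curryLeft α = θ.curryLeft α) : η = θ := by
  ext s
  have := congrArg (fun ζ => ζ (Fin.tail s)) (h (s 0))
  simp only [curryLeft_cons, Fin.cons_self_tail] at this
  exact this

theorem coeFn_alternating_add {n : ℕ} (η θ : L [⋀^Fin n]→ₗ[ℝ] W) : ⇑(η + θ) = ⇑η + ⇑θ := rfl

theorem coeFn_alternating_smul {n : ℕ} (c : ℝ) (η : L [⋀^Fin n]→ₗ[ℝ] W) :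
    ⇑(c • η) = c • ⇑η := rfl

/-- Each `g α` is already alternating, so only a coincidence between `α` and another argument has to
be checked; moving that argument to the front reduces it to `hg`. -/
theorem exists_curryLeft_eq {n : ℕ} (g : L →ₗ[ℝ] L [⋀^Fin (n + 1)]→ₗ[ℝ] W)
    (hg : ∀ α, (g α).curryLeft α = 0) :
    ∃ θ : L [⋀^Fin (n + 2)]→ₗ[ℝ] W, ∀ α, θ.curryLeft α = g α := by
  have hg' : ∀ (α : L) (s : Fin (n + 1) → L) (k : Fin (n + 1)), s k = α → g α s = 0 := by
    rintro _ s k rfl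
    have h := update_eq_sign_cons (g (s k)) s k (s k)
    rw [Function.update_eq_self] at h
    rw [h, ← curryLeft_cons, hg, AlternatingMap.zero_apply, smul_zero]
  refine ⟨{ LinearMap.uncurryLeft (AlternatingMap.toMultilinearMapLM ∘ₗ g) with
    map_eq_zero_of_eq' := ?_ }, ?_⟩
  · intro v i j hv hij
    change g (v 0) (Fin.tail v) = 0
    induction i using Fin.cases with
    | zero =>
      induction j using Fin.cases with
      | zero => exact absurd rfl hij
      | succ j => exact hg' _ _ j hv.symm
    | succ i =>
      induction j using Fin.cases with
      | zero => exact hg' _ _ i hv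
      | succ j => exact (g (v 0)).map_eq_zero_of_eq _ hv fun h => hij (congrArg Fin.succ h)
  · intro α
    ext s
    rfl

variable (br : L →ₗ[ℝ] L →ₗ[ℝ] L) (nab : L →ₗ[ℝ] W →ₗ[ℝ] W)

/-- The Cartan relation `[L_α, ι_β] = ι_{[α, β]}`. -/
theorem curryLeft_altLie {n : ℕ} (α β : L) (η : L [⋀^Fin (n + 1)]→ₗ[ℝ] W) :
    (altLie br nab (n + 1) α η).curryLeft β
      = altLie br nab n α (η.curryLeft β) - η.curryLeft (br α β) := by
  ext s
  simp only [AlternatingMap.sub_apply, curryLeft_cons, altLie_apply, Fin.sum_univ_succ,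
    Fin.cons_zero, Fin.cons_succ, Fin.update_cons_zero, Fin.cons_update]
  abel

theorem ceDiff_one_cons (η : L [⋀^Fin 0]→ₗ[ℝ] W) (α : L) (s : Fin 0 → L) :
    ceDiff (fun a b => br a b) (fun a => nab a) 0 η (Fin.cons α s) = altLie br nab 0 α η s := by
  rw [ceDiff_zero_apply, altLie_apply, Fin.cons_zero, Subsingleton.elim s Fin.elim0]
  simp

/-- By induction `δη` is assembled from its contractions `L_α η - δ(ι_α η)`. The condition for this
is that a further `ι_α` kills them: `ι_α L_α η = L_α ι_α η` because `[α, α] = 0`, and `ι_α δ ι_α η =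
L_α ι_α η` because `ι_α ι_α = 0`. Neither the Jacobi identity nor flatness enters. -/
theorem exists_alternating_eq_ceDiff {br : L →ₗ[ℝ] L →ₗ[ℝ] L} (hbr : ∀ α, br α α = 0)
    (nab : L →ₗ[ℝ] W →ₗ[ℝ] W) (n : ℕ) (η : L [⋀^Fin n]→ₗ[ℝ] W) :
    ∃ θ : L [⋀^Fin (n + 1)]→ₗ[ℝ] W,
      ⇑θ = ceDiff (fun a b => br a b) (fun a => nab a) n η := by
  induction n with
  | zero =>
    refine ⟨AlternatingMap.ofSubsingleton (ι := Fin 1) ℝ L W 0 (nab.flip (η Fin.elim0)), ?_⟩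
    funext v
    rw [ceDiff_zero_apply]
    rfl
  | succ n ih =>
    choose d hd using ih
    let g : L →ₗ[ℝ] L [⋀^Fin (n + 1)]→ₗ[ℝ] W :=
      { toFun := fun α => altLie br nab (n + 1) α η - d (η.curryLeft α)
        map_add' := by
          intro α β
          have h : d (η.curryLeft (α + β)) = d (η.curryLeft α) + d (η.curryLeft β) := by
            apply DFunLike.coe_injective
            rw [hd, map_add, coeFn_alternating_add, map_add, ← hd, ← hd]
            rfl
          rw [h, map_add, LinearMap.add_apply]
          abel
        map_smul' := by
          intro c α
          have h : d (η.curryLeft (c • α)) = c • d (η.curryLeft α) := by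
            apply DFunLike.coe_injective
            rw [hd, map_smul, coeFn_alternating_smul, map_smul, ← hd]
            rfl
          rw [h, map_smul, LinearMap.smul_apply, smul_sub, RingHom.id_apply] }
    obtain ⟨θ, hθ⟩ := exists_curryLeft_eq g (by
      intro α
      ext s
      change altLie br nab (n + 1) α η (Fin.cons α s) - d (η.curryLeft α) (Fin.cons α s) = 0
      rw [hd, ← curryLeft_cons, curryLeft_altLie, hbr, map_zero, sub_zero]
      obtain _ | n := n
      · rw [ceDiff_one_cons, sub_self]
      · have h0 : ceDiff (fun a b => br a b) (fun a => nab a) n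
            (0 : L [⋀^Fin n]→ₗ[ℝ] W) = 0 := map_zero _
        rw [ceDiff_cons, AlternatingMap.curryLeft_same, h0, Pi.zero_apply, sub_zero, sub_self])
    refine ⟨θ, funext fun v => ?_⟩
    rw [← Fin.cons_self_tail v, ← curryLeft_cons, hθ, ceDiff_cons, ← hd]
    rfl

variable {br} (hbr : ∀ α, br α α = 0)

/-- The Chevalley–Eilenberg differential on alternating maps. -/
def ceAlt (n : ℕ) : (L [⋀^Fin n]→ₗ[ℝ] W) →ₗ[ℝ] (L [⋀^Fin (n + 1)]→ₗ[ℝ] W) where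
  toFun η := (exists_alternating_eq_ceDiff hbr nab n η).choose
  map_add' η θ := by
    apply DFunLike.coe_injective
    refine (Exists.choose_spec (exists_alternating_eq_ceDiff hbr nab n (η + θ))).trans ?_
    rw [coeFn_alternating_add η θ, map_add]
    exact (congrArg₂ (· + ·) (Exists.choose_spec (exists_alternating_eq_ceDiff hbr nab n η))
      (Exists.choose_spec (exists_alternating_eq_ceDiff hbr nab n θ))).symm
  map_smul' c η := by
    apply DFunLike.coe_injective
    refine (Exists.choose_spec (exists_alternating_eq_ceDiff hbr nab n (c • η))).trans ?_
    rw [coeFn_alternating_smul c η, map_smul]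
    exact (congrArg (c • ·) (Exists.choose_spec (exists_alternating_eq_ceDiff hbr nab n η))).symm

theorem coe_ceAlt {n : ℕ} (η : L [⋀^Fin n]→ₗ[ℝ] W) :
    ⇑(ceAlt nab hbr n η) = ceDiff (fun a b => br a b) (fun a => nab a) n η :=
  (exists_alternating_eq_ceDiff hbr nab n η).choose_spec

theorem curryLeft_ceAlt_zero (α : L) (η : L [⋀^Fin 0]→ₗ[ℝ] W) :
    (ceAlt nab hbr 0 η).curryLeft α = altLie br nab 0 α η := by
  ext s
  rw [curryLeft_cons, coe_ceAlt, ceDiff_one_cons]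

theorem curryLeft_ceAlt {n : ℕ} (α : L) (η : L [⋀^Fin (n + 1)]→ₗ[ℝ] W) :
    (ceAlt nab hbr (n + 1) η).curryLeft α
      = altLie br nab (n + 1) α η - ceAlt nab hbr n (η.curryLeft α) := by
  ext s
  rw [curryLeft_cons, coe_ceAlt, ceDiff_cons, AlternatingMap.sub_apply, coe_ceAlt]

variable {nab} (hjac : ∀ α β γ, br α (br β γ) = br (br α β) γ + br β (br α γ))
  (hflat : ∀ α β w, nab α (nab β w) = nab (br α β) w + nab β (nab α w))

include hjac hflat

/-- `[L_α, L_β] = L_{[α, β]}`: flatness of `∇` in degree zero; contraction with `γ` raises the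
degree, the extra terms matching by the Jacobi identity. -/
theorem altLie_altLie {n : ℕ} (α β : L) (η : L [⋀^Fin n]→ₗ[ℝ] W) :
    altLie br nab n α (altLie br nab n β η)
      = altLie br nab n (br α β) η + altLie br nab n β (altLie br nab n α η) := by
  induction n with
  | zero =>
    ext s
    simp [altLie_apply, hflat α β]
  | succ n ih =>
    refine alternating_ext_curryLeft fun γ => ?_
    rw [AlternatingMap.curryLeft_add, LinearMap.add_apply]
    simp only [curryLeft_altLie, map_sub, ih, hjac α β γ, map_add]
    abel

theorem ceAlt_altLie {n : ℕ} (α : L) (η : L [⋀^Fin n]→ₗ[ℝ] W) :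
    ceAlt nab hbr n (altLie br nab n α η) = altLie br nab (n + 1) α (ceAlt nab hbr n η) := by
  induction n with
  | zero =>
    refine alternating_ext_curryLeft fun β => ?_
    rw [curryLeft_altLie, curryLeft_ceAlt_zero, curryLeft_ceAlt_zero, curryLeft_ceAlt_zero,
      altLie_altLie hjac hflat α β]
    abel
  | succ n ih =>
    refine alternating_ext_curryLeft fun β => ?_
    simp only [curryLeft_altLie, curryLeft_ceAlt, map_sub, ih, altLie_altLie hjac hflat α β]
    abel

/-- `ι_α δδη = L_α δη - δ(L_α η - δ ι_α η) = δδ(ι_α η)`, since `δ` commutes with `L_α`; the right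
side vanishes by induction. -/
theorem ceAlt_ceAlt {n : ℕ} (η : L [⋀^Fin n]→ₗ[ℝ] W) :
    ceAlt nab hbr (n + 1) (ceAlt nab hbr n η) = 0 := by
  induction n with
  | zero =>
    refine alternating_ext_curryLeft fun α => ?_
    rw [curryLeft_ceAlt, curryLeft_ceAlt_zero, ceAlt_altLie hbr hjac hflat, sub_self]
    simp
  | succ n ih =>
    refine alternating_ext_curryLeft fun α => ?_
    rw [curryLeft_ceAlt, curryLeft_ceAlt, map_sub, ih, ceAlt_altLie hbr hjac hflat]
    simp

end AlternatingDifferential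

/-! ### Naturality of the differential in the coefficients. -/

section Naturality

variable {L W W' : Type*} [AddCommGroup W] [Module ℝ W] [AddCommGroup W'] [Module ℝ W']

/-- Applied to three intertwiners: the inclusion of `Γ(g(A))` in `Γ(A)`, the anchor, and the
projection to `Γ(ν)`. -/
theorem ceDiff_comp (br : L → L → L) (nab : L → W →ₗ[ℝ] W) (nab' : L → W' →ₗ[ℝ] W')
    (φ : W →ₗ[ℝ] W') (h : ∀ α w, φ (nab α w) = nab' α (φ w)) (n : ℕ) (η : (Fin n → L) → W)
    (s : Fin (n + 1) → L) :
    ceDiff br nab' n (fun v => φ (η v)) s = φ (ceDiff br nab n η s) := by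
  have h1 : ceBracketPart br n (fun v => φ (η v)) s = φ (ceBracketPart br n η s) := by
    obtain _ | n := n
    · simp [ceBracketPart]
    · simp only [ceBracketPart, LinearMap.coe_mk, AddHom.coe_mk, map_sum]
      refine Finset.sum_congr rfl fun j _ => Finset.sum_congr rfl fun i _ => ?_
      split_ifs <;> simp
  simp only [ceDiff, LinearMap.coe_mk, AddHom.coe_mk, map_add, map_sum, map_smul, h, h1]

end Naturality

/-! ### Tensoriality over the ring of functions. -/

section Tensorial

variable {R L W : Type*} [CommRing R] [AddCommGroup L] [Module ℝ L] [AddCommGroup W] [Module ℝ W]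
  [Module R L] [Module R W]

variable (R) in
/-- An alternating `ℝ`-multilinear map is tensorial if it is homogeneous over `R`. -/
def IsTensorial {n : ℕ} (η : L [⋀^Fin n]→ₗ[ℝ] W) : Prop :=
  ∀ (s : Fin n → L) (i : Fin n) (f : R), η (Function.update s i (f • s i)) = f • η s

theorem isTensorial_zero_args (η : L [⋀^Fin 0]→ₗ[ℝ] W) : IsTensorial R η := fun _ i => i.elim0

theorem IsTensorial.map_update_smul {n : ℕ} {η : L [⋀^Fin n]→ₗ[ℝ] W} (h : IsTensorial R η)
    (s : Fin n → L) (i : Fin n) (f : R) (x : L) :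
    η (Function.update s i (f • x)) = f • η (Function.update s i x) := by
  have := h (Function.update s i x) i f
  rwa [Function.update_idem, Function.update_self] at this

/-- By antisymmetry any slot can be moved to slot `k`, and the signs on the two sides agree. -/
theorem isTensorial_iff_slot [SMulCommClass R ℝ W] {n : ℕ}
    {η : L [⋀^Fin (n + 1)]→ₗ[ℝ] W} (k : Fin (n + 1)) :
    IsTensorial R η ↔ ∀ (s : Fin (n + 1) → L) (f : R),
      η (Function.update s k (f • s k)) = f • η s := by
  refine ⟨fun h s f => h s k f, fun h s i f => ?_⟩
  have hcons : ∀ (x : L) (t : Fin n → L),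
      η (Fin.cons x t) = (-1 : ℝ) ^ (k : ℕ) • η (k.insertNth x t) := by
    intro x t
    have := update_eq_sign_cons η (k.insertNth x t) k x
    rw [← Fin.insertNth_self_removeNth k (Function.update _ _ _)] at this
    simp only [Fin.insertNth_apply_succAbove, Fin.removeNth_update, Function.update_self,
      Fin.removeNth_insertNth] at this
    rw [this, smul_smul, ← pow_add, Even.neg_one_pow ⟨_, rfl⟩, one_smul]
  have hself : η s = η (Function.update s i (s i)) := by rw [Function.update_eq_self]
  rw [hself, update_eq_sign_cons, update_eq_sign_cons, hcons, hcons]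
  have := h (k.insertNth (s i) fun j => s (i.succAbove j)) f
  rw [Fin.insertNth_apply_same] at this
  rw [smul_comm f, smul_comm f, ← this]
  congr 3
  funext j
  rcases eq_or_ne j k with rfl | hj
  · simp
  · obtain ⟨j, rfl⟩ := Fin.exists_succAbove_eq hj
    simp

/-- With at least two arguments there is a slot which survives contraction of the first one, and
homogeneity in that slot suffices. With one argument there is none, hence the separate criterion
`isTensorial_one_iff`. -/
theorem isTensorial_iff_curryLeft [SMulCommClass R ℝ W] {n : ℕ} {η : L [⋀^Fin (n + 2)]→ₗ[ℝ] W} :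
    IsTensorial R η ↔ ∀ α, IsTensorial R (η.curryLeft α) := by
  constructor
  · intro h α s i f
    have := h (Fin.cons α s) i.succ f
    rwa [Fin.cons_succ, ← Fin.cons_update] at this
  · intro h
    refine (isTensorial_iff_slot 1).2 fun s f => ?_
    have := h (s 0) (Fin.tail s) 0 f
    rw [curryLeft_cons, curryLeft_cons, Fin.cons_update, Fin.cons_self_tail] at this
    exact this

theorem isTensorial_one_iff [SMulCommClass R ℝ W] {η : L [⋀^Fin 1]→ₗ[ℝ] W} :
    IsTensorial R η ↔ ∀ (f : R) (α : L),
      η.curryLeft (f • α) Fin.elim0 = f • η.curryLeft α Fin.elim0 := by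
  rw [isTensorial_iff_slot 0]
  have h1 : ∀ s : Fin 1 → L, Fin.cons (s 0) Fin.elim0 = s := fun s => by
    funext i; rw [Fin.eq_zero i]; rfl
  have h2 : ∀ (s : Fin 1 → L) (x : L), Fin.cons x Fin.elim0 = Function.update s 0 x := fun s x => by
    funext i; rw [Fin.eq_zero i]; simp
  constructor
  · intro h f α
    have := h (Fin.cons α Fin.elim0) f
    rw [← h2] at this
    exact this
  · intro h s f
    have := h f (s 0)
    rw [curryLeft_cons, curryLeft_cons, h1, h2 s] at this
    exact this

theorem IsTensorial.sub {n : ℕ} {η θ : L [⋀^Fin n]→ₗ[ℝ] W} (hη : IsTensorial R η)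
    (hθ : IsTensorial R θ) : IsTensorial R (η - θ) := fun s i f => by
  simp [hη s i f, hθ s i f, smul_sub]

/-- A tensorial alternating map as an alternating map over `R`. -/
def IsTensorial.toAlternating {n : ℕ} {η : L [⋀^Fin n]→ₗ[ℝ] W} (h : IsTensorial R η) :
    L [⋀^Fin n]→ₗ[R] W where
  toFun := η
  map_update_add' := by
    intro inst s i x y
    obtain rfl : inst = instDecidableEqFin n := Subsingleton.elim _ _
    exact η.map_update_add s i x y
  map_update_smul' := by
    intro inst s i f x
    obtain rfl : inst = instDecidableEqFin n := Subsingleton.elim _ _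
    exact h.map_update_smul s i f x
  map_eq_zero_of_eq' := fun s _ _ hs hij => η.map_eq_zero_of_eq s hs hij

variable {br : L →ₗ[ℝ] L →ₗ[ℝ] L} {nab : L →ₗ[ℝ] W →ₗ[ℝ] W} {act : L → R → R}
  (hbr : ∀ α, br α α = 0)
  (hleib : ∀ α (f : R) β, br α (f • β) = f • br α β + act α f • β)
  (hnab : ∀ α (f : R) w, nab α (f • w) = f • nab α w + act α f • w)

-- With one argument, the term `act α f • η β` produced by `nab α (η (f • β))` cancels the one
-- produced by `η (br α (f • β))`. Homogeneity of `nab` in `α` is not involved, so the lemma also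
-- applies to `vecConn`.
include hleib hnab in
theorem IsTensorial.altLie [SMulCommClass R ℝ W] {n : ℕ} {η : L [⋀^Fin n]→ₗ[ℝ] W}
    (h : IsTensorial R η) (α : L) :
    IsTensorial R (altLie br nab n α η) := by
  induction n with
  | zero => exact isTensorial_zero_args _
  | succ n ih =>
    obtain _ | n := n
    · rw [isTensorial_one_iff] at h ⊢
      intro f β
      rw [curryLeft_altLie, curryLeft_altLie, AlternatingMap.sub_apply, AlternatingMap.sub_apply,
        hleib, map_add, AlternatingMap.add_apply, h, h]
      simp only [altLie_apply, Finset.univ_eq_empty, Finset.sum_empty, sub_zero, h, hnab, smul_sub]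
      abel
    · rw [isTensorial_iff_curryLeft] at h ⊢
      intro β
      rw [curryLeft_altLie]
      exact (ih (h β)).sub (h _)

-- Homogeneity of `nab` in its first argument enters only in degree zero; Cartan's formula carries
-- tensoriality upwards.
include hleib hnab in
theorem IsTensorial.ceAlt [SMulCommClass R ℝ W]
    (hnab' : ∀ (f : R) α w, nab (f • α) w = f • nab α w)
    {n : ℕ} {η : L [⋀^Fin n]→ₗ[ℝ] W} (h : IsTensorial R η) :
    IsTensorial R (ceAlt nab hbr n η) := by
  induction n with
  | zero =>
    rw [isTensorial_one_iff]
    intro f α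
    simp [curryLeft_ceAlt_zero, altLie_apply, hnab']
  | succ n ih =>
    rw [isTensorial_iff_curryLeft]
    intro α
    rw [curryLeft_ceAlt]
    refine (h.altLie hleib hnab α).sub (ih ?_)
    obtain _ | n := n
    · exact isTensorial_zero_args _
    · exact isTensorial_iff_curryLeft.1 h α

end Tensorial

end LieAlgebroid

/-! ### Calculus of derivatives along vector fields. -/

section LieDerivative

variable {E : Type*} [NormedAddCommGroup E] [NormedSpace ℝ E]
  {M : Type*} [TopologicalSpace M] [ChartedSpace E M] [IsManifold 𝓘(ℝ, E) ∞ M]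

theorem lieDeriv_add_left (X Y : VecField E M) (f : SmoothFun E M) :
    lieDeriv (X + Y) f = lieDeriv X f + lieDeriv Y f := by
  ext x; exact map_add (mvfderiv 𝓘(ℝ, E) f x) (X x) (Y x)

theorem lieDeriv_zero_left (f : SmoothFun E M) : lieDeriv (0 : VecField E M) f = 0 := by
  ext x; exact map_zero (mvfderiv 𝓘(ℝ, E) f x)

theorem lieDeriv_neg_left (X : VecField E M) (f : SmoothFun E M) :
    lieDeriv (-X) f = -lieDeriv X f := by
  ext x; exact map_neg (mvfderiv 𝓘(ℝ, E) f x) (X x)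

theorem lieDeriv_sub_left (X Y : VecField E M) (f : SmoothFun E M) :
    lieDeriv (X - Y) f = lieDeriv X f - lieDeriv Y f := by
  ext x; exact map_sub (mvfderiv 𝓘(ℝ, E) f x) (X x) (Y x)

theorem lieDeriv_smul_left (g : SmoothFun E M) (X : VecField E M) (f : SmoothFun E M) :
    lieDeriv (g • X) f = g * lieDeriv X f := by
  ext x; exact map_smul (mvfderiv 𝓘(ℝ, E) f x) (g x) (X x)

theorem lieDeriv_add_right (X : VecField E M) (f g : SmoothFun E M) :
    lieDeriv X (f + g) = lieDeriv X f + lieDeriv X g := by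
  ext x
  exact congrArg (fun T => T (X x)) (mvfderiv_add (f.contMDiff.mdifferentiable (by simp) x)
    (g.contMDiff.mdifferentiable (by simp) x))

theorem lieDeriv_mul (X : VecField E M) (f g : SmoothFun E M) :
    lieDeriv X (f * g) = f * lieDeriv X g + lieDeriv X f * g := by
  ext x
  refine (congrArg (fun T => T (X x)) (mvfderiv_mul (f.contMDiff.mdifferentiable (by simp) x)
    (g.contMDiff.mdifferentiable (by simp) x))).trans ?_
  rw [mul_comm (lieDeriv X f)]
  rfl

theorem lieDeriv_const_smul_right (X : VecField E M) (c : ℝ) (f : SmoothFun E M) :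
    lieDeriv X (c • f) = c • lieDeriv X f := by
  ext x
  have h := mvfderiv_smul (I := 𝓘(ℝ, E)) (x := x)
    (mdifferentiableAt_const (c := c)) (f.contMDiff.mdifferentiable (by simp) x)
  refine (congrArg (fun T => T (X x)) h).trans ?_
  simp [mvfderiv_const]
  exact Or.inl rfl

/-- Expanding the Jacobi identity for `X`, `Y`, `f • Z` by the Leibniz rule leaves the claim
multiplied by `Z`; choose `Z` nonzero at the point. On a zero-dimensional manifold both sides
vanish. -/
theorem lieDeriv_vecBracket [FiniteDimensional ℝ E] [T2Space M] [SigmaCompactSpace M]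
    (X Y : VecField E M) (f : SmoothFun E M) :
    lieDeriv (vecBracket X Y) f = lieDeriv X (lieDeriv Y f) - lieDeriv Y (lieDeriv X f) := by
  have h : ∀ Z : VecField E M, lieDeriv (vecBracket X Y) f • Z
      = lieDeriv X (lieDeriv Y f) • Z - lieDeriv Y (lieDeriv X f) • Z := by
    intro Z
    have h := vecBracket_jacobi X Y (f • Z)
    simp only [vecBracket_smul, map_add] at h
    rw [vecBracket_jacobi X Y Z, smul_add] at h
    rw [← sub_eq_zero] at h ⊢
    rw [← neg_eq_zero, ← h]
    abel
  ext x
  rcases subsingleton_or_nontrivial E with hE | hE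
  · have hX : ∀ (X : VecField E M) (f : SmoothFun E M), lieDeriv X f x = 0 := fun X f => by
      rw [lieDeriv_apply, show X x = 0 from Subsingleton.elim (α := E) _ _]
      exact map_zero (mvfderiv 𝓘(ℝ, E) f x)
    change lieDeriv _ _ x = lieDeriv _ _ x - lieDeriv _ _ x
    rw [hX, hX, hX, sub_zero]
  · obtain ⟨z, hz⟩ := exists_ne (0 : E)
    obtain ⟨Z, hZ⟩ := exists_sec_eq (E := E) (F := E)
      (V := (TangentSpace 𝓘(ℝ, E) : M → Type _)) x z
    have e := congrArg (fun s : VecField E M => s x) (h Z)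
    rw [← sub_smul] at e
    simp only [smul_sec_apply, hZ] at e
    exact smul_left_injective ℝ hz e

end LieDerivative

namespace LieAlgebroid

/-! ### Multiderivations and their behaviour under contraction and `L_α`. -/

section MultiDerivation

variable {E : Type*} [NormedAddCommGroup E] [NormedSpace ℝ E]
  {F : Type*} [NormedAddCommGroup F] [NormedSpace ℝ F]
  {M : Type*} [TopologicalSpace M] [ChartedSpace E M] [IsManifold 𝓘(ℝ, E) ∞ M]
  {V : M → Type*} [TopologicalSpace (TotalSpace F V)] [∀ x, TopologicalSpace (V x)]
  [FiberBundle F V] [∀ x, AddCommGroup (V x)] [∀ x, Module ℝ (V x)] [VectorBundle ℝ F V]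

/-- `D` is a multiderivation with symbol `σ`. -/
def IsMultiDer {n : ℕ} (D : Sec E F V [⋀^Fin (n + 1)]→ₗ[ℝ] Sec E F V)
    (σ : Sec E F V [⋀^Fin n]→ₗ[ℝ] VecField E M) : Prop :=
  ∀ (s : Fin n → Sec E F V) (f : SmoothFun E M) (t : Sec E F V),
    D (Fin.snoc s (f • t)) = f • D (Fin.snoc s t) + lieDeriv (σ s) f • t

/-- The Leibniz rule concerns the last slot and contraction the first, so with two or more arguments
they do not interfere. -/
theorem isMultiDer_iff_curryLeft {n : ℕ} {D : Sec E F V [⋀^Fin (n + 2)]→ₗ[ℝ] Sec E F V}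
    {σ : Sec E F V [⋀^Fin (n + 1)]→ₗ[ℝ] VecField E M} :
    IsMultiDer D σ ↔ ∀ α, IsMultiDer (D.curryLeft α) (σ.curryLeft α) := by
  constructor
  · intro h α s f t
    have := h (Fin.cons α s) f t
    rwa [← Fin.cons_snoc_eq_snoc_cons, ← Fin.cons_snoc_eq_snoc_cons] at this
  · intro h s f t
    have := h (s 0) (Fin.tail s) f t
    rwa [curryLeft_cons, curryLeft_cons, curryLeft_cons, Fin.cons_snoc_eq_snoc_cons,
      Fin.cons_snoc_eq_snoc_cons, Fin.cons_self_tail] at this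

theorem isMultiDer_one_iff {D : Sec E F V [⋀^Fin 1]→ₗ[ℝ] Sec E F V}
    {σ : Sec E F V [⋀^Fin 0]→ₗ[ℝ] VecField E M} :
    IsMultiDer D σ ↔ ∀ (f : SmoothFun E M) (t : Sec E F V),
      D.curryLeft (f • t) Fin.elim0
        = f • D.curryLeft t Fin.elim0 + lieDeriv (σ Fin.elim0) f • t := by
  have h : ∀ (s : Fin 0 → Sec E F V) (t : Sec E F V),
      (Fin.snoc s t : Fin 1 → Sec E F V) = Fin.cons t Fin.elim0 := fun s t => by
    funext i; rw [Fin.eq_zero i]; rfl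
  constructor
  · intro hD f t
    have := hD Fin.elim0 f t
    rw [h, h] at this
    exact this
  · intro hD s f t
    rw [h, h, Subsingleton.elim s Fin.elim0]
    exact hD f t

theorem IsMultiDer.sub {n : ℕ} {D D' : Sec E F V [⋀^Fin (n + 1)]→ₗ[ℝ] Sec E F V}
    {σ σ' : Sec E F V [⋀^Fin n]→ₗ[ℝ] VecField E M} (h : IsMultiDer D σ) (h' : IsMultiDer D' σ') :
    IsMultiDer (D - D') (σ - σ') := by
  intro s f t
  simp only [AlternatingMap.sub_apply, h s f t, h' s f t, lieDeriv_sub_left, sub_smul, smul_sub]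
  abel

variable (A : LieAlgebroid E F V) [FiniteDimensional ℝ E]

/-- The operators `[ρ(α), ·]` on vector fields. -/
def vecConn : Sec E F V →ₗ[ℝ] VecField E M →ₗ[ℝ] VecField E M :=
  vecBracket.comp (A.rho.restrictScalars ℝ)

theorem vecConn_apply (α : Sec E F V) (X : VecField E M) :
    A.vecConn α X = vecBracket (A.rho α) X := rfl

theorem vecConn_smul (α : Sec E F V) (f : SmoothFun E M) (X : VecField E M) :
    A.vecConn α (f • X) = f • A.vecConn α X + lieDeriv (A.rho α) f • X :=
  vecBracket_smul _ _ _

theorem vecBracket_swap (X Y : VecField E M) : vecBracket X Y = -vecBracket Y X := by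
  ext x; exact VectorField.mlieBracket_swap_apply

/-- The defect `-X(f) ρ(α)` keeps `[ρ(α), ·]` from being a representation. It is why the symbol of
`δD` needs the term `± ρ ∘ D`, and it disappears modulo `ρ(A)`. -/
theorem vecConn_smul_left (α : Sec E F V) (f : SmoothFun E M) (X : VecField E M) :
    A.vecConn (f • α) X = f • A.vecConn α X - lieDeriv X f • A.rho α := by
  rw [vecConn_apply, map_smul, vecBracket_swap, vecBracket_smul, vecConn_apply,
    vecBracket_swap (A.rho α), smul_neg]
  abel

variable [T2Space M] [SigmaCompactSpace M]

/-- With one argument this is the computation that a commutator of derivations has the commutator of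
the symbols as its symbol (`lieDeriv_vecBracket`). -/
theorem IsMultiDer.altLie {n : ℕ} {D : Sec E F V [⋀^Fin (n + 1)]→ₗ[ℝ] Sec E F V}
    {σ : Sec E F V [⋀^Fin n]→ₗ[ℝ] VecField E M} (h : IsMultiDer D σ) (α : Sec E F V) :
    IsMultiDer (altLie A.bracket A.bracket (n + 1) α D)
      (altLie A.bracket A.vecConn n α σ) := by
  induction n with
  | zero =>
    rw [isMultiDer_one_iff] at h ⊢
    intro f t
    rw [curryLeft_altLie, curryLeft_altLie]
    simp only [AlternatingMap.sub_apply, altLie_apply, Finset.univ_eq_empty, Finset.sum_empty,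
      sub_zero, vecConn_apply, lieDeriv_vecBracket, h, bracket_smul, map_add,
      AlternatingMap.add_apply, smul_sub, sub_smul]
    abel
  | succ n ih =>
    rw [isMultiDer_iff_curryLeft] at h ⊢
    intro β
    rw [curryLeft_altLie, curryLeft_altLie]
    exact (ih (h β)).sub (h _)

end MultiDerivation

section RestrictScalars

variable {R L W : Type*} [CommRing R] [Algebra ℝ R] [AddCommGroup L] [Module ℝ L] [AddCommGroup W]
  [Module ℝ W] [Module R L] [Module R W] [IsScalarTower ℝ R L] [IsScalarTower ℝ R W]

/-- An alternating map over `R` as an alternating map over `ℝ`. -/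
def restrictAlternating {n : ℕ} (η : L [⋀^Fin n]→ₗ[R] W) : L [⋀^Fin n]→ₗ[ℝ] W :=
  { MultilinearMap.restrictScalars ℝ η.toMultilinearMap with
    map_eq_zero_of_eq' := fun s _ _ h hij => η.map_eq_zero_of_eq s h hij }

theorem coe_restrictAlternating {n : ℕ} (η : L [⋀^Fin n]→ₗ[R] W) :
    ⇑(restrictAlternating η) = η := rfl

theorem isTensorial_restrictAlternating {n : ℕ} (η : L [⋀^Fin n]→ₗ[R] W) :
    IsTensorial R (restrictAlternating η) := fun s i f => by
  have := η.map_update_smul s i f (s i)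
  rwa [Function.update_eq_self] at this

end RestrictScalars

/-! ### The deformation complex is a complex. -/

section Closure

variable {E : Type*} [NormedAddCommGroup E] [NormedSpace ℝ E]
  {F : Type*} [NormedAddCommGroup F] [NormedSpace ℝ F]
  {M : Type*} [TopologicalSpace M] [ChartedSpace E M] [IsManifold 𝓘(ℝ, E) ∞ M]
  {V : M → Type*} [TopologicalSpace (TotalSpace F V)] [∀ x, TopologicalSpace (V x)]
  [FiberBundle F V] [∀ x, AddCommGroup (V x)] [∀ x, Module ℝ (V x)] [VectorBundle ℝ F V]
  (A : LieAlgebroid E F V)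

section Representation

variable {W : Type*} [AddCommGroup W] [Module (SmoothFun E M) W] [Module ℝ W]
  [IsScalarTower ℝ (SmoothFun E M) W] [SMulCommClass (SmoothFun E M) ℝ W]

/-- A representation of the Lie algebroid on a module of sections. -/
structure IsRepresentation (nab : Sec E F V →ₗ[ℝ] W →ₗ[ℝ] W) : Prop where
  smul_left : ∀ (f : SmoothFun E M) α w, nab (f • α) w = f • nab α w
  leibniz : ∀ α (f : SmoothFun E M) w, nab α (f • w) = f • nab α w + lieDeriv (A.rho α) f • w
  flat : ∀ α β w, nab α (nab β w) = nab (A.bracket α β) w + nab β (nab α w)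

variable {A} {nab : Sec E F V →ₗ[ℝ] W →ₗ[ℝ] W} (h : A.IsRepresentation nab)

include h in
theorem IsRepresentation.exists_repDiff_eq {n : ℕ} (η : Cochain E F V W n) :
    ∃ θ : Cochain E F V W (n + 1),
      cochainFun (n + 1) θ = A.repDiff (fun α => nab α) n η :=
  ⟨((isTensorial_restrictAlternating η).ceAlt A.bracket_self
    (fun α f β => A.bracket_smul f α β) h.leibniz h.smul_left).toAlternating,
    coe_ceAlt nab A.bracket_self (restrictAlternating η)⟩

end Representation

omit [IsManifold 𝓘(ℝ, E) ∞ M] in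
theorem isTensorial_curryLeft {n : ℕ} {W : Type*} [AddCommGroup W] [Module (SmoothFun E M) W]
    [Module ℝ W] [SMulCommClass (SmoothFun E M) ℝ W]
    {σ : Sec E F V [⋀^Fin (n + 1)]→ₗ[ℝ] W}
    (h : IsTensorial (SmoothFun E M) σ) (α : Sec E F V) :
    IsTensorial (SmoothFun E M) (σ.curryLeft α) := by
  obtain _ | n := n
  · exact isTensorial_zero_args _
  · exact isTensorial_iff_curryLeft.1 h α

theorem bracket_swap (α β : Sec E F V) : A.bracket α β = -A.bracket β α := by
  have h := A.bracket_self (α + β)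
  simp only [map_add, LinearMap.add_apply, A.bracket_self, zero_add, add_zero] at h
  exact eq_neg_of_add_eq_zero_right h

theorem isMultiDer_ceAlt_zero (D : Sec E F V [⋀^Fin 0]→ₗ[ℝ] Sec E F V) :
    IsMultiDer (ceAlt A.bracket A.bracket_self 0 D)
      (-(A.rho.restrictScalars ℝ).compAlternatingMap D) := by
  rw [isMultiDer_one_iff]
  intro f t
  simp only [curryLeft_ceAlt_zero, altLie_apply, Finset.univ_eq_empty, Finset.sum_empty, sub_zero,
    AlternatingMap.neg_apply, LinearMap.compAlternatingMap_apply, LinearMap.coe_restrictScalars,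
    lieDeriv_neg_left, A.bracket_swap _ (D Fin.elim0), bracket_smul, smul_neg, neg_smul, neg_add]

variable [FiniteDimensional ℝ E]

/-- The symbol of the differential of a multiderivation. -/
def diffSymbol {n : ℕ} (D : Sec E F V [⋀^Fin (n + 1)]→ₗ[ℝ] Sec E F V)
    (σ : Sec E F V [⋀^Fin n]→ₗ[ℝ] VecField E M) : Sec E F V [⋀^Fin (n + 1)]→ₗ[ℝ] VecField E M :=
  ceAlt A.vecConn A.bracket_self n σ
    + (-1 : ℝ) ^ n • (A.rho.restrictScalars ℝ).compAlternatingMap D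

theorem curryLeft_diffSymbol_zero (D : Sec E F V [⋀^Fin 1]→ₗ[ℝ] Sec E F V)
    (σ : Sec E F V [⋀^Fin 0]→ₗ[ℝ] VecField E M) (α : Sec E F V) :
    (A.diffSymbol D σ).curryLeft α = altLie A.bracket A.vecConn 0 α σ
      + (A.rho.restrictScalars ℝ).compAlternatingMap (D.curryLeft α) := by
  rw [diffSymbol, AlternatingMap.curryLeft_add, LinearMap.add_apply, curryLeft_ceAlt_zero,
    pow_zero, one_smul, AlternatingMap.curryLeft_compAlternatingMap]

/-- Cartan's formula for symbols. The alternating sign in front of `ρ ∘ D` is what lets the extra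
term fit the recursion. -/
theorem curryLeft_diffSymbol {n : ℕ} (D : Sec E F V [⋀^Fin (n + 2)]→ₗ[ℝ] Sec E F V)
    (σ : Sec E F V [⋀^Fin (n + 1)]→ₗ[ℝ] VecField E M) (α : Sec E F V) :
    (A.diffSymbol D σ).curryLeft α = altLie A.bracket A.vecConn (n + 1) α σ
      - A.diffSymbol (D.curryLeft α) (σ.curryLeft α) := by
  rw [diffSymbol, diffSymbol, AlternatingMap.curryLeft_add, LinearMap.add_apply, curryLeft_ceAlt,
    AlternatingMap.curryLeft_smul, LinearMap.smul_apply,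
    AlternatingMap.curryLeft_compAlternatingMap, pow_succ, mul_neg_one, neg_smul]
  abel

/-- In the lowest degree the defect `-σ(f) ρ(α)` of `[ρ(f α), σ]` cancels the term `σ(f) ρ(α)`
coming from `ρ(D(f α))`. -/
theorem IsMultiDer.isTensorial_diffSymbol {n : ℕ}
    {D : Sec E F V [⋀^Fin (n + 1)]→ₗ[ℝ] Sec E F V}
    {σ : Sec E F V [⋀^Fin n]→ₗ[ℝ] VecField E M} (h : IsMultiDer D σ)
    (hσ : IsTensorial (SmoothFun E M) σ) :
    IsTensorial (SmoothFun E M) (A.diffSymbol D σ) := by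
  induction n with
  | zero =>
    rw [isMultiDer_one_iff] at h
    rw [isTensorial_one_iff]
    intro f α
    simp only [curryLeft_diffSymbol_zero, AlternatingMap.add_apply, altLie_apply,
      Finset.univ_eq_empty, Finset.sum_empty, sub_zero, vecConn_smul_left,
      LinearMap.compAlternatingMap_apply, LinearMap.coe_restrictScalars, h, map_add, map_smul,
      smul_add]
    abel
  | succ n ih =>
    rw [isTensorial_iff_curryLeft]
    intro α
    rw [curryLeft_diffSymbol]
    exact (hσ.altLie (fun α f β => A.bracket_smul f α β) A.vecConn_smul α).sub
      (ih (isMultiDer_iff_curryLeft.1 h α) (isTensorial_curryLeft hσ α))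

variable [T2Space M] [SigmaCompactSpace M]

theorem IsMultiDer.ceAlt {n : ℕ}
    {D : Sec E F V [⋀^Fin (n + 1)]→ₗ[ℝ] Sec E F V}
    {σ : Sec E F V [⋀^Fin n]→ₗ[ℝ] VecField E M} (h : IsMultiDer D σ) :
    IsMultiDer (ceAlt A.bracket A.bracket_self (n + 1) D) (A.diffSymbol D σ) := by
  induction n with
  | zero =>
    rw [isMultiDer_iff_curryLeft]
    intro α
    rw [curryLeft_ceAlt, curryLeft_diffSymbol_zero, ← sub_neg_eq_add]
    exact (h.altLie A α).sub (A.isMultiDer_ceAlt_zero _)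
  | succ n ih =>
    rw [isMultiDer_iff_curryLeft] at h ⊢
    intro α
    rw [curryLeft_ceAlt, curryLeft_diffSymbol]
    exact ((isMultiDer_iff_curryLeft.2 h).altLie A α).sub (ih (h α))

theorem exists_isDefDiff {n : ℕ} (D : DefCochain E F V n) :
    ∃ D' : DefCochain E F V (n + 1), A.IsDefDiff D D' := by
  obtain _ | n := n
  · refine ⟨⟨(LieAlgebroid.ceAlt A.bracket A.bracket_self 0 (defPair 0 D).1,
      (isTensorial_zero_args (R := SmoothFun E M)
        (-(A.rho.restrictScalars ℝ).compAlternatingMap (defPair 0 D).1)).toAlternating),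
      A.isMultiDer_ceAlt_zero _⟩, ?_⟩
    refine Prod.ext ?_ ?_
    · exact (coe_ceAlt _ A.bracket_self (defPair 0 D).1).symm
    · rfl
  · have hD : IsMultiDer (defPair (n + 1) D).1 (restrictAlternating (symbol n D)) := D.2
    have hσ := hD.isTensorial_diffSymbol A (isTensorial_restrictAlternating _)
    let D' : multiDer E F V (n + 1) :=
      ⟨(LieAlgebroid.ceAlt A.bracket A.bracket_self (n + 1) (defPair (n + 1) D).1,
        hσ.toAlternating), hD.ceAlt A⟩
    refine ⟨D', ?_⟩
    refine Prod.ext ?_ ?_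
    · exact (coe_ceAlt _ A.bracket_self (defPair (n + 1) D).1).symm
    · funext s
      have h : A.diffSymbol (defPair (n + 1) D).1 (restrictAlternating (symbol n D)) s
          = ceDiff (fun α β => A.bracket α β) (fun α => A.vecConn α) n (symbolFun n D) s
            + (-1 : ℝ) ^ n • A.rhoComp (n + 1) (defFun (n + 1) D) s := by
        rw [diffSymbol, AlternatingMap.add_apply, coe_ceAlt]
        rfl
      exact h.symm

variable [ContMDiffVectorBundle ∞ F V 𝓘(ℝ, E)]

variable {A}

theorem vecConn_flat (α β : Sec E F V) (X : VecField E M) :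
    A.vecConn α (A.vecConn β X) = A.vecConn (A.bracket α β) X + A.vecConn β (A.vecConn α X) := by
  rw [vecConn_apply A (A.bracket α β), rho_bracket]
  exact vecBracket_jacobi _ _ _

theorem ceDiff_rhoComp (n : ℕ) (D : (Fin n → Sec E F V) → Sec E F V) :
    ceDiff (fun α β => A.bracket α β) (fun α => A.vecConn α) n (A.rhoComp n D)
      = A.rhoComp (n + 1) (ceDiff (fun α β => A.bracket α β) (fun α => A.bracket α) n D) :=
  funext fun s => ceDiff_comp _ _ _ (A.rho.restrictScalars ℝ) (A.rho_bracket) n D s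

/-- For the symbol, `δ(δσ + (-1)^n ρ ∘ D) + (-1)^{n+1} ρ ∘ δD` is zero: `δδσ = 0` because `[ρ(α),
·]` is flat, and `δ(ρ ∘ D) = ρ ∘ δD` because `ρ` preserves brackets. -/
theorem IsDefDiff.defDiff_eq_zero {n : ℕ} {D : DefCochain E F V n} {D' : DefCochain E F V (n + 1)}
    (h : A.IsDefDiff D D') : A.defDiff (n + 1) D' = 0 := by
  have h1 : defFun (n + 1) D'
      = ceDiff (fun α β => A.bracket α β) (fun α => A.bracket α) n (defFun n D) :=
    (congrArg Prod.fst h).symm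
  have h2 : symbolFun n D' = A.defDiffSymbol n D := (congrArg Prod.snd h).symm
  refine Prod.ext ?_ ?_
  · have h3 := congrArg DFunLike.coe
      (ceAlt_ceAlt A.bracket_self A.jacobi A.jacobi (defPair n D).1)
    rw [coe_ceAlt, coe_ceAlt] at h3
    refine Eq.trans ?_ h3
    exact congrArg (ceDiff (fun α β => A.bracket α β) (fun α => A.bracket α) (n + 1)) h1
  · change ceDiff (fun α β => A.bracket α β) (fun α => A.vecConn α) n (symbolFun n D')
      + (-1 : ℝ) ^ n • A.rhoComp (n + 1) (defFun (n + 1) D') = 0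
    rw [h1, h2, ← ceDiff_rhoComp]
    obtain _ | n := n
    · change ceDiff (fun α β => A.bracket α β) (fun α => A.vecConn α) 0
        (-(A.rhoComp 0 (defFun 0 D))) + _ = 0
      rw [map_neg, pow_zero, one_smul, neg_add_cancel]
    · have h3 := congrArg DFunLike.coe
        (ceAlt_ceAlt A.bracket_self A.jacobi vecConn_flat (restrictAlternating (symbol n D)))
      rw [coe_ceAlt, coe_ceAlt] at h3
      have h4 : A.defDiffSymbol (n + 1) D
          = ceDiff (fun α β => A.bracket α β) (fun α => A.vecConn α) n (symbolFun n D)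
            + (-1 : ℝ) ^ n • A.rhoComp (n + 1) (defFun (n + 1) D) := rfl
      rw [h4, map_add, map_smul, pow_succ (-1 : ℝ) n, mul_neg_one, neg_smul,
        add_neg_cancel_right]
      exact h3

end Closure

end LieAlgebroid

/-! ### Local frames glued by partitions of unity. -/

section LocalFrames

variable {E : Type*} [NormedAddCommGroup E] [NormedSpace ℝ E]
  {F : Type*} [NormedAddCommGroup F] [NormedSpace ℝ F] [FiniteDimensional ℝ F]
  {M : Type*} [TopologicalSpace M] [ChartedSpace E M]
  {V : M → Type*} [TopologicalSpace (TotalSpace F V)] [∀ x, TopologicalSpace (V x)]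
  [FiberBundle F V] [∀ x, AddCommGroup (V x)] [∀ x, Module ℝ (V x)] [VectorBundle ℝ F V]
  [ContMDiffVectorBundle ∞ F V 𝓘(ℝ, E)]

/-- In a trivialization `τ`, let `Q` be a left inverse of the frame at `x₀` and `G x` the composite
of `Q` with the frame at `x`. As `G x₀ = 1`, `G` is invertible near `x₀`, and `G⁻¹ Q τ` is dual to
the frame. -/
theorem exists_local_dual {r : ℕ} (γ : Fin r → Sec E F V) (x₀ : M)
    (hγ : LinearIndependent ℝ fun i => γ i x₀) :
    ∃ (U : Set M) (f : ∀ x, V x →ₗ[ℝ] (Fin r → ℝ)), IsOpen U ∧ x₀ ∈ U ∧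
      (∀ s : Sec E F V, ∀ x ∈ U, ContMDiffAt 𝓘(ℝ, E) 𝓘(ℝ, Fin r → ℝ) ∞ (fun x => f x (s x)) x) ∧
      ∀ x ∈ U, ∀ i, f x (γ i x) = Pi.single i 1 := by
  let t := trivializationAt F V x₀
  have ht : x₀ ∈ t.baseSet := FiberBundle.mem_baseSet_trivializationAt' x₀
  let τ : ∀ x : M, V x →ₗ[ℝ] F := fun x => t.linearMapAt ℝ x
  have hτ : ∀ (s : Sec E F V), ∀ x ∈ t.baseSet,
      ContMDiffAt 𝓘(ℝ, E) 𝓘(ℝ, F) ∞ (fun x => τ x (s x)) x := by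
    intro s x hx
    refine ((t.contMDiffAt_section_iff hx).1 (s.contMDiff x)).congr_of_eventuallyEq ?_
    filter_upwards [t.open_baseSet.mem_nhds hx] with y hy
    exact congrFun (t.coe_linearMapAt_of_mem (R := ℝ) hy) (s y)
  let Φ : (Fin r → ℝ) →ₗ[ℝ] F := Fintype.linearCombination ℝ fun i => τ x₀ (γ i x₀)
  have hΦ : LinearMap.ker Φ = ⊥ := by
    have h : LinearIndependent ℝ fun i => τ x₀ (γ i x₀) := by
      refine hγ.map' (τ x₀) (LinearMap.ker_eq_bot.2 ?_)
      have := (t.linearEquivAt ℝ x₀ ht).injective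
      rwa [← LinearEquiv.coe_coe, ← t.linearMapAt_def_of_mem ht] at this
    exact h.fintypeLinearCombination_injective |> LinearMap.ker_eq_bot.2
  obtain ⟨Q', hQ'⟩ := Φ.exists_leftInverse_of_injective hΦ
  let Q : F →L[ℝ] (Fin r → ℝ) := LinearMap.toContinuousLinearMap Q'
  let G : M → ((Fin r → ℝ) →L[ℝ] (Fin r → ℝ)) := fun x =>
    ∑ i, ContinuousLinearMap.smulRightL ℝ (Fin r → ℝ) (Fin r → ℝ)
      (ContinuousLinearMap.proj i) (Q (τ x (γ i x)))
  have hG_apply : ∀ x c, G x c = ∑ i, c i • Q (τ x (γ i x)) := by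
    intro x c
    simp [G]
  have hG₀ : G x₀ = 1 := by
    ext1 c
    rw [hG_apply]
    have := LinearMap.congr_fun hQ' c
    simp only [Φ, LinearMap.comp_apply, Fintype.linearCombination_apply, map_sum, map_smul] at this
    exact this
  have hG : ∀ x ∈ t.baseSet,
      ContMDiffAt 𝓘(ℝ, E) 𝓘(ℝ, (Fin r → ℝ) →L[ℝ] (Fin r → ℝ)) ∞ G x := by
    intro x hx
    refine ContMDiffAt.sum fun i _ => ?_
    exact ((ContinuousLinearMap.smulRightL ℝ (Fin r → ℝ) (Fin r → ℝ)
      (ContinuousLinearMap.proj i)).comp Q).contMDiff.contMDiffAt.comp x (hτ (γ i) x hx)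
  have hGc : ContinuousOn G t.baseSet := fun x hx => (hG x hx).continuousAt.continuousWithinAt
  refine ⟨t.baseSet ∩ G ⁻¹' {u | IsUnit u},
    fun x => ((Ring.inverse (G x)).comp Q : F →L[ℝ] (Fin r → ℝ)).toLinearMap.comp (τ x),
    hGc.isOpen_inter_preimage t.open_baseSet Units.isOpen, ⟨ht, ?_⟩, ?_, ?_⟩
  · change IsUnit (G x₀)
    rw [hG₀]; exact isUnit_one
  · rintro s x ⟨hx, hu⟩
    obtain ⟨u, hu⟩ := hu
    have h1 : ContMDiffAt 𝓘(ℝ, E) 𝓘(ℝ, (Fin r → ℝ) →L[ℝ] (Fin r → ℝ)) ∞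
        (fun x => Ring.inverse (G x)) x := by
      have h0 : ContDiffAt ℝ ∞ (Ring.inverse : ((Fin r → ℝ) →L[ℝ] (Fin r → ℝ)) → _) (G x) := by
        rw [← hu]; exact contDiffAt_ringInverse ℝ u
      exact h0.contMDiffAt.comp x (hG x hx)
    exact h1.clm_apply (Q.contMDiff.contMDiffAt.comp x (hτ s x hx))
  · rintro x ⟨hx, hu⟩ i
    have h1 : Q (τ x (γ i x)) = G x (Pi.single i 1) := by
      rw [hG_apply, Finset.sum_eq_single i] <;> simp +contextual
    obtain ⟨u, hu⟩ := hu
    change Ring.inverse (G x) (Q (τ x (γ i x))) = _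
    rw [h1, ← hu, Ring.inverse_unit]
    exact DFunLike.congr_fun u.inv_mul _

variable [IsManifold 𝓘(ℝ, E) ∞ M] [FiniteDimensional ℝ E] [T2Space M] [SigmaCompactSpace M]

/-- Near `j` the sections `γ j i` stay independent, so by constant rank they span `P x` and the
local dual gives coordinates there; the cutoff `φ j` makes these global. Smoothness of `P` need not
be assumed. With `P = ⊤` this yields a connection, with `P = ρ(A)` a right inverse of the anchor. -/
theorem exists_frame_functionals {r : ℕ} (γ : M → Fin r → Sec E F V)
    (hγ : ∀ x₀, LinearIndependent ℝ fun i => γ x₀ i x₀)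
    (P : ∀ x, Submodule ℝ (V x)) (hP : ∀ x, Module.finrank ℝ (P x) = r)
    (hγP : ∀ j i x, γ j i x ∈ P x) :
    ∃ (φ : SmoothPartitionOfUnity M 𝓘(ℝ, E) M Set.univ)
      (a : M → Fin r → Sec E F V →ₗ[SmoothFun E M] SmoothFun E M),
      (∀ j i s, ∀ x ∉ tsupport (φ j), a j i s x = 0) ∧
      ∀ (j : M) (s : Sec E F V) (x : M), s x ∈ P x →
        ∑ i, a j i s x • γ j i x = φ j x • s x := by
  choose U f hUo hU hf hfγ using fun x₀ => exists_local_dual (γ x₀) x₀ (hγ x₀)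
  obtain ⟨φ, hφ⟩ : ∃ φ : SmoothPartitionOfUnity M 𝓘(ℝ, E) M Set.univ, φ.IsSubordinate U :=
    SmoothPartitionOfUnity.exists_isSubordinate 𝓘(ℝ, E) isClosed_univ U hUo
      fun x _ => Set.mem_iUnion.2 ⟨x, hU x⟩
  have hsm : ∀ j i (s : Sec E F V),
      ContMDiff 𝓘(ℝ, E) 𝓘(ℝ, ℝ) ∞ fun x => φ j x • f j x (s x) i := by
    intro j i s
    refine φ.contMDiff_smul fun x hx => ?_
    exact (ContinuousLinearMap.proj (R := ℝ) (φ := fun _ : Fin r => ℝ) i).contMDiff.contMDiffAt.comp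
      x (hf j s x (hφ j hx))
  refine ⟨φ, fun j i =>
    { toFun := fun s => ⟨fun x => φ j x • f j x (s x) i, hsm j i s⟩
      map_add' := ?_
      map_smul' := ?_ }, ?_, ?_⟩
  · intro s t
    ext x
    change φ j x • f j x (s x + t x) i = φ j x • f j x (s x) i + φ j x • f j x (t x) i
    rw [map_add, Pi.add_apply, smul_add]
  · intro g s
    ext x
    change φ j x • f j x (g x • s x) i = g x * (φ j x • f j x (s x) i)
    rw [map_smul, Pi.smul_apply, smul_eq_mul, smul_eq_mul, smul_eq_mul]
    ring
  · intro j i s x hx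
    change φ j x • f j x (s x) i = 0
    rw [image_eq_zero_of_notMem_tsupport hx, zero_smul]
  · intro j s x hs
    change ∑ i, (φ j x • f j x (s x) i) • γ j i x = _
    by_cases hx : x ∈ U j
    · have : FiniteDimensional ℝ (V x) :=
        ((trivializationAt F V x).linearEquivAt ℝ x
          (FiberBundle.mem_baseSet_trivializationAt' x)).symm.finiteDimensional
      have hdual : ∀ c : Fin r → ℝ, f j x (∑ i, c i • γ j i x) = c := by
        intro c
        rw [map_sum]
        simp only [map_smul, hfγ j x hx]
        funext k
        simp [Finset.sum_apply, Pi.single_apply]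
      let L : (Fin r → ℝ) →ₗ[ℝ] P x :=
        Fintype.linearCombination ℝ fun i => ⟨γ j i x, hγP j i x⟩
      have hL : ∀ c, (L c : V x) = ∑ i, c i • γ j i x := by
        intro c
        simp only [L, Fintype.linearCombination_apply]
        push_cast
        rfl
      have hinj : Function.Injective L := by
        intro c c' h
        rw [← hdual c, ← hdual c', ← hL, ← hL, h]
      have hsurj : Function.Surjective L :=
        (LinearMap.injective_iff_surjective_of_finrank_eq_finrank (by simp [hP])).1 hinj
      obtain ⟨c, hc⟩ := hsurj ⟨s x, hs⟩
      have hc' : s x = ∑ i, c i • γ j i x := by rw [← hL, hc]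
      rw [hc', hdual, Finset.smul_sum]
      simp only [smul_smul, smul_eq_mul]
    · have h0 : φ j x = 0 := image_eq_zero_of_notMem_tsupport fun h => hx (hφ j h)
      simp [h0]

omit [FiniteDimensional ℝ F] [ContMDiffVectorBundle ∞ F V 𝓘(ℝ, E)] [FiniteDimensional ℝ E]
  [T2Space M] [SigmaCompactSpace M] [IsManifold 𝓘(ℝ, E) ∞ M] in
theorem exists_locallyFinite_sum {r : ℕ} (φ : SmoothPartitionOfUnity M 𝓘(ℝ, E) M Set.univ)
    (h : M → Fin r → SmoothFun E M) (hh : ∀ j i, ∀ x ∉ tsupport (φ j), h j i x = 0)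
    (e : M → Fin r → Sec E F V) :
    ∃ s : Sec E F V, ∀ x, s x = ∑ j ∈ φ.fintsupport x, ∑ i, h j i x • e j i x := by
  refine ⟨⟨fun x => ∑ j ∈ φ.fintsupport x, ∑ i, h j i x • e j i x, fun x₀ => ?_⟩, fun x => rfl⟩
  refine ((∑ j ∈ φ.fintsupport x₀, ∑ i, h j i • e j i : Sec E F V).contMDiff
    x₀).congr_of_eventuallyEq ?_
  filter_upwards [φ.eventually_fintsupport_subset x₀] with x hx
  congr 1
  have hcoe : (∑ j ∈ φ.fintsupport x₀, ∑ i, h j i • e j i : Sec E F V) x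
      = ∑ j ∈ φ.fintsupport x₀, ∑ i, h j i x • e j i x := by
    have h1 := map_sum (ContMDiffSection.coeAddHom 𝓘(ℝ, E) F ∞ V)
      (fun j => ∑ i, h j i • e j i) (φ.fintsupport x₀)
    refine (congrFun h1 x).trans ?_
    rw [Finset.sum_apply]
    refine Finset.sum_congr rfl fun j _ => ?_
    refine (congrFun (map_sum (ContMDiffSection.coeAddHom 𝓘(ℝ, E) F ∞ V) _ _) x).trans ?_
    rw [Finset.sum_apply]
    rfl
  rw [hcoe]
  refine Finset.sum_subset hx fun j _ hj => ?_
  rw [φ.mem_fintsupport_iff] at hj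
  exact Finset.sum_eq_zero fun i _ => by rw [hh j i x hj, zero_smul]

end LocalFrames

/-! ### A connection on `A`, and splittings of the anchor and of `TM → ν`. -/

section Splittings

variable {E : Type*} [NormedAddCommGroup E] [NormedSpace ℝ E] [FiniteDimensional ℝ E]
  {F : Type*} [NormedAddCommGroup F] [NormedSpace ℝ F]
  {M : Type*} [TopologicalSpace M] [ChartedSpace E M] [IsManifold 𝓘(ℝ, E) ∞ M]
  [T2Space M] [SigmaCompactSpace M]
  {V : M → Type*} [TopologicalSpace (TotalSpace F V)] [∀ x, TopologicalSpace (V x)]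
  [FiberBundle F V] [∀ x, AddCommGroup (V x)] [∀ x, Module ℝ (V x)] [VectorBundle ℝ F V]
  [ContMDiffVectorBundle ∞ F V 𝓘(ℝ, E)]

omit [FiniteDimensional ℝ E] [T2Space M] [SigmaCompactSpace M] in
theorem lieDeriv_eq_zero_of_eventuallyEq {f : SmoothFun E M} {x : M} (X : VecField E M)
    (h : ∀ᶠ y in 𝓝 x, f y = 0) : lieDeriv X f x = 0 := by
  have h1 : (f : M → ℝ) =ᶠ[𝓝 x] fun _ => 0 := h
  have h2 : mfderiv 𝓘(ℝ, E) 𝓘(ℝ, ℝ) f x = mfderiv 𝓘(ℝ, E) 𝓘(ℝ, ℝ) (fun _ : M => (0 : ℝ)) x :=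
    h1.mfderiv_eq
  have h3 : mfderiv 𝓘(ℝ, E) 𝓘(ℝ, ℝ) f x = 0 := h2.trans mfderiv_const
  exact congrArg (fun T => T (X x)) h3

/-- `∇_X s = ∑ X(a_{ji}(s)) γ_{ji}`. The Leibniz rule holds because `∑ a_{ji}(s) γ_{ji} = ∑ φ_j s =
s`. -/
theorem exists_connection [FiniteDimensional ℝ F] :
    ∃ nabla : VecField E M →ₗ[ℝ] Sec E F V →ₗ[ℝ] Sec E F V,
      (∀ (f : SmoothFun E M) X s, nabla (f • X) s = f • nabla X s) ∧
      ∀ X (f : SmoothFun E M) s, nabla X (f • s) = f • nabla X s + lieDeriv X f • s := by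
  have hfr (x : M) : Module.finrank ℝ (V x) = Module.finrank ℝ F :=
    ((trivializationAt F V x).linearEquivAt ℝ x
      (FiberBundle.mem_baseSet_trivializationAt' x)).finrank_eq
  have hfd (x : M) : FiniteDimensional ℝ (V x) :=
    ((trivializationAt F V x).linearEquivAt ℝ x
      (FiberBundle.mem_baseSet_trivializationAt' x)).symm.finiteDimensional
  let b (x : M) : Module.Basis (Fin (Module.finrank ℝ F)) ℝ (V x) :=
    Module.finBasisOfFinrankEq ℝ _ (hfr x)
  choose γ hγ using fun (x : M) i => exists_sec_eq (E := E) (F := F) x (b x i)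
  obtain ⟨φ, a, ha, hsum⟩ := exists_frame_functionals γ
    (fun x => by simpa only [hγ] using (b x).linearIndependent)
    (fun x => ⊤) (fun x => by rw [finrank_top, hfr]) (fun j i x => trivial)
  have ha' : ∀ (X : VecField E M) (s : Sec E F V) (j : M) i, ∀ x ∉ tsupport (φ j),
      lieDeriv X (a j i s) x = 0 := by
    intro X s j i x hx
    refine lieDeriv_eq_zero_of_eventuallyEq X ?_
    filter_upwards [(isClosed_tsupport (φ j)).isOpen_compl.mem_nhds hx] with y hy
    exact ha j i s y hy
  choose N hN using fun (X : VecField E M) (s : Sec E F V) => exists_locallyFinite_sum φ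
    (fun j i => lieDeriv X (a j i s)) (ha' X s) γ
  refine ⟨LinearMap.mk₂ ℝ N ?_ ?_ ?_ ?_, ?_, ?_⟩
  · intro X Y s
    ext x
    rw [ContMDiffSection.coe_add, Pi.add_apply, hN, hN, hN]
    simp only [lieDeriv_add_left, ContMDiffMap.coe_add, Pi.add_apply, add_smul,
      Finset.sum_add_distrib]
  · intro c X s
    ext x
    have h : ∀ f : SmoothFun E M, lieDeriv (c • X) f x = c * lieDeriv X f x := fun f =>
      map_smul (mvfderiv 𝓘(ℝ, E) f x) c (X x)
    rw [ContMDiffSection.coe_smul, Pi.smul_apply, hN, hN]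
    simp only [h, mul_smul, Finset.smul_sum]
  · intro X s s'
    ext x
    rw [ContMDiffSection.coe_add, Pi.add_apply, hN, hN, hN]
    simp only [map_add, lieDeriv_add_right, ContMDiffMap.coe_add, Pi.add_apply, add_smul,
      Finset.sum_add_distrib]
  · intro c X s
    ext x
    have h : ∀ j i, a j i (c • s) = c • a j i s := fun j i =>
      LinearMap.map_smul_of_tower (a j i) c s
    rw [ContMDiffSection.coe_smul, Pi.smul_apply, hN, hN]
    simp only [h, lieDeriv_const_smul_right, ContMDiffMap.coe_smul, Pi.smul_apply, smul_assoc,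
      Finset.smul_sum]
  · intro f X s
    ext x
    change N (f • X) s x = f x • N X s x
    rw [hN, hN]
    simp only [lieDeriv_smul_left, ContMDiffMap.coe_mul, Pi.mul_apply, mul_smul, Finset.smul_sum]
  · intro X f s
    ext x
    change N X (f • s) x = f x • N X s x + lieDeriv X f x • s x
    rw [hN, hN]
    simp only [map_smul, smul_eq_mul, lieDeriv_mul, ContMDiffMap.coe_add, ContMDiffMap.coe_mul,
      Pi.add_apply, Pi.mul_apply, add_smul, mul_smul, Finset.sum_add_distrib, Finset.smul_sum]
    congr 1
    simp only [← Finset.smul_sum, hsum _ s x trivial]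
    rw [← Finset.sum_smul,
      φ.sum_finsupport' x (Set.mem_univ x) (φ.finsupport_subset_fintsupport x), one_smul]

namespace LieAlgebroid

variable {A : LieAlgebroid E F V}

/-- `θ X = ∑ a_{ji}(X) β_{ji}`, where the `ρ(β_{ji})` are local frames of `ρ(A)`. The identity is
needed point by point: `X` may leave `ρ(A)` elsewhere. -/
theorem IsRegular.exists_anchor_section (hA : A.IsRegular) :
    ∃ θ : VecField E M →ₗ[SmoothFun E M] Sec E F V, ∀ (X : VecField E M) (x : M),
      X x ∈ LinearMap.range (A.anchor x) → A.anchor x (θ X x) = X x := by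
  obtain ⟨r, hr⟩ := hA
  have hfd (x : M) : FiniteDimensional ℝ (TangentSpace 𝓘(ℝ, E) x) :=
    inferInstanceAs (FiniteDimensional ℝ E)
  let b (x : M) : Module.Basis (Fin r) ℝ (LinearMap.range (A.anchor x)) :=
    Module.finBasisOfFinrankEq ℝ _ (hr x)
  have hβ : ∀ (x : M) i, ∃ β : Sec E F V, A.rho β x = b x i := by
    intro x i
    obtain ⟨w, hw⟩ := (b x i).2
    obtain ⟨β, hβ⟩ := exists_sec_eq (E := E) (F := F) x w
    exact ⟨β, by rw [rho_apply, hβ, hw]⟩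
  choose β hβ using hβ
  have hli : ∀ x, LinearIndependent ℝ fun i => A.rho (β x i) x := by
    intro x
    have h := (b x).linearIndependent.map' (LinearMap.range (A.anchor x)).subtype
      (Submodule.ker_subtype _)
    have e : (fun i => A.rho (β x i) x) = (LinearMap.range (A.anchor x)).subtype ∘ b x :=
      funext fun i => hβ x i
    rw [e]
    exact h
  obtain ⟨φ, a, ha, hsum⟩ := exists_frame_functionals (E := E) (F := E)
    (V := (TangentSpace 𝓘(ℝ, E) : M → Type _)) (fun x i => A.rho (β x i)) hli
    (fun x => LinearMap.range (A.anchor x)) hr (fun j i x => ⟨β j i x, rfl⟩)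
  choose N hN using fun X : VecField E M => exists_locallyFinite_sum φ
    (fun j i => a j i X) (fun j i => ha j i X) β
  refine ⟨{ toFun := N, map_add' := ?_, map_smul' := ?_ }, ?_⟩
  · intro X Y
    ext x
    rw [ContMDiffSection.coe_add, Pi.add_apply, hN, hN, hN]
    simp only [map_add, ContMDiffMap.coe_add, Pi.add_apply, add_smul, Finset.sum_add_distrib]
  · intro f X
    ext x
    rw [RingHom.id_apply, smul_sec_apply, hN, hN]
    simp only [map_smul, smul_eq_mul, ContMDiffMap.coe_mul, Pi.mul_apply, mul_smul,
      Finset.smul_sum]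
  · intro X x hX
    change A.anchor x (N X x) = X x
    have hsum' := fun j => hsum j X x hX
    simp only [rho_apply] at hsum'
    rw [hN]
    simp only [map_sum, map_smul, hsum']
    rw [← Finset.sum_smul,
      φ.sum_finsupport' x (Set.mem_univ x) (φ.finsupport_subset_fintsupport x), one_smul]

/-- The splitting sends the class of `X` to `X - ρ(θ X)`, whose value at `x` depends only on `X x`
modulo `ρ(A)` since `ρ ∘ θ` is the identity on `ρ(A)`. -/
theorem IsRegular.exists_normal_section (hA : A.IsRegular) :
    ∃ κ : A.normalSec →ₗ[SmoothFun E M] VecField E M, ∀ s, A.toNormal (κ s) = s := by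
  obtain ⟨θ, hθ⟩ := hA.exists_anchor_section
  have hwd : ∀ (X Y : VecField E M) (x : M), (LinearMap.range (A.anchor x)).mkQ (X x)
      = (LinearMap.range (A.anchor x)).mkQ (Y x) →
      (X - A.rho (θ X)) x = (Y - A.rho (θ Y)) x := by
    intro X Y x h
    have h1 := hθ (X - Y) x ((Submodule.Quotient.eq _).1 h)
    rw [map_sub] at h1
    have h2 : A.anchor x (θ X x) - A.anchor x (θ Y x) = X x - Y x := by
      rw [← map_sub]; exact h1
    change X x - A.anchor x (θ X x) = Y x - A.anchor x (θ Y x)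
    rw [sub_eq_sub_iff_sub_eq_sub, ← h2]
  choose ξ hξ using fun (s : A.normalSec) (x : M) => s.2 x
  have hN : ∀ s : A.normalSec, ∃ Z : VecField E M, ∀ (x : M) (X : VecField E M),
      s.1 x = (LinearMap.range (A.anchor x)).mkQ (X x) → Z x = (X - A.rho (θ X)) x := by
    intro s
    -- The representative `ξ s x` varies with the point without any regularity; near `x₀` it may be
    -- replaced by the fixed field `ξ s x₀`, which gives smoothness.
    refine ⟨⟨fun x => (ξ s x - A.rho (θ (ξ s x))) x, fun x₀ => ?_⟩, fun x X hX => ?_⟩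
    · refine ((ξ s x₀ - A.rho (θ (ξ s x₀))).contMDiff x₀).congr_of_eventuallyEq ?_
      filter_upwards [hξ s x₀] with x hx
      congr 1
      exact hwd _ _ x ((hξ s x).self_of_nhds.symm.trans hx)
    · exact hwd _ _ x ((hξ s x).self_of_nhds.symm.trans hX)
  choose N hN using hN
  refine ⟨{ toFun := N, map_add' := ?_, map_smul' := ?_ }, ?_⟩
  · intro s t
    ext x
    have hs := (hξ s x).self_of_nhds
    have ht := (hξ t x).self_of_nhds
    rw [ContMDiffSection.coe_add, Pi.add_apply, hN s x _ hs, hN t x _ ht,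
      hN (s + t) x (ξ s x + ξ t x) ((congrArg₂ (· + ·) hs ht).trans (map_add _ _ _).symm),
      map_add, map_add, add_sub_add_comm]
    rfl
  · intro f s
    ext x
    have hs := (hξ s x).self_of_nhds
    rw [RingHom.id_apply, smul_sec_apply, hN s x _ hs,
      hN (f • s) x (f • ξ s x) ((congrArg (f x • ·) hs).trans (map_smul _ _ _).symm),
      map_smul, map_smul, ← smul_sub]
    rfl
  · intro s
    refine normalSec_ext fun x => ?_
    have hs := (hξ s x).self_of_nhds
    rw [hs]
    change (LinearMap.range (A.anchor x)).mkQ (N s x) = _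
    rw [hN s x _ hs]
    refine (Submodule.Quotient.eq _).2 ⟨-θ (ξ s x) x, ?_⟩
    change A.anchor x (-θ (ξ s x) x) = ξ s x x - A.anchor x (θ (ξ s x) x) - ξ s x x
    rw [map_neg]
    abel

end LieAlgebroid

end Splittings

/-! ### Linear maps on quotients from linear relations. -/

section QuotientRelations

variable {X Y : Type*} [AddCommGroup X] [Module ℝ X] [AddCommGroup Y] [Module ℝ Y]

/-- Made for the connecting map, where the lift is a choice. Two values for the same `x` differ by a
value related to `0 ∈ p`, hence by an element of `q`. -/
theorem exists_quotient_map_of_relation (p : Submodule ℝ X) (q : Submodule ℝ Y)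
    (Γ : Submodule ℝ (X × Y)) (htotal : ∀ x, ∃ y, (x, y) ∈ Γ)
    (hpq : ∀ x y, (x, y) ∈ Γ → x ∈ p → y ∈ q) :
    ∃ L : X ⧸ p →ₗ[ℝ] Y ⧸ q, ∀ x y, (x, y) ∈ Γ → L (p.mkQ x) = q.mkQ y := by
  choose g hg using htotal
  have hwd : ∀ x y, (x, y) ∈ Γ → q.mkQ (g x) = q.mkQ y := by
    intro x y h
    refine (Submodule.Quotient.eq q).2 (hpq 0 _ ?_ p.zero_mem)
    have := Γ.sub_mem (hg x) h
    rwa [Prod.mk_sub_mk, sub_self] at this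
  let L₀ : X →ₗ[ℝ] Y ⧸ q :=
    { toFun := fun x => q.mkQ (g x)
      map_add' := fun x x' => by
        rw [← map_add]; exact hwd _ _ (Γ.add_mem (hg x) (hg x'))
      map_smul' := fun c x => by
        rw [RingHom.id_apply, ← map_smul]; exact hwd _ _ (Γ.smul_mem c (hg x)) }
  refine ⟨p.liftQ L₀ fun x hx => ?_, fun x y h => hwd x y h⟩
  exact (Submodule.Quotient.mk_eq_zero q).2 (hpq _ _ (hg x) hx)

end QuotientRelations

/-! ### The abstract long exact sequence. -/

section LongExactSequence

theorem mkQ_submoduleOf_eq_zero_iff {X : Type*} [AddCommGroup X] [Module ℝ X]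
    (Z B : Submodule ℝ X) (z : Z) : (B.submoduleOf Z).mkQ z = 0 ↔ (z : X) ∈ B :=
  Submodule.Quotient.mk_eq_zero _

/-- `G → C → N` need not be exact in the middle. Instead `hker`, `hker'` and `hker₀` express that
the inclusion of `G` in the kernel of `pr` is a quasi-isomorphism. In `hker'` the correction `D₀`
must itself lie in that kernel, so that a lift can be changed by `D₀` without changing its image in
`N`. -/
theorem exists_long_exact_sequence
    {G C N : ℕ → Type*} [∀ n, AddCommGroup (G n)] [∀ n, Module ℝ (G n)]
    [∀ n, AddCommGroup (C n)] [∀ n, Module ℝ (C n)] [∀ n, AddCommGroup (N n)]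
    [∀ n, Module ℝ (N n)]
    (dG : ∀ n, G n →ₗ[ℝ] G (n + 1)) (dC : ∀ n, C n →ₗ[ℝ] C (n + 1))
    (dN : ∀ n, N n →ₗ[ℝ] N (n + 1))
    (hdC : ∀ n x, dC (n + 1) (dC n x) = 0)
    (ZG BG : ∀ n, Submodule ℝ (G n)) (ZC BC : ∀ n, Submodule ℝ (C n))
    (ZN BN : ∀ n, Submodule ℝ (N n))
    (hZG : ∀ n x, x ∈ ZG n ↔ dG n x = 0) (hZC : ∀ n x, x ∈ ZC n ↔ dC n x = 0)
    (hZN : ∀ n x, x ∈ ZN n ↔ dN n x = 0)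
    (hBG₀ : BG 0 = ⊥) (hBG : ∀ n x, x ∈ BG (n + 1) ↔ ∃ y, dG n y = x)
    (hBC₀ : BC 0 = ⊥) (hBC : ∀ n x, x ∈ BC (n + 1) ↔ ∃ y, dC n y = x)
    (hBN₀ : BN 0 = ⊥) (hBN : ∀ n x, x ∈ BN (n + 1) ↔ ∃ y, dN n y = x)
    (i : ∀ n, G n →ₗ[ℝ] C n) (pr : ∀ n, C (n + 1) →ₗ[ℝ] N n)
    (hi : ∀ n, Function.Injective (i n)) (hid : ∀ n x, i (n + 1) (dG n x) = dC n (i n x))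
    (hprd : ∀ n x, pr (n + 1) (dC (n + 1) x) = dN n (pr n x)) (hprd₀ : ∀ x, pr 0 (dC 0 x) = 0)
    (hpri : ∀ n x, pr n (i (n + 1) x) = 0)
    (hpr : ∀ n, Function.Surjective (pr n))
    (hker : ∀ n (D : C (n + 1)) (η : G (n + 2)), pr n D = 0 → dC (n + 1) D = i (n + 2) η →
      ∃ (D₀ : C n) (θ : G (n + 1)), D - dC n D₀ = i (n + 1) θ)
    (hker' : ∀ n (D : C (n + 2)), pr (n + 1) D = 0 → dC (n + 2) D = 0 →
      ∃ (D₀ : C (n + 1)) (θ : G (n + 2)), pr n D₀ = 0 ∧ D - dC (n + 1) D₀ = i (n + 2) θ)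
    (hker₀ : ∀ (D : C 0) (η : G 1), dC 0 D = i 1 η → ∃ θ, i 0 θ = D) :
    ∃ (j : ∀ n, (ZG n ⧸ (BG n).submoduleOf (ZG n)) →ₗ[ℝ] (ZC n ⧸ (BC n).submoduleOf (ZC n)))
      (p : ∀ n, (ZC (n + 1) ⧸ (BC (n + 1)).submoduleOf (ZC (n + 1))) →ₗ[ℝ]
        (ZN n ⧸ (BN n).submoduleOf (ZN n)))
      (δ : ∀ n, (ZN n ⧸ (BN n).submoduleOf (ZN n)) →ₗ[ℝ]
        (ZG (n + 2) ⧸ (BG (n + 2)).submoduleOf (ZG (n + 2)))),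
      (∀ n (η : ZG n), ∃ h : i n η ∈ ZC n,
        j n (Submodule.mkQ _ η) = Submodule.mkQ _ ⟨i n η, h⟩) ∧
      (∀ n (D : ZC (n + 1)), ∃ h : pr n D ∈ ZN n,
        p n (Submodule.mkQ _ D) = Submodule.mkQ _ ⟨pr n D, h⟩) ∧
      (∀ n (c : ZN n), ∃ (D : C (n + 1)) (η : ZG (n + 2)),
        pr n D = c ∧ dC (n + 1) D = i (n + 2) η) ∧
      (∀ n (c : ZN n) (D : C (n + 1)) (η : ZG (n + 2)), pr n D = c →
        dC (n + 1) D = i (n + 2) η → δ n (Submodule.mkQ _ c) = Submodule.mkQ _ η) ∧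
      Function.Bijective (j 0) ∧ Function.Injective (j 1) ∧
      (∀ n, Function.Exact (j (n + 1)) (p n)) ∧
      (∀ n, Function.Exact (p n) (δ n)) ∧
      (∀ n, Function.Exact (δ n) (j (n + 2))) ∧
      ((∀ n, Subsingleton (N n)) → ∀ n, Function.Bijective (j n)) := by
  have hiZ : ∀ n (η : ZG n), i n η ∈ ZC n := fun n η => by
    rw [hZC, ← hid, (hZG n _).1 η.2, map_zero]
  have hprZ : ∀ n (D : ZC (n + 1)), pr n D ∈ ZN n := fun n D => by
    rw [hZN, ← hprd, (hZC _ _).1 D.2, map_zero]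
  have hiZ' : ∀ n (D : C n) (η : G (n + 1)), dC n D = i (n + 1) η → η ∈ ZG (n + 1) := by
    intro n D η h
    rw [hZG]
    apply hi
    rw [hid, ← h, hdC, map_zero]
  have hprZ' : ∀ n (D : C (n + 1)) (η : G (n + 2)), dC (n + 1) D = i (n + 2) η → pr n D ∈ ZN n := by
    intro n D η h
    rw [hZN, ← hprd, h, hpri]
  -- lifting a coboundary
  have hlift : ∀ n (D : C (n + 1)), pr n D ∈ BN n → ∃ B : C n, pr n (D - dC n B) = 0 := by
    intro n D h
    obtain _ | n := n
    · rw [hBN₀, Submodule.mem_bot] at h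
      exact ⟨0, by simpa using h⟩
    · obtain ⟨b, hb⟩ := (hBN n _).1 h
      obtain ⟨B, rfl⟩ := hpr n b
      exact ⟨B, by rw [map_sub, hprd, hb, sub_self]⟩
  -- Used twice: with general `η` it makes the connecting map well defined, with `η = 0` it gives
  -- exactness at `C`.
  have hconn : ∀ n (D : C (n + 1)) (η : G (n + 2)), pr n D ∈ BN n →
      dC (n + 1) D = i (n + 2) η → ∃ (B : C n) (θ : G (n + 1)), D - dC n B = i (n + 1) θ := by
    intro n D η h hη
    obtain ⟨B, hB⟩ := hlift n D h
    obtain ⟨D₀, θ, hθ⟩ := hker n (D - dC n B) η hB (by rw [map_sub, hdC, sub_zero, hη])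
    exact ⟨B + D₀, θ, by rw [map_add, ← sub_sub, hθ]⟩
  have hdiff : ∀ n (D : C (n + 1)) (η : G (n + 2)) (B : C n) (θ : G (n + 1)),
      dC (n + 1) D = i (n + 2) η → D - dC n B = i (n + 1) θ → dG (n + 1) θ = η := by
    intro n D η B θ hη hθ
    apply hi
    rw [hid, ← hθ, map_sub, hdC, sub_zero, hη]
  have hex : ∀ n (c : ZN n), ∃ (D : C (n + 1)) (η : ZG (n + 2)),
      pr n D = c ∧ dC (n + 1) D = i (n + 2) η := by
    intro n c
    obtain ⟨D, hD⟩ := hpr n c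
    -- For an arbitrary lift `D` of `c`, `δD` is closed and lies in the kernel of `pr`, hence equals
    -- `δD₀` up to an element of `G`; then `D - D₀` is a lift of the required kind.
    obtain ⟨D₀, θ, hD₀, hθ⟩ := hker' n (dC (n + 1) D)
      (by rw [hprd, hD]; exact (hZN n _).1 c.2) (hdC _ _)
    rw [← map_sub] at hθ
    exact ⟨D - D₀, ⟨θ, hiZ' _ _ _ hθ⟩, by rw [map_sub, hD₀, sub_zero, hD], hθ⟩
  have hj : ∀ n, ∃ j : (ZG n ⧸ (BG n).submoduleOf (ZG n)) →ₗ[ℝ]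
      (ZC n ⧸ (BC n).submoduleOf (ZC n)),
      ∀ η : ZG n, j (Submodule.mkQ _ η) = Submodule.mkQ _ ⟨i n η, hiZ n η⟩ := by
    intro n
    let φ : ZG n →ₗ[ℝ] ZC n := ((i n).comp (ZG n).subtype).codRestrict (ZC n) (hiZ n)
    obtain ⟨L, hL⟩ := exists_quotient_map_of_relation ((BG n).submoduleOf (ZG n))
      ((BC n).submoduleOf (ZC n)) φ.graph (fun x => ⟨φ x, (φ.mem_graph_iff _).2 rfl⟩) (by
        intro x y h hx
        obtain rfl : y = φ x := (φ.mem_graph_iff _).1 h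
        change (x : G n) ∈ BG n at hx
        change i n x ∈ BC n
        obtain _ | n := n
        · rw [hBG₀, Submodule.mem_bot] at hx
          rw [hx, map_zero]
          exact Submodule.zero_mem _
        · obtain ⟨y, hy⟩ := (hBG n _).1 hx
          exact (hBC n _).2 ⟨i n y, by rw [← hid, hy]⟩)
    exact ⟨L, fun η => hL _ _ ((φ.mem_graph_iff _).2 rfl)⟩
  have hp : ∀ n, ∃ p : (ZC (n + 1) ⧸ (BC (n + 1)).submoduleOf (ZC (n + 1))) →ₗ[ℝ]
        (ZN n ⧸ (BN n).submoduleOf (ZN n)),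
      ∀ D : ZC (n + 1), p (Submodule.mkQ _ D) = Submodule.mkQ _ ⟨pr n D, hprZ n D⟩ := by
    intro n
    let φ : ZC (n + 1) →ₗ[ℝ] ZN n := ((pr n).comp (ZC (n + 1)).subtype).codRestrict (ZN n) (hprZ n)
    obtain ⟨L, hL⟩ := exists_quotient_map_of_relation ((BC (n + 1)).submoduleOf (ZC (n + 1)))
      ((BN n).submoduleOf (ZN n)) φ.graph (fun x => ⟨φ x, (φ.mem_graph_iff _).2 rfl⟩) (by
        intro x y h hx
        obtain rfl : y = φ x := (φ.mem_graph_iff _).1 h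
        change (x : C (n + 1)) ∈ BC (n + 1) at hx
        change pr n x ∈ BN n
        obtain ⟨y, hy⟩ := (hBC n _).1 hx
        rw [← hy]
        obtain _ | n := n
        · rw [hprd₀]
          exact Submodule.zero_mem _
        · exact (hBN n _).2 ⟨pr n y, by rw [← hprd]⟩)
    exact ⟨L, fun η => hL _ _ ((φ.mem_graph_iff _).2 rfl)⟩
  have hδ : ∀ n, ∃ δ : (ZN n ⧸ (BN n).submoduleOf (ZN n)) →ₗ[ℝ]
        (ZG (n + 2) ⧸ (BG (n + 2)).submoduleOf (ZG (n + 2))),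
      ∀ (c : ZN n) (D : C (n + 1)) (η : ZG (n + 2)), pr n D = c →
        dC (n + 1) D = i (n + 2) η → δ (Submodule.mkQ _ c) = Submodule.mkQ _ η := by
    intro n
    let Γ : Submodule ℝ (ZN n × ZG (n + 2)) :=
      { carrier := {x | ∃ D : C (n + 1), pr n D = x.1 ∧ dC (n + 1) D = i (n + 2) x.2}
        add_mem' := by
          rintro x y ⟨D, h1, h2⟩ ⟨D', h1', h2'⟩
          exact ⟨D + D', by rw [map_add, h1, h1']; rfl, by rw [map_add, h2, h2', ← map_add]; rfl⟩
        zero_mem' := ⟨0, by simp, by simp⟩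
        smul_mem' := by
          rintro c x ⟨D, h1, h2⟩
          exact ⟨c • D, by rw [map_smul, h1]; rfl, by rw [map_smul, h2, ← map_smul]; rfl⟩ }
    obtain ⟨L, hL⟩ := exists_quotient_map_of_relation ((BN n).submoduleOf (ZN n))
      ((BG (n + 2)).submoduleOf (ZG (n + 2))) Γ
      (fun c => by
        obtain ⟨D, η, h1, h2⟩ := hex n c
        exact ⟨η, D, h1, h2⟩)
      (by
        rintro c η ⟨D, h1, h2⟩ hc
        change (c : N n) ∈ BN n at hc
        change (η : G (n + 2)) ∈ BG (n + 2)
        obtain ⟨B, θ, hθ⟩ := hconn n D η (by rw [h1]; exact hc) h2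
        exact (hBG _ _).2 ⟨θ, hdiff n D η B θ h2 hθ⟩)
    exact ⟨L, fun c D η h1 h2 => hL _ _ ⟨D, h1, h2⟩⟩
  choose j hj using hj
  choose p hp using hp
  choose δ hδ using hδ
  have hj₀ : Function.Bijective (j 0) := by
    constructor
    · refine (injective_iff_map_eq_zero _).2 fun x hx => ?_
      obtain ⟨η, rfl⟩ := Submodule.mkQ_surjective _ x
      rw [hj, mkQ_submoduleOf_eq_zero_iff, hBC₀, Submodule.mem_bot] at hx
      rw [mkQ_submoduleOf_eq_zero_iff, hBG₀, Submodule.mem_bot]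
      exact hi 0 (hx.trans (map_zero _).symm)
    · intro y
      obtain ⟨D, rfl⟩ := Submodule.mkQ_surjective _ y
      have hD := (hZC _ _).1 D.2
      obtain ⟨θ, hθ⟩ := hker₀ D 0 (by rw [hD, map_zero])
      refine ⟨Submodule.mkQ _ ⟨θ, (hZG _ _).2 (hi _ ?_)⟩, ?_⟩
      · rw [hid, hθ, hD, map_zero]
      · rw [hj]
        exact congrArg _ (Subtype.ext hθ)
  have hj₁ : Function.Injective (j 1) := by
    refine (injective_iff_map_eq_zero _).2 fun x hx => ?_
    obtain ⟨η, rfl⟩ := Submodule.mkQ_surjective _ x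
    rw [hj, mkQ_submoduleOf_eq_zero_iff, hBC] at hx
    obtain ⟨D, hD⟩ := hx
    obtain ⟨θ, rfl⟩ := hker₀ D η hD
    rw [mkQ_submoduleOf_eq_zero_iff, hBG]
    exact ⟨θ, hi _ (by rw [hid, hD])⟩
  have hjp : ∀ n, Function.Exact (j (n + 1)) (p n) := by
    intro n y
    obtain ⟨D, rfl⟩ := Submodule.mkQ_surjective _ y
    rw [hp, mkQ_submoduleOf_eq_zero_iff]
    have hD := (hZC _ _).1 D.2
    constructor
    · intro h
      obtain ⟨B, θ, hθ⟩ := hconn n D 0 h (by rw [hD, map_zero])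
      have hθ' := hdiff n D 0 B θ (by rw [hD, map_zero]) hθ
      refine ⟨Submodule.mkQ _ ⟨θ, (hZG _ _).2 hθ'⟩, ?_⟩
      rw [hj, ← sub_eq_zero, ← map_sub, mkQ_submoduleOf_eq_zero_iff, hBC]
      refine ⟨-B, ?_⟩
      change dC n (-B) = i (n + 1) θ - D
      rw [← hθ, map_neg]
      abel
    · rintro ⟨x, hx⟩
      obtain ⟨η, rfl⟩ := Submodule.mkQ_surjective _ x
      rw [← mkQ_submoduleOf_eq_zero_iff (ZN n) (BN n) ⟨pr n D, hprZ n D⟩, ← hp, ← hx, hj, hp,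
        mkQ_submoduleOf_eq_zero_iff]
      change pr n (i (n + 1) η) ∈ BN n
      rw [hpri]
      exact Submodule.zero_mem _
  have hpδ : ∀ n, Function.Exact (p n) (δ n) := by
    intro n y
    obtain ⟨c, rfl⟩ := Submodule.mkQ_surjective _ y
    obtain ⟨D, η, hD, hη⟩ := hex n c
    constructor
    · intro h
      rw [hδ n c D η hD hη, mkQ_submoduleOf_eq_zero_iff, hBG] at h
      obtain ⟨θ, hθ⟩ := h
      refine ⟨Submodule.mkQ _ ⟨D - i (n + 1) θ, (hZC _ _).2 ?_⟩, ?_⟩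
      · rw [map_sub, ← hid, hθ, hη, sub_self]
      · rw [hp]
        refine congrArg _ (Subtype.ext ?_)
        change pr n (D - i (n + 1) θ) = c
        rw [map_sub, hpri, sub_zero, hD]
    · rintro ⟨x, hx⟩
      obtain ⟨D', rfl⟩ := Submodule.mkQ_surjective _ x
      rw [← hx, hp, hδ n _ D' 0 rfl, map_zero]
      rw [(hZC _ _).1 D'.2]
      exact (map_zero _).symm
  have hδj : ∀ n, Function.Exact (δ n) (j (n + 2)) := by
    intro n y
    obtain ⟨η, rfl⟩ := Submodule.mkQ_surjective _ y
    rw [hj, mkQ_submoduleOf_eq_zero_iff, hBC]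
    constructor
    · rintro ⟨D, hD⟩
      exact ⟨Submodule.mkQ _ ⟨pr n D, hprZ' n D η hD⟩, hδ n _ D η rfl hD⟩
    · rintro ⟨x, hx⟩
      obtain ⟨c, rfl⟩ := Submodule.mkQ_surjective _ x
      obtain ⟨D, η', hD, hη'⟩ := hex n c
      rw [hδ n c D η' hD hη', ← sub_eq_zero, ← map_sub, mkQ_submoduleOf_eq_zero_iff, hBG] at hx
      obtain ⟨θ, hθ⟩ := hx
      refine ⟨D - i (n + 1) θ, ?_⟩
      rw [map_sub, ← hid, hθ, hη', ← map_sub]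
      exact congrArg _ (sub_sub_cancel (η' : G (n + 2)) η)
  refine ⟨j, p, δ, fun n η => ⟨hiZ n η, hj n η⟩, fun n D => ⟨hprZ n D, hp n D⟩, hex, hδ, hj₀, hj₁,
    hjp, hpδ, hδj, fun hN => ?_⟩
  have hquot : ∀ n (x : ZN n ⧸ (BN n).submoduleOf (ZN n)), x = 0 := by
    intro n x
    obtain ⟨c, rfl⟩ := Submodule.mkQ_surjective _ x
    rw [Subsingleton.elim c 0, map_zero]
  have hsurj : ∀ n, Function.Surjective (j (n + 1)) := fun n y => (hjp n y).1 (hquot n _)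
  intro n
  match n with
  | 0 => exact hj₀
  | 1 => exact ⟨hj₁, hsurj 0⟩
  | n + 2 =>
    refine ⟨(injective_iff_map_eq_zero _).2 fun x hx => ?_, hsurj (n + 1)⟩
    obtain ⟨y, rfl⟩ := (hδj n x).1 hx
    rw [hquot n y, map_zero]

end LongExactSequence

namespace LieAlgebroid

/-! ### The isotropy and Bott representations. -/

section Representations

variable {E : Type*} [NormedAddCommGroup E] [NormedSpace ℝ E]
  {F : Type*} [NormedAddCommGroup F] [NormedSpace ℝ F]
  {M : Type*} [TopologicalSpace M] [ChartedSpace E M] [IsManifold 𝓘(ℝ, E) ∞ M]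
  {V : M → Type*} [TopologicalSpace (TotalSpace F V)] [∀ x, TopologicalSpace (V x)]
  [FiberBundle F V] [∀ x, AddCommGroup (V x)] [∀ x, Module ℝ (V x)] [VectorBundle ℝ F V]
  (A : LieAlgebroid E F V)

theorem rho_isotropySec (β : A.isotropySec) : A.rho β = 0 := by
  ext x; exact β.2 x

variable [FiniteDimensional ℝ E] [T2Space M] [SigmaCompactSpace M]
  [ContMDiffVectorBundle ∞ F V 𝓘(ℝ, E)]

/-- The isotropy representation as a bilinear map. -/
def isotropyRep : Sec E F V →ₗ[ℝ] A.isotropySec →ₗ[ℝ] A.isotropySec :=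
  LinearMap.mk₂ ℝ (fun α β => A.isotropyConn α β)
    (fun α α' β => Subtype.ext (LinearMap.congr_fun (map_add A.bracket α α') (β : Sec E F V)))
    (fun c α β => Subtype.ext (LinearMap.congr_fun (map_smul A.bracket c α) (β : Sec E F V)))
    (fun _ β β' => map_add _ β β')
    (fun c _ β => map_smul _ c β)

theorem isRepresentation_isotropyRep : A.IsRepresentation A.isotropyRep where
  smul_left f α β := by
    refine Subtype.ext ?_
    change A.bracket (f • α) β = f • A.bracket α β
    rw [bracket_swap, bracket_smul, rho_isotropySec, lieDeriv_zero_left, zero_smul, add_zero,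
      bracket_swap, smul_neg, neg_neg]
  leibniz α f β := Subtype.ext (A.bracket_smul f α β)
  flat α β γ := Subtype.ext (A.jacobi α β γ)

variable {A} (hA : A.IsRegular)

/-- The Bott representation as a bilinear map. -/
def IsRegular.bottRep : Sec E F V →ₗ[ℝ] A.normalSec →ₗ[ℝ] A.normalSec :=
  have hadd : ∀ α α' s, A.bott hA (α + α') s = A.bott hA α s + A.bott hA α' s := by
    intro α α' s
    refine normalSec_ext fun x => ?_
    obtain ⟨X, hX⟩ := s.2 x
    change _ = (A.bott hA α s).1 x + (A.bott hA α' s).1 x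
    rw [A.bott_apply hA _ s X x hX, A.bott_apply hA _ s X x hX, A.bott_apply hA _ s X x hX,
      map_add A.rho, map_add (vecBracket (E := E) (M := M)), LinearMap.add_apply]
    exact map_add (LinearMap.range (A.anchor x)).mkQ _ _
  have hsmul : ∀ (c : ℝ) α s, A.bott hA (c • α) s = c • A.bott hA α s := by
    intro c α s
    refine normalSec_ext fun x => ?_
    obtain ⟨X, hX⟩ := s.2 x
    change _ = c • (A.bott hA α s).1 x
    rw [A.bott_apply hA _ s X x hX, A.bott_apply hA _ s X x hX,
      LinearMap.map_smul_of_tower A.rho, map_smul (vecBracket (E := E) (M := M)),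
      LinearMap.smul_apply]
    exact map_smul (LinearMap.range (A.anchor x)).mkQ c _
  LinearMap.mk₂ ℝ (fun α s => A.bott hA α s) hadd hsmul (fun _ s t => map_add _ s t)
    (fun c _ s => map_smul _ c s)

theorem IsRegular.bottRep_apply (α : Sec E F V) : hA.bottRep α = A.bott hA α := rfl

/-- All identities hold for `[ρ(α), ·]` on local representatives, except homogeneity in `α`, whose
defect is a multiple of `ρ(α)` and so vanishes in `ν`. -/
theorem IsRegular.isRepresentation_bottRep : A.IsRepresentation hA.bottRep where
  smul_left f α s := by
    refine normalSec_ext fun x => ?_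
    obtain ⟨X, hX⟩ := s.2 x
    rw [normalSec_smul_apply, bottRep_apply, bottRep_apply, A.bott_apply hA _ s X x hX,
      A.bott_apply hA _ s X x hX, ← map_smul]
    refine (Submodule.Quotient.eq _).2 ⟨-(lieDeriv X f x • α x), ?_⟩
    have h := congrArg (fun Y : VecField E M => Y x) (A.vecConn_smul_left α f X)
    change vecBracket (A.rho (f • α)) X x
      = f x • vecBracket (A.rho α) X x - lieDeriv X f x • A.anchor x (α x) at h
    rw [h, map_neg, map_smul]
    abel
  leibniz α f s := by
    refine normalSec_ext fun x => ?_
    obtain ⟨X, hX⟩ := s.2 x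
    have hfX : ∀ᶠ y in 𝓝 x, (f • s).1 y = (LinearMap.range (A.anchor y)).mkQ ((f • X) y) := by
      filter_upwards [hX] with y hy
      rw [normalSec_smul_apply, hy]
      rfl
    change _ = f x • (A.bott hA α s).1 x + lieDeriv (A.rho α) f x • s.1 x
    rw [bottRep_apply, A.bott_apply hA α _ _ x hfX, A.bott_apply hA _ s X x hX,
      hX.self_of_nhds, vecBracket_smul]
    rfl
  flat α β s := by
    refine normalSec_ext fun x => ?_
    obtain ⟨X, hX⟩ := s.2 x
    -- Applying the Bott connection twice requires a representative of `∇_γ s` on a neighbourhood,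
    -- not just at `x`.
    have h : ∀ γ, ∀ᶠ y in 𝓝 x, (A.bott hA γ s).1 y
        = (LinearMap.range (A.anchor y)).mkQ (vecBracket (A.rho γ) X y) := by
      intro γ
      filter_upwards [hX.eventually_nhds] with y hy
      exact A.bott_apply hA γ s X y hy
    change (A.bott hA α (A.bott hA β s)).1 x
      = (A.bott hA (A.bracket α β) s).1 x + (A.bott hA β (A.bott hA α s)).1 x
    rw [A.bott_apply hA α _ _ x (h β), A.bott_apply hA β _ _ x (h α),
      A.bott_apply hA _ s X x hX, rho_bracket, vecBracket_jacobi]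
    rfl

end Representations

/-! ### Deformation cochains with prescribed symbol. -/

section DeformationCochains

variable {E : Type*} [NormedAddCommGroup E] [NormedSpace ℝ E]
  {F : Type*} [NormedAddCommGroup F] [NormedSpace ℝ F]
  {M : Type*} [TopologicalSpace M] [ChartedSpace E M] [IsManifold 𝓘(ℝ, E) ∞ M]
  {V : M → Type*} [TopologicalSpace (TotalSpace F V)] [∀ x, TopologicalSpace (V x)]
  [FiberBundle F V] [∀ x, AddCommGroup (V x)] [∀ x, Module ℝ (V x)] [VectorBundle ℝ F V]

theorem exists_defCochain_of_cochain {n : ℕ} (T : Cochain E F V (Sec E F V) n) :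
    ∃ D : DefCochain E F V n, defPair n D = (restrictAlternating T, 0) := by
  obtain _ | n := n
  · exact ⟨⟨(restrictAlternating T, 0), Submodule.mem_top⟩, rfl⟩
  · refine ⟨⟨(restrictAlternating T, 0), ?_⟩, rfl⟩
    intro s f t
    have h := T.map_update_smul (Fin.snoc s t) (Fin.last n) f t
    rw [Fin.update_snoc_last, Fin.update_snoc_last] at h
    change T (Fin.snoc s (f • t)) = f • T (Fin.snoc s t) + lieDeriv (0 : VecField E M) f • t
    rw [h, lieDeriv_zero_left, zero_smul, add_zero]

variable (A : LieAlgebroid E F V)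

theorem exists_inclCochain_eq {n : ℕ} (D : DefCochain E F V n) (h₀ : (defPair n D).2 = 0)
    (hρ : ∀ s, A.rho ((defPair n D).1 s) = 0) : ∃ η, A.inclCochain n η = D := by
  have hD : IsTensorial (SmoothFun E M) (defPair n D).1 := by
    obtain _ | n := n
    · exact isTensorial_zero_args _
    · refine (isTensorial_iff_slot (Fin.last n)).2 fun s f => ?_
      have h : (defPair (n + 1) D).1 (Fin.snoc (Fin.init s) (f • s (Fin.last n)))
          = f • (defPair (n + 1) D).1 (Fin.snoc (Fin.init s) (s (Fin.last n)))
            + lieDeriv (symbol n D (Fin.init s)) f • s (Fin.last n) :=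
        D.2 (Fin.init s) f (s (Fin.last n))
      have h1 : symbol n D (Fin.init s) = 0 :=
        congrArg (fun σ : Cochain E F V (VecField E M) n => σ (Fin.init s)) h₀
      have h2 : Function.update s (Fin.last n) (f • s (Fin.last n))
          = Fin.snoc (Fin.init s) (f • s (Fin.last n)) := by
        conv_lhs => rw [← Fin.snoc_init_self s]
        rw [Fin.update_snoc_last, Fin.snoc_last]
      rw [h2, h, h1, lieDeriv_zero_left, zero_smul, add_zero, Fin.snoc_init_self]
  refine ⟨hD.toAlternating.codRestrict A.isotropySec fun s x => ?_, ?_⟩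
  · exact congrArg (fun X : VecField E M => X x) (hρ s)
  · refine Subtype.ext (Prod.ext ?_ h₀.symm)
    rfl

variable [FiniteDimensional ℝ E] [FiniteDimensional ℝ F] [T2Space M] [SigmaCompactSpace M]
  [ContMDiffVectorBundle ∞ F V 𝓘(ℝ, E)]

omit [FiniteDimensional ℝ E] [FiniteDimensional ℝ F] [T2Space M] [SigmaCompactSpace M]
  [ContMDiffVectorBundle ∞ F V 𝓘(ℝ, E)] in
theorem removeNth_castSucc_snoc {X : Type*} {n : ℕ} (i : Fin (n + 1)) (s : Fin (n + 1) → X)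
    (t : X) : i.castSucc.removeNth (Fin.snoc s t : Fin (n + 2) → X)
      = Fin.snoc (i.removeNth s) t := by
  funext k
  refine Fin.lastCases ?_ (fun k => ?_) k
  · simp [Fin.removeNth]
  · simp [Fin.removeNth]

/-- The multiderivation is `(-1)^n ∑ (-1)^i ∇_{σ(…, ŝ_i, …)} s_i`. In the last slot the terms `i <
n` are `C^∞(M)`-linear, because `σ` and `X ↦ ∇_X` are; the term `i = n` contributes the symbol, with
total sign `+1`. -/
theorem exists_symbol_eq {n : ℕ} (σ : Cochain E F V (VecField E M) n) :
    ∃ D : DefCochain E F V (n + 1), symbol n D = σ := by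
  obtain ⟨nabla, hsmul, hleib⟩ := exists_connection (E := E) (F := F) (V := V)
  let f : Sec E F V →ₗ[ℝ] Sec E F V [⋀^Fin n]→ₗ[ℝ] Sec E F V :=
    { toFun := fun t => (nabla.flip t).compAlternatingMap (restrictAlternating σ)
      map_add' := fun t t' => by
        ext1 s; exact map_add (nabla (σ s)) t t'
      map_smul' := fun c t => by
        ext1 s; exact map_smul (nabla (σ s)) c t }
  let D : Sec E F V [⋀^Fin (n + 1)]→ₗ[ℝ] Sec E F V :=
    (-1 : ℝ) ^ n • AlternatingMap.alternatizeUncurryFin f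
  have hD : IsMultiDer D (restrictAlternating σ) := by
    intro s g t
    have hval : ∀ v : Fin (n + 1) → Sec E F V, D v = (-1 : ℝ) ^ n • ∑ i : Fin (n + 1),
        (-1 : ℤ) ^ (i : ℕ) • nabla (σ (i.removeNth v)) (v i) := by
      intro v
      rw [AlternatingMap.smul_apply, AlternatingMap.alternatizeUncurryFin_apply]
      rfl
    have hσ : ∀ i : Fin n, σ (i.castSucc.removeNth (Fin.snoc s (g • t) : Fin (n + 1) → Sec E F V))
        = g • σ (i.castSucc.removeNth (Fin.snoc s t : Fin (n + 1) → Sec E F V)) := by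
      intro i
      obtain _ | n := n
      · exact i.elim0
      · rw [removeNth_castSucc_snoc, removeNth_castSucc_snoc]
        have h := σ.map_update_smul (Fin.snoc (i.removeNth s) t) (Fin.last n) g t
        rwa [Fin.update_snoc_last, Fin.update_snoc_last] at h
    rw [hval, hval, Fin.sum_univ_castSucc, Fin.sum_univ_castSucc]
    simp only [Fin.snoc_last, Fin.snoc_castSucc, hσ, hsmul, hleib, smul_add, Fin.removeNth_last,
      Fin.init_snoc, Fin.val_last, Fin.val_castSucc]
    have hsign : ∀ w : Sec E F V, (-1 : ℝ) ^ n • (-1 : ℤ) ^ n • w = w := by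
      intro w
      rcases Nat.even_or_odd n with hn | hn <;> simp [hn.neg_one_pow]
    rw [hsign, hsign, hsign, coe_restrictAlternating, smul_comm g, Finset.smul_sum (r := g),
      add_assoc]
    simp only [smul_comm g]
  exact ⟨⟨(D, σ), hD⟩, rfl⟩

end DeformationCochains

end LieAlgebroid

theorem exists_linear_lift {X Y Z : Type*} [AddCommGroup X] [Module ℝ X] [AddCommGroup Y]
    [Module ℝ Y] [AddCommGroup Z] [Module ℝ Z] (f : X →ₗ[ℝ] Z) (g : Y →ₗ[ℝ] Z)
    (hg : Function.Injective g) (h : ∀ x, ∃ y, g y = f x) :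
    ∃ L : X →ₗ[ℝ] Y, ∀ x, g (L x) = f x := by
  choose L hL using h
  exact ⟨{ toFun := L
           map_add' := fun x x' => hg (by rw [hL, map_add, map_add, hL, hL])
           map_smul' := fun c x => hg (by rw [hL, map_smul, RingHom.id_apply, map_smul, hL]) }, hL⟩

namespace LieAlgebroid

/-! ### Inclusion and normal symbol as chain maps, and the comparison with the kernel. -/

section ChainMaps

variable {E : Type*} [NormedAddCommGroup E] [NormedSpace ℝ E]
  {F : Type*} [NormedAddCommGroup F] [NormedSpace ℝ F]
  {M : Type*} [TopologicalSpace M] [ChartedSpace E M] [IsManifold 𝓘(ℝ, E) ∞ M]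
  {V : M → Type*} [TopologicalSpace (TotalSpace F V)] [∀ x, TopologicalSpace (V x)]
  [FiberBundle F V] [∀ x, AddCommGroup (V x)] [∀ x, Module ℝ (V x)] [VectorBundle ℝ F V]
  (A : LieAlgebroid E F V)

omit [IsManifold 𝓘(ℝ, E) ∞ M] in
theorem cochainFun_injective {W : Type*} [AddCommGroup W] [Module (SmoothFun E M) W] [Module ℝ W]
    [SMulCommClass (SmoothFun E M) ℝ W] (n : ℕ) :
    Function.Injective (cochainFun (E := E) (F := F) (V := V) (W := W) n) :=
  DFunLike.coe_injective

theorem defFun_symbolFun_injective (n : ℕ) :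
    Function.Injective ((defFun (E := E) (F := F) (V := V) (n + 1)).prod (symbolFun n)) := by
  intro D D' h
  refine Subtype.ext (Prod.ext ?_ ?_)
  · exact DFunLike.coe_injective (congrArg Prod.fst h)
  · exact cochainFun_injective n (congrArg Prod.snd h)

theorem inclCochain_injective (n : ℕ) : Function.Injective (A.inclCochain n) := by
  intro η θ h
  ext1 s
  exact Subtype.ext (congrArg (fun D => (defPair n D).1 s) h)

theorem defPair_inclCochain (n : ℕ) (η : Cochain E F V A.isotropySec n) :
    defPair n (A.inclCochain n η) = (A.inclMap n η, 0) := rfl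

theorem normalSymbol_eq_zero_iff {n : ℕ} (D : DefCochain E F V (n + 1)) :
    A.normalSymbol n D = 0 ↔
      ∀ s x, symbolFun n D s x ∈ LinearMap.range (A.anchor x) := by
  constructor
  · intro h s x
    have h1 := congrArg (fun c : Cochain E F V A.normalSec n => (c s).1 x) h
    exact (Submodule.Quotient.mk_eq_zero _).1 h1
  · intro h
    ext1 s
    exact normalSec_ext fun x => (Submodule.Quotient.mk_eq_zero _).2 (h s x)

theorem toNormal_rho (α : Sec E F V) : A.toNormal (A.rho α) = 0 :=
  normalSec_ext fun x => (Submodule.Quotient.mk_eq_zero _).2 ⟨α x, rfl⟩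

theorem symbolFun_inclCochain (n : ℕ) (η : Cochain E F V A.isotropySec (n + 1)) :
    symbolFun n (A.inclCochain (n + 1) η) = 0 := rfl

theorem normalSymbol_inclCochain (n : ℕ) (η : Cochain E F V A.isotropySec (n + 1)) :
    A.normalSymbol n (A.inclCochain (n + 1) η) = 0 := by
  rw [normalSymbol_eq_zero_iff]
  intro s x
  rw [symbolFun_inclCochain]
  exact Submodule.zero_mem _

variable [FiniteDimensional ℝ E]

theorem defDiffSymbol_succ {n : ℕ} (D : DefCochain E F V (n + 1)) :
    A.defDiffSymbol (n + 1) D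
      = ceDiff (fun α β => A.bracket α β) (fun α => A.vecConn α) n (symbolFun n D)
        + (-1 : ℝ) ^ n • A.rhoComp (n + 1) (defFun (n + 1) D) := rfl

theorem defDiffSymbol_of_symbol_eq_zero {n : ℕ} {D : DefCochain E F V n}
    (h : (defPair n D).2 = 0) :
    A.defDiffSymbol n D = (-1 : ℝ) ^ (n + 1) • A.rhoComp n (defFun n D) := by
  obtain _ | n := n
  · rw [zero_add, pow_one, neg_one_smul]
    rfl
  · have h0 : symbolFun n D = 0 := congrArg (cochainFun n) h
    rw [defDiffSymbol_succ, h0, map_zero, zero_add, pow_succ (-1 : ℝ) (n + 1),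
      pow_succ (-1 : ℝ) n, mul_assoc, neg_one_mul, neg_neg, mul_one]

variable {A} in
theorem IsDefDiff.normalSymbol_zero {D : DefCochain E F V 0} {D' : DefCochain E F V 1}
    (h : A.IsDefDiff D D') : A.normalSymbol 0 D' = 0 := by
  rw [normalSymbol_eq_zero_iff]
  intro s x
  have h1 : symbolFun 0 D' = A.defDiffSymbol 0 D := (congrArg Prod.snd h).symm
  rw [h1]
  exact Submodule.neg_mem _ ⟨defFun 0 D s x, rfl⟩

variable {A} in
-- When `σ_D = 0` the symbol of `δD` is `± ρ ∘ D`, so its vanishing forces values in `g(A)`, while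
-- `σ_D = 0` makes `D` tensorial.
theorem IsDefDiff.exists_inclCochain_eq {n : ℕ} {D : DefCochain E F V n}
    {D' : DefCochain E F V (n + 1)} (h : A.IsDefDiff D D') (h₀ : (defPair n D).2 = 0)
    (h' : symbolFun n D' = 0) : ∃ η, A.inclCochain n η = D := by
  refine A.exists_inclCochain_eq D h₀ fun s => ?_
  have h1 : symbolFun n D' = A.defDiffSymbol n D := (congrArg Prod.snd h).symm
  rw [h', defDiffSymbol_of_symbol_eq_zero A h₀] at h1
  have h2 : (-1 : ℝ) ^ (n + 1) • A.rho ((defPair n D).1 s) = 0 := (congrFun h1 s).symm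
  exact (smul_eq_zero.1 h2).resolve_left (pow_ne_zero _ (by norm_num))

variable [T2Space M] [SigmaCompactSpace M] [ContMDiffVectorBundle ∞ F V 𝓘(ℝ, E)]

theorem isDefDiff_inclCochain {n : ℕ} {η : Cochain E F V A.isotropySec n}
    {θ : Cochain E F V A.isotropySec (n + 1)}
    (h : cochainFun (n + 1) θ = A.repDiff A.isotropyConn n η) :
    A.IsDefDiff (A.inclCochain n η) (A.inclCochain (n + 1) θ) := by
  refine Prod.ext ?_ ?_
  · funext s
    refine (ceDiff_comp (fun α β => A.bracket α β) A.isotropyConn (fun α => A.bracket α)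
      (A.isotropySec.subtype.restrictScalars ℝ) (fun α β => rfl) n η s).trans ?_
    exact congrArg Subtype.val (congrFun h s).symm
  · change A.defDiffSymbol n _ = _
    rw [defDiffSymbol_of_symbol_eq_zero A (congrArg Prod.snd (A.defPair_inclCochain n η)),
      symbolFun_inclCochain]
    have h0 : A.rhoComp n (defFun n (A.inclCochain n η)) = 0 :=
      funext fun s => A.rho_isotropySec (η s)
    rw [h0, smul_zero]

variable {A}

/-- The term `± ρ ∘ D` in the symbol dies in `ν`, and the projection turns `[ρ(α), ·]` into the Bott
connection. -/
theorem IsDefDiff.cochainFun_normalSymbol (hA : A.IsRegular) {n : ℕ}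
    {D : DefCochain E F V (n + 1)} {D' : DefCochain E F V (n + 2)} (h : A.IsDefDiff D D') :
    cochainFun (n + 1) (A.normalSymbol (n + 1) D')
      = A.repDiff (A.bott hA) n (A.normalSymbol n D) := by
  funext s
  have h1 : symbolFun (n + 1) D' = A.defDiffSymbol (n + 1) D := (congrArg Prod.snd h).symm
  change A.toNormal (symbolFun (n + 1) D' s) = _
  rw [h1, defDiffSymbol_succ]
  refine (map_add A.toNormal _ _).trans ?_
  have h2 : A.toNormal (((-1 : ℝ) ^ n • A.rhoComp (n + 1) (defFun (n + 1) D)) s) = 0 := by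
    rw [Pi.smul_apply, LinearMap.map_smul_of_tower]
    refine (congrArg _ (A.toNormal_rho _)).trans (smul_zero _)
  rw [h2, add_zero]
  exact (ceDiff_comp (fun α β => A.bracket α β) (fun α => A.vecConn α) (A.bott hA)
    (A.toNormal.restrictScalars ℝ) (fun α X => (A.bott_toNormal hA α X).symm) n
    (symbolFun n D) s).symm

/-- The core of the quasi-isomorphism: the symbol of `D` is removed by the coboundary of a tensorial
cochain. Only the symbol of `δD` is required to vanish, so the lemma serves both `δD = 0` and `δD`
in `C(A; g(A))`. -/
theorem IsDefDiff.exists_sub_eq_inclCochain (hA : A.IsRegular) {n : ℕ}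
    {D : DefCochain E F V (n + 1)} {D' : DefCochain E F V (n + 2)} (h : A.IsDefDiff D D')
    (h₀ : A.normalSymbol n D = 0) (h' : symbolFun (n + 1) D' = 0) :
    ∃ (D₀ : DefCochain E F V n) (B : DefCochain E F V (n + 1)) (η : _),
      A.IsDefDiff D₀ B ∧ (defPair n D₀).2 = 0 ∧ D - B = A.inclCochain (n + 1) η := by
  obtain ⟨θ, hθ⟩ := hA.exists_anchor_section
  -- The sign is the one in `σ_{δD₀} = (-1)^{n+1} ρ ∘ D₀`, so that `σ_{δD₀} = ρ ∘ θ ∘ σ_D = σ_D`.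
  obtain ⟨D₀, hD₀⟩ := exists_defCochain_of_cochain
    ((-1 : ℝ) ^ (n + 1) • θ.compAlternatingMap (symbol n D))
  obtain ⟨B, hB⟩ := A.exists_isDefDiff D₀
  have hD₀' : (defPair n D₀).2 = 0 := congrArg Prod.snd hD₀
  have hBs : symbolFun n B = symbolFun n D := by
    have h1 : symbolFun n B = A.defDiffSymbol n D₀ := (congrArg Prod.snd hB).symm
    rw [h1, defDiffSymbol_of_symbol_eq_zero A hD₀']
    have h2 : defFun n D₀ = (-1 : ℝ) ^ (n + 1) •
        fun s : Fin n → Sec E F V => (θ (symbolFun n D s) : Sec E F V) :=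
        congrArg (fun p : (Sec E F V [⋀^Fin n]→ₗ[ℝ] Sec E F V) × SymbolSpace E F V n =>
        (p.1 : (Fin n → Sec E F V) → Sec E F V)) hD₀
    rw [h2, map_smul, smul_smul, ← pow_add, Even.neg_one_pow ⟨_, rfl⟩, one_smul]
    funext s
    ext x
    exact hθ _ x ((A.normalSymbol_eq_zero_iff D).1 h₀ s x)
  obtain ⟨B', hB'⟩ := A.exists_isDefDiff B
  have hB'0 : symbolFun (n + 1) B' = 0 := by
    have h1 : A.defDiff (n + 1) B = 0 := hB.defDiff_eq_zero
    exact (congrArg Prod.snd hB').symm.trans (congrArg Prod.snd h1)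
  have hsub : A.IsDefDiff (D - B) (D' - B') := by
    change A.defDiff (n + 1) (D - B) = _
    rw [map_sub, h, hB', map_sub, map_sub]
    rfl
  obtain ⟨η, hη⟩ := hsub.exists_inclCochain_eq
    (by
      refine cochainFun_injective n ?_
      change symbolFun n (D - B) = 0
      rw [map_sub, hBs, sub_self])
    (by rw [map_sub, h', hB'0, sub_self])
  exact ⟨D₀, B, η, hB, hD₀', hη.symm⟩

theorem IsRegular.normalSymbol_surjective [FiniteDimensional ℝ F] (hA : A.IsRegular) (n : ℕ) :
    Function.Surjective (A.normalSymbol n) := by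
  intro c
  obtain ⟨κ, hκ⟩ := hA.exists_normal_section
  obtain ⟨D, hD⟩ := exists_symbol_eq (κ.compAlternatingMap c)
  refine ⟨D, ?_⟩
  ext1 s
  change A.toNormal (symbol n D s) = c s
  rw [hD]
  exact hκ (c s)

end ChainMaps

/-! ### The differentials as linear maps between cochain spaces. -/

section Complexes

variable {E : Type*} [NormedAddCommGroup E] [NormedSpace ℝ E]
  {F : Type*} [NormedAddCommGroup F] [NormedSpace ℝ F]
  {M : Type*} [TopologicalSpace M] [ChartedSpace E M] [IsManifold 𝓘(ℝ, E) ∞ M]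
  {V : M → Type*} [TopologicalSpace (TotalSpace F V)] [∀ x, TopologicalSpace (V x)]
  [FiberBundle F V] [∀ x, AddCommGroup (V x)] [∀ x, Module ℝ (V x)] [VectorBundle ℝ F V]
  {A : LieAlgebroid E F V}

theorem IsTransitive.subsingleton_cochain_normalSec (h : A.IsTransitive) (n : ℕ) :
    Subsingleton (Cochain E F V A.normalSec n) := by
  refine ⟨fun c c' => ?_⟩
  ext1 s
  refine normalSec_ext fun x => ?_
  obtain ⟨X, hX⟩ := Submodule.mkQ_surjective _ ((c s).1 x)
  obtain ⟨Y, hY⟩ := Submodule.mkQ_surjective _ ((c' s).1 x)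
  rw [← hX, ← hY]
  exact (Submodule.Quotient.eq _).2 (h x _)

theorem IsRepresentation.exists_differential {W : Type*} [AddCommGroup W]
    [Module (SmoothFun E M) W] [Module ℝ W] [IsScalarTower ℝ (SmoothFun E M) W]
    {nab : Sec E F V →ₗ[ℝ] W →ₗ[ℝ] W} (h : A.IsRepresentation nab) :
    ∃ d : ∀ n, Cochain E F V W n →ₗ[ℝ] Cochain E F V W (n + 1),
      (∀ n η, cochainFun (n + 1) (d n η) = A.repDiff (fun α => nab α) n η) ∧
      (∀ n η, η ∈ A.repCocycles (fun α => nab α) n ↔ d n η = 0) ∧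
      ∀ n η, η ∈ A.repCoboundaries (fun α => nab α) (n + 1) ↔ ∃ θ, d n θ = η := by
  have h : ∀ n, ∃ d : Cochain E F V W n →ₗ[ℝ] Cochain E F V W (n + 1),
      ∀ η, cochainFun (n + 1) (d η) = A.repDiff (fun α => nab α) n η := fun n =>
    exists_linear_lift _ _ (cochainFun_injective (n + 1)) fun η => h.exists_repDiff_eq η
  choose d hd using h
  refine ⟨d, hd, fun n η => ?_, fun n η => exists_congr fun θ => ?_⟩
  · exact ⟨fun h => cochainFun_injective _ ((hd n η).trans h),
      fun h => (hd n η).symm.trans (by rw [h, map_zero])⟩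
  · exact ⟨fun h => cochainFun_injective _ ((hd n θ).trans h),
      fun h => (hd n θ).symm.trans (by rw [h])⟩

variable [FiniteDimensional ℝ E] [T2Space M] [SigmaCompactSpace M]

variable (A) in
theorem exists_deformation_differential :
    ∃ d : ∀ n, DefCochain E F V n →ₗ[ℝ] DefCochain E F V (n + 1),
      ∀ n D D', A.IsDefDiff D D' ↔ d n D = D' := by
  have h : ∀ n, ∃ d : DefCochain E F V n →ₗ[ℝ] DefCochain E F V (n + 1),
      ∀ D, ((defFun (n + 1)).prod (symbolFun n)) (d D) = A.defDiff n D := fun n =>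
    exists_linear_lift _ _ (defFun_symbolFun_injective n) fun D =>
      (A.exists_isDefDiff D).imp fun _ h => h.symm
  choose d hd using h
  refine ⟨d, fun n D D' => ⟨fun h' => ?_, fun h' => ?_⟩⟩
  · exact defFun_symbolFun_injective n ((hd n D).trans h')
  · subst h'
    exact (hd n D).symm

end Complexes

end LieAlgebroid

end LieAlgebroidDeformation

end

set_option maxHeartbeats 1000000 in
theorem mainTheorem3
    {E : Type*} [NormedAddCommGroup E] [NormedSpace ℝ E] [FiniteDimensional ℝ E]
    {F : Type*} [NormedAddCommGroup F] [NormedSpace ℝ F] [FiniteDimensional ℝ F]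
    {M : Type*} [TopologicalSpace M] [T2Space M] [SigmaCompactSpace M]
    [ChartedSpace E M] [IsManifold 𝓘(ℝ, E) ∞ M]
    {V : M → Type*} [TopologicalSpace (TotalSpace F V)] [∀ x, TopologicalSpace (V x)]
    [FiberBundle F V] [∀ x, AddCommGroup (V x)] [∀ x, Module ℝ (V x)] [VectorBundle ℝ F V]
    [ContMDiffVectorBundle ∞ F V 𝓘(ℝ, E)]
    (A : LieAlgebroidDeformation.LieAlgebroid E F V) (hA : A.IsRegular) :
    -- the maps `H^n(A; g(A)) → H_def^n(A) → H^{n-1}(A; ν) → H^{n+1}(A; g(A))`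
    ∃ (j : ∀ n, A.RepCoh A.isotropyConn n →ₗ[ℝ] A.DefCoh n)
      (p : ∀ n, A.DefCoh (n + 1) →ₗ[ℝ] A.RepCoh (A.bott hA) n)
      (δ : ∀ n, A.RepCoh (A.bott hA) n →ₗ[ℝ] A.RepCoh A.isotropyConn (n + 2)),
      -- `j` is induced by the inclusion of cochains
      (∀ n (η : A.repCocycles A.isotropyConn n),
        ∃ h : A.inclCochain n η ∈ A.defCocycles n,
          j n (A.repClass A.isotropyConn n η) = A.defClass n ⟨A.inclCochain n η, h⟩) ∧
      -- `p` is induced by the symbol modulo the image of the anchor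
      (∀ n (D : A.defCocycles (n + 1)),
        ∃ h : A.normalSymbol n D ∈ A.repCocycles (A.bott hA) n,
          p n (A.defClass (n + 1) D) = A.repClass (A.bott hA) n ⟨A.normalSymbol n D, h⟩) ∧
      -- `δ` is the connecting map: every cocycle `c` with values in `ν` is the class of the symbol
      -- of some `D` such that `δD` comes from a cocycle `η` with values in `g(A)`, and then
      -- `δ[c] = [η]`
      (∀ n (c : A.repCocycles (A.bott hA) n),
        ∃ (D : LieAlgebroidDeformation.LieAlgebroid.DefCochain E F V (n + 1))
          (η : A.repCocycles A.isotropyConn (n + 2)),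
          A.normalSymbol n D = c ∧ A.IsDefDiff D (A.inclCochain (n + 2) η)) ∧
      (∀ n (c : A.repCocycles (A.bott hA) n)
        (D : LieAlgebroidDeformation.LieAlgebroid.DefCochain E F V (n + 1))
        (η : A.repCocycles A.isotropyConn (n + 2)),
        A.normalSymbol n D = c → A.IsDefDiff D (A.inclCochain (n + 2) η) →
          δ n (A.repClass (A.bott hA) n c) = A.repClass A.isotropyConn (n + 2) η) ∧
      -- exactness; in low degrees the sequence is
      -- `0 → H^0(A; g(A)) → H_def^0(A) → 0 → H^1(A; g(A)) → H_def^1(A) → H^0(A; ν) → ⋯`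
      Function.Bijective (j 0) ∧
      Function.Injective (j 1) ∧
      (∀ n, Function.Exact (j (n + 1)) (p n)) ∧
      (∀ n, Function.Exact (p n) (δ n)) ∧
      (∀ n, Function.Exact (δ n) (j (n + 2))) ∧
      -- the transitive case
      (A.IsTransitive → ∀ n, Function.Bijective (j n)) := by
  obtain ⟨dG, hdG, hZG, hBG⟩ := A.isRepresentation_isotropyRep.exists_differential
  obtain ⟨dN, hdN, hZN, hBN⟩ := hA.isRepresentation_bottRep.exists_differential
  obtain ⟨dC, hdC⟩ := A.exists_deformation_differential
  have hZC : ∀ n x, x ∈ A.defCocycles n ↔ dC n x = 0 := fun n x =>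
    Iff.trans Iff.rfl (hdC n x 0)
  have hBC : ∀ n x, x ∈ A.defCoboundaries (n + 1) ↔ ∃ y, dC n y = x := fun n x =>
    exists_congr fun y => hdC n y x
  have hd : ∀ n D, A.IsDefDiff D (dC n D) := fun n D => (hdC n D _).2 rfl
  -- One statement feeds both comparison hypotheses below; the vanishing symbol of `D₀` supplies the
  -- condition that `D₀` has zero normal symbol.
  have hker : ∀ n (D : LieAlgebroidDeformation.LieAlgebroid.DefCochain E F V (n + 1)),
      A.normalSymbol n D = 0 →
      LieAlgebroidDeformation.LieAlgebroid.symbolFun (n + 1) (dC (n + 1) D) = 0 →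
      ∃ (D₀ : LieAlgebroidDeformation.LieAlgebroid.DefCochain E F V n) (θ : _),
        (LieAlgebroidDeformation.LieAlgebroid.defPair n D₀).2 = 0 ∧
          D - dC n D₀ = A.inclCochain (n + 1) θ := by
    intro n D h h'
    obtain ⟨D₀, B, η, hB, h₀, hη⟩ := (hd _ D).exists_sub_eq_inclCochain hA h h'
    rw [← (hdC n D₀ B).1 hB] at hη
    exact ⟨D₀, η, h₀, hη⟩
  obtain ⟨j, p, δ, hj, hp, hex, hδ, hj₀, hj₁, hjp, hpδ, hδj, htr⟩ :=
    LieAlgebroidDeformation.exists_long_exact_sequence dG dC dN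
      (fun n D => (hdC _ _ 0).1 (hd n D).defDiff_eq_zero)
      (A.repCocycles A.isotropyConn) (A.repCoboundaries A.isotropyConn)
      A.defCocycles A.defCoboundaries
      (A.repCocycles (A.bott hA)) (A.repCoboundaries (A.bott hA))
      hZG hZC hZN rfl hBG rfl hBC rfl hBN A.inclCochain A.normalSymbol
      A.inclCochain_injective
      (fun n η => ((hdC _ _ _).1 (A.isDefDiff_inclCochain (hdG n η))).symm)
      (fun n D => LieAlgebroidDeformation.LieAlgebroid.cochainFun_injective _
        (((hd _ D).cochainFun_normalSymbol hA).trans (hdN n _).symm))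
      (fun D => (hd 0 D).normalSymbol_zero)
      A.normalSymbol_inclCochain hA.normalSymbol_surjective
      (fun n D η h h' => by
        obtain ⟨D₀, θ, -, hθ⟩ := hker n D h (by rw [h', A.symbolFun_inclCochain])
        exact ⟨D₀, θ, hθ⟩)
      (fun n D h h' => by
        obtain ⟨D₀, θ, h₀, hθ⟩ := hker (n + 1) D h (by rw [h', map_zero])
        refine ⟨D₀, θ, (A.normalSymbol_eq_zero_iff D₀).2 fun s x => ?_, hθ⟩
        have h1 : LieAlgebroidDeformation.LieAlgebroid.symbol n D₀ = 0 := h₀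
        change LieAlgebroidDeformation.LieAlgebroid.symbol n D₀ s x ∈ _
        rw [h1]
        exact Submodule.zero_mem _)
      -- In degree zero `SymbolSpace` is a point, so the symbol vanishes by `rfl`, and `σ_{δβ} =
      -- -ρ(β) = 0` says that `β` lies in `Γ(g(A))`.
      (fun D η h => (hd 0 D).exists_inclCochain_eq rfl (by rw [h, A.symbolFun_inclCochain]))
  refine ⟨j, p, δ, hj, hp, fun n c => ?_, fun n c D η hc h => hδ n c D η hc ((hdC _ _ _).1 h),
    hj₀, hj₁, hjp, hpδ, hδj, fun h => htr h.subsingleton_cochain_normalSec⟩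
  obtain ⟨D, η, hc, h⟩ := hex n c
  exact ⟨D, η, hc, (hdC _ _ _).2 h⟩
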